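/- **Setting.** Let $d,N\ge 1$. Let $\chi\in C^\infty_c(\mathbb R^d,\mathbb R)$ be radial, supported in the closed unit ball, with $\int\chi^2=1$, and put $\chi_\epsilon(x)=\epsilon^{-d/2}\chi(x/\epsilon)$, $\chi_{\epsilon,z}(x)=\chi_\epsilon(x-z)$. For $r\in\mathbb R$ let $D^c_r=\{X=(x_1,\dots,x_N)\in(\mathbb R^d)^N:\ |x_i-x_j|\ge r\ \ \forall i\ne j\}$. Let $\mathbb P$ be a probability measure on $(\mathbb R^d)^N$, invariant under permutations of the $N$ variables, with $\mathbb P(D^c_\alpha)=1$ for some $\alpha>0$. Assume that its one-particle marginal (the law of $x_1$, of total mass $1$) has a density $\rho=\rho_{\mathbb P}$ with $\sqrt\rho\in H^1(\mathbb R^d)$. For $Y=(y_1,\dots,y_N)$, $Z=(z_1,\dots,z_N)$ put $$w_\epsilon(Y,Z)=\prod_{k=1}^N\frac{\chi_\epsilon(z_k-y_k)^2}{(\rho*\chi_\epsilon^2)(z_k)}$$ (with $0/0=0$). Let $\mathbb P_\epsilon$ be the measure on $(\mathbb R^d)^N$ with density $$X\mapsto\iint\prod_{k=1}^N\rho(x_k)\chi_\epsilon(x_k-z_k)^2\;w_\epsilon(Y,Z)\,d\mathbb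 P(Y)\,dZ .$$ Let $L^2_a$ be the complex Hilbert space of antisymmetric functions in $L^2((\mathbb R^d)^N)$, let $$\Psi_Z=(\sqrt\rho\,\chi_{\epsilon,z_1})\wedge\cdots\wedge(\sqrt\rho\,\chi_{\epsilon,z_N}),\qquad (\phi_1\wedge\dots\wedge\phi_N)(X)=\frac1{\sqrt{N!}}\sum_\sigma\operatorname{sgn}(\sigma)\prod_{k}\phi_{\sigma(k)}(x_k),$$ and let $$\Gamma_\epsilon=\iint w_\epsilon(Y,Z)\,|\Psi_Z\rangle\langle\Psi_Z|\,d\mathbb P(Y)\,dZ,$$ an operator on $L^2_a$. For $\Gamma\ge0$ and a self-adjoint operator $A\ge0$, $\mathrm{Tr}(A\Gamma)=\sum_i\langle\Gamma^{1/2}b_i,A\,\Gamma^{1/2}b_i\rangle\in[0,\infty]$ for an orthonormal basis $(b_i)$ of $L^2_a$, where $\langle\psi,A\psi\rangle$ is the quadratic form of $A$; for $A=-\Delta$ it is $\sum_j\int|\nabla_j\psi|^2$, and $+\infty$ if $\psi\notin H^1$. Likewise, for multiplication by a real function $\Phi$, $\mathrm{Tr}(\Phi\Gamma)=\sum_i\int\Phi\,|\Gamma^{1/2}b_i|^2$,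 when the integrals and the sum converge absolutely. **Theorem.** Let $0<\epsilon<\alpha/4$. 1. The integral defining $\Gamma_\epsilon$ converges absolutely in operator norm, $\Gamma_\epsilon\ge0$, $\mathrm{Tr}\,\Gamma_\epsilon=1$, and $\Gamma_\epsilon$ has one-particle density $\rho$, that is, $\mathrm{Tr}(\phi(x_1)\Gamma_\epsilon)=\int_{\mathbb R^d}\phi\rho$ for every real $\phi\in L^\infty(\mathbb R^d)$. Moreover, $\mathbb P_\epsilon$ is a probability measure with $\mathbb P_\epsilon(D^c_{\alpha-4\epsilon})=1$. 2. $$\mathrm{Tr}(-\Delta)\Gamma_\epsilon=N\left(\int_{\mathbb R^d}|\nabla\sqrt{\rho}|^2+\frac1{\epsilon^2}\int_{\mathbb R^d}|\nabla\chi|^2\right).$$ 3. The weak gradient $\nabla\rho$ exists and is integrable. Let $\Phi:D^c_{\alpha-4\epsilon}\to\mathbb R$ be a symmetric function of class $C^2$ (up to the boundary). If $\Phi$ is $\mathbb P_\epsilon$-integrable, then $\mathrm{Tr}(\Phi\Gamma_\epsilon)=\int\Phi\,d\mathbb P_\epsilon$. If all $\nabla_j\Phi$ are bounded on $D^c_{\alpha-4\epsilon}$,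 then $\Phi$ is $\mathbb P_\epsilon$-integrable if and only if it is $\mathbb P$-integrable. If $\Phi$ is integrable for both measures, then $$\left|\int\Phi\,d\mathbb P_\epsilon-\int\Phi\,d\mathbb P\right|\le\epsilon^2\left\{\sum_{j=1}^N\|\nabla_j\Phi\|_{L^\infty(D^c_{\alpha-4\epsilon})}\left(\int_{\mathbb R^d}|\nabla\rho|\right)\left(\int_{\mathbb R^d}|u|^2\chi(u)^2\,du\right)+2\sum_{j,k=1}^N\|\nabla_j\nabla_k\Phi\|_{L^\infty(D^c_{\alpha-4\epsilon})}\right\},$$ where the size of the matrix $\nabla_j\nabla_k\Phi(X)$ is its operator norm and the right side may be $+\infty$. 4. As $\epsilon\to0^+$, $\mathbb P_\epsilon\rightharpoonup\mathbb P$: $\int f\,d\mathbb P_\epsilon\to\int f\,d\mathbb P$ for every bounded continuous $f$ on $(\mathbb R^d)^N$. -/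

import Mathlib

open MeasureTheory Filter Topology
open scoped ENNReal ContDiff

noncomputable section

namespace FermionicRegularization

/-! ### Configurations -/

/-- The one-particle space `ℝ^d` with its Euclidean norm. -/
abbrev Space (d : ℕ) : Type := EuclideanSpace ℝ (Fin d)

/-- Configurations of `N` particles in `ℝ^d`, with Lebesgue measure as `volume`. -/
abbrev Config (N d : ℕ) : Type := Fin N → Space d

/-- The closed set of configurations whose interparticle distances are all at least `r`. -/
def separated (N d : ℕ) (r : ℝ) : Set (Config N d) :=
  {X | ∀ i j, i ≠ j → r ≤ ‖X i - X j‖}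

/-- `P` is invariant under permutations of the particles. -/
def IsSymmetricMeasure {N d : ℕ} (P : Measure (Config N d)) : Prop :=
  ∀ σ : Equiv.Perm (Fin N), P.map (fun X => X ∘ σ) = P

/-- `ρ` is (a measurable non-negative representative of) the density of the one-particle
marginal of `P`. -/
structure IsMarginalDensity {N d : ℕ} [NeZero N] (P : Measure (Config N d))
    (ρ : Space d → ℝ) : Prop where
  measurable : Measurable ρ
  nonneg : ∀ x, 0 ≤ ρ x
  marginal_eq : P.map (fun X => X 0) = volume.withDensity (fun x => ENNReal.ofReal (ρ x))

/-! ### Weak derivatives -/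

/-- `G` is the weak (distributional) derivative of `f`. -/
structure HasWeakFDeriv {V F : Type*} [NormedAddCommGroup V] [NormedSpace ℝ V]
    [MeasureSpace V] [NormedAddCommGroup F] [NormedSpace ℝ F]
    (f : V → F) (G : V → V →L[ℝ] F) : Prop where
  locallyIntegrable : LocallyIntegrable f volume
  locallyIntegrable_deriv : LocallyIntegrable G volume
  integral_eq : ∀ φ : V → ℝ, ContDiff ℝ ∞ φ → HasCompactSupport φ → ∀ v : V,
    ∫ x, (fderiv ℝ φ x v) • f x = - ∫ x, φ x • G x v

open Classical in
/-- A representative of the weak derivative of `f` (zero if there is none). On `ℝ^d`, and for a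
real-valued `f`, `‖weakFDeriv f x‖` is the Euclidean norm `|∇f(x)|`. -/
def weakFDeriv {V F : Type*} [NormedAddCommGroup V] [NormedSpace ℝ V]
    [MeasureSpace V] [NormedAddCommGroup F] [NormedSpace ℝ F] (f : V → F) : V → V →L[ℝ] F :=
  if h : ∃ G, HasWeakFDeriv f G then h.choose else 0

/-- The Sobolev space `H¹`: square-integrable functions with a square-integrable weak
derivative. -/
def MemH1 {d : ℕ} (f : Space d → ℝ) : Prop :=
  MemLp f 2 volume ∧ ∃ G, HasWeakFDeriv f G ∧ MemLp G 2 volume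

/-! ### The fermionic space -/

/-- Permuting the particles preserves Lebesgue measure. -/
theorem measurePreserving_comp_perm {N d : ℕ} (σ : Equiv.Perm (Fin N)) :
    MeasurePreserving (fun X : Config N d => X ∘ σ) volume volume := by
  have h := volume_measurePreserving_piCongrLeft (fun _ : Fin N => Space d) σ.symm
  have e : (fun X : Config N d => X ∘ σ)
      = MeasurableEquiv.piCongrLeft (fun _ : Fin N => Space d) σ.symm := by
    funext X i
    have := MeasurableEquiv.piCongrLeft_apply_apply (β := fun _ : Fin N => Space d) σ.symm X (σ i)
    simpa using this.symm
  rw [e]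
  exact h

/-- The action `ψ ↦ ψ ∘ σ` of a permutation of the particles on `L²((ℝ^d)^N)`. -/
def permute {N d : ℕ} (σ : Equiv.Perm (Fin N)) :
    Lp ℂ 2 (volume : Measure (Config N d)) →ₗᵢ[ℂ] Lp ℂ 2 (volume : Measure (Config N d)) :=
  Lp.compMeasurePreservingₗᵢ ℂ (fun X : Config N d => X ∘ σ) (measurePreserving_comp_perm σ)

/-- The subspace of antisymmetric functions in `L²((ℝ^d)^N)`. -/
def antisymmetric (N d : ℕ) : Submodule ℂ (Lp ℂ 2 (volume : Measure (Config N d))) where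
  carrier := {ψ | ∀ σ : Equiv.Perm (Fin N),
    permute σ ψ = (((Equiv.Perm.sign σ : ℤˣ) : ℤ) : ℂ) • ψ}
  add_mem' := by
    intro a b ha hb σ
    rw [map_add, ha σ, hb σ, smul_add]
  zero_mem' := by
    intro σ
    rw [map_zero, smul_zero]
  smul_mem' := by
    intro c a ha σ
    rw [map_smul, ha σ, smul_comm]

instance antisymmetric_completeSpace (N d : ℕ) : CompleteSpace (antisymmetric N d) := by
  have h : IsClosed (antisymmetric N d : Set (Lp ℂ 2 (volume : Measure (Config N d)))) := by
    have e : (antisymmetric N d : Set (Lp ℂ 2 (volume : Measure (Config N d)))) =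
        ⋂ σ : Equiv.Perm (Fin N), {ψ | permute σ ψ = (((Equiv.Perm.sign σ : ℤˣ) : ℤ) : ℂ) • ψ} := by
      ext ψ
      simp [antisymmetric]
    rw [e]
    exact isClosed_iInter fun σ =>
      isClosed_eq (permute σ).continuous (continuous_const_smul _)
  exact h.completeSpace_coe

/-- The fermionic Hilbert space `L²_a((ℝ^d)^N)`: the antisymmetric subspace, as a type. -/
def Fermionic (N d : ℕ) : Type := antisymmetric N d

instance (N d : ℕ) : NormedAddCommGroup (Fermionic N d) :=
  inferInstanceAs (NormedAddCommGroup (antisymmetric N d))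

instance (N d : ℕ) : InnerProductSpace ℂ (Fermionic N d) :=
  inferInstanceAs (InnerProductSpace ℂ (antisymmetric N d))

instance (N d : ℕ) : CompleteSpace (Fermionic N d) :=
  inferInstanceAs (CompleteSpace (antisymmetric N d))

/-- The underlying element of `L²((ℝ^d)^N)` of a fermionic wave function. -/
def Fermionic.toL2 {N d : ℕ} (ψ : Fermionic N d) : Lp ℂ 2 (volume : Measure (Config N d)) :=
  Subtype.val (p := fun ψ => ψ ∈ antisymmetric N d) ψ

/-- The Slater determinant `φ₁ ∧ ⋯ ∧ φ_N` as a function of the configuration: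
`(N!)^{-1/2} ∑_σ sign(σ) ∏_k φ_{σ(k)}(x_k)`. -/
def slaterFun {N d : ℕ} (φ : Fin N → Space d → ℂ) (X : Config N d) : ℂ :=
  ((Real.sqrt (Nat.factorial N : ℝ) : ℝ) : ℂ)⁻¹ *
    ∑ σ : Equiv.Perm (Fin N), (((Equiv.Perm.sign σ : ℤˣ) : ℤ) : ℂ) * ∏ k, φ (σ k) (X k)

theorem slaterFun_comp_perm {N d : ℕ} (φ : Fin N → Space d → ℂ) (X : Config N d)
    (τ : Equiv.Perm (Fin N)) :
    slaterFun φ (X ∘ τ) = (((Equiv.Perm.sign τ : ℤˣ) : ℤ) : ℂ) * slaterFun φ X := by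
  have hdet : ∀ Y : Config N d, ∑ σ : Equiv.Perm (Fin N),
      (((Equiv.Perm.sign σ : ℤˣ) : ℤ) : ℂ) * ∏ k, φ (σ k) (Y k)
        = (Matrix.of fun i j => φ i (Y j)).det := by
    intro Y
    rw [Matrix.det_apply']
    rfl
  have h2 : (Matrix.of fun i j => φ i ((X ∘ τ) j))
      = (Matrix.of fun i j => φ i (X j)).submatrix id τ := rfl
  unfold slaterFun
  rw [hdet, hdet, h2, Matrix.det_permute']
  ring

open Classical in
/-- The Slater determinant `φ₁ ∧ ⋯ ∧ φ_N` as an element of the fermionic space (zero if it is not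
square-integrable; it always is when the `φ_k` are in `L²`). -/
def slater {N d : ℕ} (φ : Fin N → Space d → ℂ) : Fermionic N d :=
  if h : MemLp (slaterFun φ) 2 (volume : Measure (Config N d)) then
    ⟨h.toLp (slaterFun φ), by
      intro σ
      refine Lp.ext ?_
      refine (Lp.coeFn_compMeasurePreserving _ (measurePreserving_comp_perm σ)).trans ?_
      refine ((measurePreserving_comp_perm σ).quasiMeasurePreserving.ae_eq_comp
        h.coeFn_toLp).trans ?_
      refine EventuallyEq.trans ?_ (Lp.coeFn_smul _ _).symm
      filter_upwards [h.coeFn_toLp] with X hX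
      simp only [Function.comp_def, Pi.smul_apply, smul_eq_mul]
      rw [hX]
      exact slaterFun_comp_perm φ X σ⟩
  else 0

/-! ### The regularized classical and quantum states -/

/-- `χ_ε(x) = ε^{-d/2} χ(x/ε)`. -/
def rescale {d : ℕ} (χ : Space d → ℝ) (ε : ℝ) (x : Space d) : ℝ :=
  ε ^ (-(d : ℝ) / 2) * χ (ε⁻¹ • x)

/-- `(ρ ∗ χ_ε²)(z)`. -/
def smoothed {d : ℕ} (ρ χ : Space d → ℝ) (ε : ℝ) (z : Space d) : ℝ :=
  ∫ x, ρ x * rescale χ ε (z - x) ^ 2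

/-- The weight `∏_k χ_ε(z_k - y_k)² / (ρ ∗ χ_ε²)(z_k)`. -/
def weight {N d : ℕ} (ρ χ : Space d → ℝ) (ε : ℝ) (Y Z : Config N d) : ℝ :=
  ∏ k, rescale χ ε (Z k - Y k) ^ 2 / smoothed ρ χ ε (Z k)

/-- The regularized probability `P_ε`, with density
`∬ ∏_k ρ(x_k) χ_ε(x_k-z_k)² χ_ε(z_k-y_k)² / (ρ ∗ χ_ε²)(z_k) dP(Y) dZ`. -/
def regularizedMeasure {N d : ℕ} (P : Measure (Config N d)) (ρ χ : Space d → ℝ) (ε : ℝ) :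
    Measure (Config N d) :=
  volume.withDensity fun X => ∫⁻ q : Config N d × Config N d,
    ENNReal.ofReal ((∏ k, ρ (X k) * rescale χ ε (X k - q.2 k) ^ 2) * weight ρ χ ε q.1 q.2)
    ∂(P.prod volume)

/-- The unnormalized state `√ρ^{⊗N} (χ_{ε,z₁} ∧ ⋯ ∧ χ_{ε,z_N})`, which is the Slater determinant
of the functions `√ρ χ_{ε,z_k}`. -/
def trialVector {N d : ℕ} (ρ χ : Space d → ℝ) (ε : ℝ) (Z : Config N d) : Fermionic N d :=
  slater fun k x => ((Real.sqrt (ρ x) * rescale χ ε (x - Z k) : ℝ) : ℂ)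

/-- The operator-valued integrand of `Γ_ε`: the weight times the rank-one operator
`|Ψ_Z⟩⟨Ψ_Z|`, at the point `q = (Y, Z)`. -/
def stateIntegrand {N d : ℕ} (ρ χ : Space d → ℝ) (ε : ℝ) (q : Config N d × Config N d) :
    Fermionic N d →L[ℂ] Fermionic N d :=
  ((weight ρ χ ε q.1 q.2 : ℝ) : ℂ) •
    InnerProductSpace.rankOne ℂ (trialVector ρ χ ε q.2) (trialVector ρ χ ε q.2)

/-- The mixed state `Γ_ε`, an integral of rank-one operators on the fermionic space (a Bochner
integral in operator norm). -/
def quantumState {N d : ℕ} (P : Measure (Config N d)) (ρ χ : Space d → ℝ) (ε : ℝ) :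
    Fermionic N d →L[ℂ] Fermionic N d :=
  ∫ q, stateIntegrand ρ χ ε q ∂(P.prod volume)

/-! ### Traces against a non-negative operator `Γ`

For `A ≥ 0` the trace `Tr(A Γ)` is `Tr(Γ^{1/2} A Γ^{1/2}) = ∑ᵢ ⟨Γ^{1/2} bᵢ, A Γ^{1/2} bᵢ⟩`
in `[0, ∞]`, where `⟨ψ, A ψ⟩` is the quadratic form of `A`, equal to `∞` outside of the form
domain, and `b` is an orthonormal basis. -/

/-- The quadratic form of `-Δ` on `(ℝ^d)^N`: `∑_j ∫ |∇_j ψ|²` if `ψ` has a weak derivative, and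
`∞` otherwise (weak derivatives are unique almost everywhere, so that the infimum is over at most
one value). -/
def kineticForm {N d : ℕ} (ψ : Config N d → ℂ) : ℝ≥0∞ :=
  ⨅ (G : Config N d → Config N d →L[ℝ] ℂ) (_ : HasWeakFDeriv ψ G),
    ∫⁻ X, ∑ j : Fin N, ∑ a : Fin d,
      ‖G X (Pi.single j (EuclideanSpace.single a (1 : ℝ)))‖ₑ ^ 2

/-- `Tr((-Δ) Γ)` for `Γ ≥ 0`, computed in the orthonormal basis `b`. -/
def kineticTrace {N d : ℕ} {ι : Type*} (b : HilbertBasis ι ℂ (Fermionic N d))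
    (Γ : Fermionic N d →L[ℂ] Fermionic N d) : ℝ≥0∞ :=
  ∑' i, kineticForm (CFC.sqrt Γ (b i)).toL2

/-- `Tr(Φ Γ)` exists (absolutely) and equals `t`, for `Γ ≥ 0` and for the operator of
multiplication by the real function `Φ`; the trace is computed in the orthonormal basis `b`. -/
def HasMulTrace {N d : ℕ} {ι : Type*} (b : HilbertBasis ι ℂ (Fermionic N d))
    (Φ : Config N d → ℝ) (Γ : Fermionic N d →L[ℂ] Fermionic N d) (t : ℝ) : Prop :=
  (∀ i, Integrable (fun X => Φ X * ‖(CFC.sqrt Γ (b i)).toL2 X‖ ^ 2) volume) ∧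
  Summable (fun i => ∫ X, |Φ X| * ‖(CFC.sqrt Γ (b i)).toL2 X‖ ^ 2) ∧
  HasSum (fun i => ∫ X, Φ X * ‖(CFC.sqrt Γ (b i)).toL2 X‖ ^ 2) t

/-- `ρ` is the one-particle density of `Γ`: `Tr(φ(x₁) Γ) = ∫ φ ρ` for all `φ ∈ L^∞(ℝ^d)`. -/
def HasOneParticleDensity {N d : ℕ} [NeZero N] {ι : Type*}
    (b : HilbertBasis ι ℂ (Fermionic N d)) (Γ : Fermionic N d →L[ℂ] Fermionic N d)
    (ρ : Space d → ℝ) : Prop :=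
  Integrable ρ volume ∧ ∀ φ : Space d → ℝ, MemLp φ ⊤ volume →
    HasMulTrace b (fun X => φ (X 0)) Γ (∫ x, φ x * ρ x)

/-! ### Observables on a set of configurations -/

/-- The gradient `∇_j f` in the position of the `j`-th particle, relative to the set `S`. -/
def gradWithin {N d : ℕ} {F : Type*} [NormedAddCommGroup F] [NormedSpace ℝ F]
    (S : Set (Config N d)) (j : Fin N) (f : Config N d → F) (X : Config N d) :
    Space d →L[ℝ] F :=
  (fderivWithin ℝ f S X).comp (ContinuousLinearMap.single ℝ (fun _ : Fin N => Space d) j)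

/-- The supremum over `S` of the norm of `f`, in `[0, ∞]`. -/
def supNorm {N d : ℕ} {F : Type*} [NormedAddCommGroup F] (S : Set (Config N d))
    (f : Config N d → F) : ℝ≥0∞ :=
  ⨆ X ∈ S, ‖f X‖ₑ

/-- The function `Φ` is invariant under permutations of the particles on the set `S`. -/
def IsSymmetricOn {N d : ℕ} (S : Set (Config N d)) (Φ : Config N d → ℝ) : Prop :=
  ∀ σ : Equiv.Perm (Fin N), ∀ X ∈ S, Φ (X ∘ σ) = Φ X

end FermionicRegularization

end

open FermionicRegularization

/-!
The regularized measure `P_ε` is the second marginal of the law of a pair `(Y, X)` (`coupling`).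
Here `Y` has law `P`, and given `Y`, each particle moves independently, from `y` to a smeared
position `z` with law `χ_ε(z - y)² dz`, and then from `z` to a point `x` drawn from the conditional
law of a particle of density `ρ` given its smeared position `z`. The transition from `y` to `x` has
a probability density (`IsCutoff.lintegral_transition`), it leaves `ρ` stationary
(`IsCutoff.lintegral_transition_mul`), and it moves a particle by at most `2ε`. Hence `P_ε` is a
probability with one-particle density `ρ`, and it lives on configurations with distances at least
`α - 4ε`.

For the potential energy, Taylor's formula is applied along the segment from `Y` to `X`
(`ofReal_abs_integral_sub_le`). The second-order terms are bounded by the displacement `2ε`. In the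
first-order terms only the mean displacement of each particle matters, given `Y`
(`enorm_integral_displacement_le`). The step from `y` to `z` has mean zero, because `χ` is even; for
the same reason `∫ ρ(z + u) χ_ε(u)² u du` does not change if `ρ(z + u)` is replaced by
`ρ(z + u) - ρ(z)`, and `∫ |ρ(z + u) - ρ(z)| dz ≤ |u| ∫ |∇ρ|` gives the second power of `ε`. Here
`∇ρ = 2 √ρ ∇√ρ`, by Leibniz' rule for weak derivatives (`IsWeakLineDeriv.sq`). Weak convergence is
tested with Lipschitz functions (`tendsto_integral_regularizedMeasure`).

For the quantum state, the points `z_k` that carry weight are more than `2ε` apart, so that the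
orbitals `√ρ χ_{ε,z_k}` have disjoint supports and the exchange terms in the square of the Slater
determinant vanish (`enorm_slaterAt_sq`). By the symmetry of `P`, the density of `Γ_ε` in
configuration space is then that of `P_ε` (`lintegral_mixWeight_mul_enorm_slaterAt_sq`). The kinetic
energy reduces in the same way to that of the single orbitals; averaged over `z`, it splits into
`∫ |∇√ρ|²` and `∫ |∇χ_ε|²`, since the cross term is the integral of an odd function
(`IsCutoff.sum_lintegral_orbitalDeriv_sq`).

The traces are defined through the vectors `Γ^{1/2} bᵢ` of a basis, not through the mixture
`∬ w_ε |Ψ_Z⟩⟨Ψ_Z|`. The two are related by `exists_trace_formula`, which holds for possibly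
unbounded operators and yields, along with the value of the trace, that the vectors `Γ^{1/2} bᵢ` are
in the form domain. With restrictions to measurable sets it gives all traces of multiplication
operators (`hasMulTrace_quantumState`), with partial derivatives the kinetic energy
(`kineticTrace_quantumState`).
-/

open FermionicRegularization

/-! ### Integrals over finite products -/

/-- Tonelli's theorem for a product of functions of one variable each. -/
theorem lintegral_pi_prod {n : ℕ} {E : Type*} [MeasurableSpace E] (μ : Fin n → Measure E)
    [∀ i, SigmaFinite (μ i)] (f : Fin n → E → ℝ≥0∞) (hf : ∀ i, Measurable (f i)) :
    ∫⁻ x : Fin n → E, ∏ i, f i (x i) ∂(Measure.pi μ) = ∏ i, ∫⁻ x, f i x ∂(μ i) := by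
  induction n with
  | zero => simp
  | succ n ih =>
    have hmp := (measurePreserving_piFinSuccAbove μ 0).symm
    rw [← hmp.lintegral_comp_emb (MeasurableEquiv.measurableEmbedding _)]
    simp only [MeasurableEquiv.piFinSuccAbove_symm_apply, Fin.insertNthEquiv,
      Fin.prod_univ_succ, Fin.insertNth_zero, Equiv.coe_fn_mk, Fin.cons_succ,
      Fin.zero_succAbove, cast_eq, Fin.cons_zero]
    rw [← ih (fun i => μ i.succ) (fun i => f i.succ) fun i => hf _]
    exact lintegral_prod_mul (hf 0).aemeasurable
      (Finset.measurable_prod _ fun i _ => (hf _).comp (measurable_pi_apply i)).aemeasurable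

/-- A product density with respect to a product measure defines the product of the measures with
the individual densities. -/
theorem withDensity_prod_eq_pi {n : ℕ} {E : Type*} [MeasurableSpace E] (μ : Measure E)
    [SigmaFinite μ] (f : Fin n → E → ℝ≥0∞) (hf : ∀ i, Measurable (f i))
    [∀ i, SigmaFinite (μ.withDensity (f i))] :
    (Measure.pi fun _ => μ).withDensity (fun x : Fin n → E => ∏ i, f i (x i))
      = Measure.pi fun i => μ.withDensity (f i) := by
  refine (Measure.pi_eq fun s hs => ?_).symm
  rw [withDensity_apply _ (MeasurableSet.univ_pi hs),
    ← lintegral_indicator (MeasurableSet.univ_pi hs)]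
  have : (Set.univ.pi s).indicator (fun x : Fin n → E => ∏ i, f i (x i))
      = fun x => ∏ i, (s i).indicator (f i) (x i) := by
    funext x
    by_cases hx : x ∈ Set.univ.pi s
    · rw [Set.indicator_of_mem hx]
      exact Finset.prod_congr rfl fun i _ =>
        (Set.indicator_of_mem (hx i (Set.mem_univ i)) _).symm
    · rw [Set.indicator_of_notMem hx]
      simp only [Set.mem_pi, Set.mem_univ, true_imp_iff, not_forall] at hx
      obtain ⟨i, hi⟩ := hx
      exact (Finset.prod_eq_zero (Finset.mem_univ i) (Set.indicator_of_notMem hi _)).symm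
  rw [this, lintegral_pi_prod _ _ fun i => (hf i).indicator (hs i)]
  exact Finset.prod_congr rfl fun i _ => by
    rw [lintegral_indicator (hs i), withDensity_apply _ (hs i)]

/-! ### Hilbert bases, weak measurability and traces -/

/-- The vectors of a Hilbert basis are at mutual distance at least one. -/
theorem HilbertBasis.countable_of_secondCountable {ι K : Type*} [NormedAddCommGroup K]
    [InnerProductSpace ℂ K] [SecondCountableTopology K] (e : HilbertBasis ι ℂ K) :
    Countable ι := by
  have hd : ∀ i j, i ≠ j → 1 ≤ ‖e i - e j‖ := by
    intro i j hij
    have h1 := e.orthonormal.1 i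
    have h2 : inner ℂ (e i) (e i - e j) = 1 := by
      rw [inner_sub_right, e.orthonormal.2 hij, inner_self_eq_norm_sq_to_K, h1]
      simp
    have h3 := norm_inner_le_norm (𝕜 := ℂ) (e i) (e i - e j)
    rw [h2, h1] at h3
    simpa using h3
  obtain ⟨s, hs, hds⟩ := TopologicalSpace.exists_countable_dense K
  choose f hf using fun i => hds.exists_dist_lt (e i) (ε := 1 / 2) (by norm_num)
  have := hs.to_subtype
  refine Function.Injective.countable (f := fun i => (⟨f i, (hf i).1⟩ : s)) fun i j hij => ?_
  by_contra hne
  have h := hd i j hne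
  have hij' : f i = f j := congrArg Subtype.val hij
  have h4 := dist_triangle_right (e i) (e j) (f i)
  have h5 := (hf i).2
  have h6 := (hf j).2
  rw [← hij'] at h6
  rw [dist_eq_norm] at h4
  linarith

/-- Parseval's identity in `[0, ∞]`. -/
theorem HilbertBasis.tsum_enorm_inner_sq {ι K : Type*} [NormedAddCommGroup K]
    [InnerProductSpace ℂ K] (e : HilbertBasis ι ℂ K) (x : K) :
    ∑' i, ‖inner ℂ (e i) x‖ₑ ^ 2 = ‖x‖ₑ ^ 2 := by
  have h := e.hasSum_inner_mul_inner x x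
  have h2 : HasSum (fun i => ‖inner ℂ (e i) x‖ ^ 2) (‖x‖ ^ 2) := by
    have h3 := Complex.hasSum_re h
    convert! h3 using 1
    · funext i
      rw [← inner_conj_symm x (e i), ← Complex.normSq_eq_conj_mul_self, Complex.ofReal_re,
        Complex.normSq_eq_norm_sq]
    · rw [inner_self_eq_norm_sq_to_K]
      norm_cast
  have h4 : ∀ y : K, ‖y‖ₑ ^ 2 = ENNReal.ofReal (‖y‖ ^ 2) := fun y => by
    rw [← ofReal_norm, ENNReal.ofReal_pow (norm_nonneg _)]
  have h5 : ∀ y : ℂ, ‖y‖ₑ ^ 2 = ENNReal.ofReal (‖y‖ ^ 2) := fun y => by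
    rw [← ofReal_norm, ENNReal.ofReal_pow (norm_nonneg _)]
  rw [h4, ← h2.tsum_eq, ENNReal.ofReal_tsum_of_nonneg (fun _ => by positivity) h2.summable]
  exact tsum_congr fun i => h5 _

/-- A weakly measurable map into a separable Hilbert space is strongly measurable. -/
theorem stronglyMeasurable_of_inner {Q K : Type*} [MeasurableSpace Q] [NormedAddCommGroup K]
    [InnerProductSpace ℂ K] [CompleteSpace K] [SecondCountableTopology K] (f : Q → K)
    (hf : ∀ x, Measurable fun q => inner ℂ x (f q)) : StronglyMeasurable f := by
  obtain ⟨w, e, -⟩ := exists_hilbertBasis ℂ K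
  have := e.countable_of_secondCountable
  refine stronglyMeasurable_of_tendsto (atTop : Filter (Finset w))
    (f := fun s q => ∑ i ∈ s, (inner ℂ (e i) (f q)) • e i) (fun s => ?_) ?_
  · exact Finset.stronglyMeasurable_fun_sum _ fun i _ =>
      (hf (e i)).stronglyMeasurable.smul stronglyMeasurable_const
  · rw [tendsto_pi_nhds]
    intro q
    have := e.hasSum_repr (f q)
    simp only [HilbertBasis.repr_apply_apply] at this
    exact this

theorem inner_sqrt_left {H : Type*} [NormedAddCommGroup H] [InnerProductSpace ℂ H]
    [CompleteSpace H] (Γ : H →L[ℂ] H) (x y : H) :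
    inner ℂ (CFC.sqrt Γ x) y = inner ℂ x (CFC.sqrt Γ y) :=
  ((ContinuousLinearMap.nonneg_iff_isPositive _).1 (CFC.sqrt_nonneg Γ)).isSymmetric _ _

theorem inner_apply_eq_norm_sqrt_sq {H : Type*} [NormedAddCommGroup H] [InnerProductSpace ℂ H]
    [CompleteSpace H] {Γ : H →L[ℂ] H} (hΓ : 0 ≤ Γ) (x : H) :
    inner ℂ x (Γ x) = ((‖CFC.sqrt Γ x‖ ^ 2 : ℝ) : ℂ) := by
  have h1 : CFC.sqrt Γ (CFC.sqrt Γ x) = Γ x :=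
    congrArg (fun T : H →L[ℂ] H => T x) (CFC.sqrt_mul_sqrt_self Γ hΓ)
  rw [← h1, ← inner_sqrt_left, inner_self_eq_norm_sq_to_K]
  norm_cast

theorem enorm_inner_le {K : Type*} [NormedAddCommGroup K] [InnerProductSpace ℂ K] (x y : K) :
    ‖inner ℂ x y‖ₑ ≤ ‖x‖ₑ * ‖y‖ₑ := by
  simp only [← ofReal_norm]
  rw [← ENNReal.ofReal_mul (norm_nonneg _)]
  exact ENNReal.ofReal_le_ofReal (norm_inner_le_norm _ _)

/-- The trace of a possibly unbounded quadratic form against a mixture `Γ = ∫ W |Ψ⟩⟨Ψ|`.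
The operator `B`, formally the adjoint of `A ∘ e⁻¹`, has `Ψ' = B Ψ`; if `∫ W ‖B Ψ‖²` is finite
then `B` is defined on the range of `√Γ`, and `∑ᵢ ‖B √Γ bᵢ‖² = ∫ W ‖B Ψ‖²`. -/
theorem exists_trace_formula {H K V Q ι : Type*} [NormedAddCommGroup H] [InnerProductSpace ℂ H]
    [CompleteSpace H] [NormedAddCommGroup K] [InnerProductSpace ℂ K] [CompleteSpace K]
    [SecondCountableTopology K] [SecondCountableTopology H] [AddCommGroup V] [Module ℂ V]
    [MeasurableSpace Q] {μ : Measure Q} {W : Q → ℝ≥0∞} (hW : Measurable W)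
    {Γ : H →L[ℂ] H} (hΓ : 0 ≤ Γ) {Ψ : Q → H} {Ψ' : Q → K}
    (hform : ∀ x, ENNReal.ofReal (inner ℂ x (Γ x)).re = ∫⁻ q, W q * ‖inner ℂ (Ψ q) x‖ₑ ^ 2 ∂μ)
    (hΨ' : ∀ x, Measurable fun q => inner ℂ x (Ψ' q))
    (e : V →ₗ[ℂ] K) (he : DenseRange e) (A : V →ₗ[ℂ] H)
    (hA : ∀ v, ∀ᵐ q ∂μ, W q ≠ 0 → inner ℂ (Ψ q) (A v) = inner ℂ (Ψ' q) (e v))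
    (hE : ∫⁻ q, W q * ‖Ψ' q‖ₑ ^ 2 ∂μ ≠ ⊤) (b : HilbertBasis ι ℂ H) :
    ∃ G : ι → K, (∀ i v, inner ℂ (CFC.sqrt Γ (b i)) (A v) = inner ℂ (G i) (e v)) ∧
      ∑' i, ‖G i‖ₑ ^ 2 = ∫⁻ q, W q * ‖Ψ' q‖ₑ ^ 2 ∂μ := by
  borelize K
  set E := ∫⁻ q, W q * ‖Ψ' q‖ₑ ^ 2 ∂μ with hEdef
  have hΨ'm : Measurable Ψ' := (stronglyMeasurable_of_inner Ψ' hΨ').measurable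
  have hinner : ∀ x, Measurable fun q => inner ℂ (Ψ' q) x := fun x =>
    hΨ'm.inner measurable_const
  let T : V →ₗ[ℂ] H := (CFC.sqrt Γ).toLinearMap ∘ₗ A
  have hT : ∀ v, ‖T v‖ₑ ^ 2 = ∫⁻ q, W q * ‖inner ℂ (Ψ' q) (e v)‖ₑ ^ 2 ∂μ := by
    intro v
    have h1 : ‖T v‖ₑ ^ 2 = ENNReal.ofReal (‖T v‖ ^ 2) := by
      rw [← ofReal_norm, ENNReal.ofReal_pow (norm_nonneg _)]
    have h2 : ‖T v‖ ^ 2 = (inner ℂ (A v) (Γ (A v))).re := by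
      rw [inner_apply_eq_norm_sqrt_sq hΓ, Complex.ofReal_re]
      rfl
    rw [h1, h2, hform]
    refine lintegral_congr_ae ?_
    filter_upwards [hA v] with q hq
    by_cases h : W q = 0
    · simp [h]
    · rw [hq h]
  have hbound : ∀ x, ∫⁻ q, W q * ‖inner ℂ (Ψ' q) x‖ₑ ^ 2 ∂μ ≤ E * ‖x‖ₑ ^ 2 := by
    intro x
    rw [hEdef, ← lintegral_mul_const' _ _ (by finiteness)]
    refine lintegral_mono fun q => ?_
    rw [mul_assoc, ← mul_pow]
    gcongr
    exact enorm_inner_le _ _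
  have hTb : ∀ v, ‖T v‖ ≤ Real.sqrt E.toReal * ‖e v‖ := by
    intro v
    refine le_of_sq_le_sq ?_ (by positivity)
    have h1 := (hT v).trans_le (hbound (e v))
    rw [← ofReal_norm, ← ofReal_norm, ← ENNReal.ofReal_pow (norm_nonneg _),
      ← ENNReal.ofReal_pow (norm_nonneg _), ← ENNReal.ofReal_toReal (a := E) hE,
      ← ENNReal.ofReal_mul ENNReal.toReal_nonneg,
      ENNReal.ofReal_le_ofReal_iff (by positivity)] at h1
    rw [mul_pow, Real.sq_sqrt ENNReal.toReal_nonneg]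
    exact h1
  -- `S` is the adjoint of `B √Γ`; by `hTb` it is bounded, although `B` need not be
  let S : K →L[ℂ] H := T.extendOfNorm e
  have hS : ∀ v, S (e v) = T v := fun v => LinearMap.extendOfNorm_eq he ⟨_, hTb⟩ v
  -- both sides of the identity for `T` are continuous in `e v`, so that it extends to `K`
  have hS2 : ∀ x, ‖S x‖ₑ ^ 2 = ∫⁻ q, W q * ‖inner ℂ (Ψ' q) x‖ₑ ^ 2 ∂μ := by
    intro x
    obtain ⟨u, hu, hux⟩ := mem_closure_iff_seq_limit.1 (he x)
    choose v hv using hu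
    have hbdd : ∃ C, ∀ n, ‖u n‖ ≤ C := by
      obtain ⟨C, hC⟩ := (hux.norm.bddAbove_range)
      exact ⟨C, fun n => hC ⟨n, rfl⟩⟩
    obtain ⟨C, hC⟩ := hbdd
    have hC0 : 0 ≤ C := (norm_nonneg _).trans (hC 0)
    have l1 : Tendsto (fun n => ‖S (u n)‖ₑ ^ 2) atTop (𝓝 (‖S x‖ₑ ^ 2)) :=
      ((ENNReal.continuous_pow 2).tendsto _).comp
        ((continuous_enorm.tendsto _).comp ((S.continuous.tendsto x).comp hux))
    have l2 : Tendsto (fun n => ∫⁻ q, W q * ‖inner ℂ (Ψ' q) (u n)‖ₑ ^ 2 ∂μ) atTop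
        (𝓝 (∫⁻ q, W q * ‖inner ℂ (Ψ' q) x‖ₑ ^ 2 ∂μ)) := by
      have hWfin : ∀ᵐ q ∂μ, Ψ' q ≠ 0 → W q ≠ ⊤ := by
        filter_upwards [ae_lt_top (hW.mul (hΨ'm.enorm.pow_const 2)) hE] with q hq h0 hWq
        simp [hWq, h0, ENNReal.top_mul] at hq
      refine tendsto_lintegral_of_dominated_convergence
        (fun q => W q * ‖Ψ' q‖ₑ ^ 2 * ENNReal.ofReal C ^ 2) (fun n => ?_) (fun n => ?_) ?_ ?_
      · exact hW.mul ((hinner _).enorm.pow_const 2)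
      · refine ae_of_all _ fun q => ?_
        beta_reduce
        rw [mul_assoc, ← mul_pow]
        gcongr
        refine (enorm_inner_le _ _).trans ?_
        gcongr
        rw [← ofReal_norm]
        exact ENNReal.ofReal_le_ofReal (hC n)
      · rw [lintegral_mul_const' _ _ (by finiteness)]
        exact ENNReal.mul_ne_top hE (by finiteness)
      · filter_upwards [hWfin] with q hq
        by_cases h0 : Ψ' q = 0
        · simp [h0]
        refine ENNReal.Tendsto.const_mul ?_ (Or.inr (hq h0))
        exact ((ENNReal.continuous_pow 2).tendsto _).comp
          ((continuous_enorm.tendsto _).comp (tendsto_const_nhds.inner hux))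
    refine tendsto_nhds_unique l1 ?_
    convert! l2 using 2 with n
    rw [← hv n, hS, hT]
  obtain ⟨w, f, -⟩ := exists_hilbertBasis ℂ K
  have := f.countable_of_secondCountable
  have := b.countable_of_secondCountable
  refine ⟨fun i => S.adjoint (b i), fun i v => ?_, ?_⟩
  · rw [ContinuousLinearMap.adjoint_inner_left, hS, inner_sqrt_left]
    rfl
  -- both sides are the square of the Hilbert–Schmidt norm of `S`
  · calc ∑' i, ‖S.adjoint (b i)‖ₑ ^ 2
        = ∑' i, ∑' j, ‖inner ℂ (f j) (S.adjoint (b i))‖ₑ ^ 2 :=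
          tsum_congr fun i => (f.tsum_enorm_inner_sq _).symm
      _ = ∑' j, ∑' i, ‖inner ℂ (b i) (S (f j))‖ₑ ^ 2 := by
          rw [ENNReal.tsum_comm]
          refine tsum_congr fun j => tsum_congr fun i => ?_
          rw [ContinuousLinearMap.adjoint_inner_right, ← inner_conj_symm, enorm_eq_nnnorm,
            enorm_eq_nnnorm, RCLike.nnnorm_conj]
      _ = ∑' j, ∫⁻ q, W q * ‖inner ℂ (Ψ' q) (f j)‖ₑ ^ 2 ∂μ :=
          tsum_congr fun j => by rw [b.tsum_enorm_inner_sq, hS2]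
      _ = ∫⁻ q, ∑' j, W q * ‖inner ℂ (Ψ' q) (f j)‖ₑ ^ 2 ∂μ :=
          (lintegral_tsum fun j => (hW.mul ((hinner _).enorm.pow_const 2)).aemeasurable).symm
      _ = E := by
          refine lintegral_congr fun q => ?_
          rw [ENNReal.tsum_mul_left, ← f.tsum_enorm_inner_sq]
          congr 1
          refine tsum_congr fun j => ?_
          rw [← inner_conj_symm, enorm_eq_nnnorm, enorm_eq_nnnorm, RCLike.nnnorm_conj]

/-! ### Weak derivatives in one direction -/

/-- `g` is the weak derivative of `f` in the direction `v`. -/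
structure IsWeakLineDeriv {V F : Type*} [NormedAddCommGroup V] [NormedSpace ℝ V]
    [MeasureSpace V] [NormedAddCommGroup F] [NormedSpace ℝ F] (v : V) (f g : V → F) : Prop where
  locallyIntegrable : LocallyIntegrable f volume
  locallyIntegrable_deriv : LocallyIntegrable g volume
  integral_eq : ∀ φ : V → ℝ, ContDiff ℝ ∞ φ → HasCompactSupport φ →
    ∫ x, (fderiv ℝ φ x v) • f x = - ∫ x, φ x • g x

section WeakDerivatives

variable {V F : Type*} [NormedAddCommGroup V] [NormedSpace ℝ V] [NormedAddCommGroup F]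
  [NormedSpace ℝ F]

theorem continuous_fderiv_apply_of_contDiff {φ : V → ℝ} (h : ContDiff ℝ ∞ φ) (v : V) :
    Continuous fun x => fderiv ℝ φ x v :=
  (h.continuous_fderiv (by simp)).clm_apply continuous_const

variable [MeasureSpace V]

theorem FermionicRegularization.HasWeakFDeriv.isWeakLineDeriv {f : V → F} {G : V → V →L[ℝ] F}
    (h : HasWeakFDeriv f G) (v : V) : IsWeakLineDeriv v f fun x => G x v where
  locallyIntegrable := h.locallyIntegrable
  locallyIntegrable_deriv := by
    intro x
    obtain ⟨s, hs, hi⟩ := h.locallyIntegrable_deriv x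
    exact ⟨s, hs, (ContinuousLinearMap.apply ℝ F v).integrable_comp hi⟩
  integral_eq φ h1 h2 := h.integral_eq φ h1 h2 v

theorem locallyIntegrable_smulRight (c : V →L[ℝ] ℝ) {g : V → F}
    (hg : LocallyIntegrable g volume) : LocallyIntegrable (fun x => c.smulRight (g x)) volume := by
  intro x
  obtain ⟨s, hs, hi⟩ := hg x
  exact ⟨s, hs, (ContinuousLinearMap.smulRightL ℝ V F c).integrable_comp hi⟩

theorem locallyIntegrable_sum_smulRight {ι : Type*} (s : Finset ι) (c : ι → V →L[ℝ] ℝ)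
    {g : ι → V → F} (hg : ∀ i, LocallyIntegrable (g i) volume) :
    LocallyIntegrable (fun x => ∑ i ∈ s, (c i).smulRight (g i x)) volume := by
  classical
  induction s using Finset.induction_on with
  | empty =>
    simp only [Finset.sum_empty]
    exact locallyIntegrable_zero (ε'' := V →L[ℝ] F)
  | insert i s hi ih =>
    simp only [Finset.sum_insert hi]
    exact LocallyIntegrable.add (ε'' := V →L[ℝ] F)
      (locallyIntegrable_smulRight (c i) (hg i)) ih

variable [BorelSpace V]

theorem IsWeakLineDeriv.integrable_fderiv_smul {f g : V → F} {v : V}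
    (h : IsWeakLineDeriv v f g) {φ : V → ℝ} (h1 : ContDiff ℝ ∞ φ) (h2 : HasCompactSupport φ)
    (w : V) : Integrable fun x => (fderiv ℝ φ x w) • f x :=
  h.locallyIntegrable.integrable_smul_left_of_hasCompactSupport
    (continuous_fderiv_apply_of_contDiff h1 w) (h2.fderiv_apply ℝ w)

theorem IsWeakLineDeriv.integrable_smul_deriv {f g : V → F} {v : V}
    (h : IsWeakLineDeriv v f g) {φ : V → ℝ} (h1 : ContDiff ℝ ∞ φ) (h2 : HasCompactSupport φ) :
    Integrable fun x => φ x • g x :=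
  h.locallyIntegrable_deriv.integrable_smul_left_of_hasCompactSupport h1.continuous h2

/-- Directional weak derivatives along a basis assemble to a weak derivative. The dual basis enters
as the family `c` of coordinate functionals. -/
theorem hasWeakFDeriv_of_basis {ι : Type*} [Fintype ι] {e : ι → V} (c : ι → V →L[ℝ] ℝ)
    (hc : ∀ v, v = ∑ i, c i v • e i) {f : V → F} (hf : LocallyIntegrable f volume)
    {g : ι → V → F} (h : ∀ i, IsWeakLineDeriv (e i) f (g i)) :
    HasWeakFDeriv f fun x => ∑ i, (c i).smulRight (g i x) := by
  refine ⟨hf, locallyIntegrable_sum_smulRight _ c fun i => (h i).locallyIntegrable_deriv,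
    fun φ h1 h2 v => ?_⟩
  have e1 : ∀ x, (fderiv ℝ φ x v) • f x = ∑ i, c i v • ((fderiv ℝ φ x (e i)) • f x) := by
    intro x
    have e3 : fderiv ℝ φ x v = ∑ i, c i v * fderiv ℝ φ x (e i) := by
      have := congrArg (fderiv ℝ φ x) (hc v)
      simpa only [map_sum, map_smul, smul_eq_mul] using this
    rw [e3, Finset.sum_smul]
    exact Finset.sum_congr rfl fun i _ => mul_smul _ _ _
  have e2 : ∀ x, φ x • (∑ i, (c i).smulRight (g i x)) v = ∑ i, c i v • (φ x • g i x) := by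
    intro x
    rw [sum_apply, Finset.smul_sum]
    exact Finset.sum_congr rfl fun i _ => by
      rw [ContinuousLinearMap.smulRight_apply, smul_comm]
  rw [integral_congr_ae (ae_of_all _ e1), integral_congr_ae (ae_of_all _ e2),
    integral_finsetSum _ fun i _ => ((h i).integrable_fderiv_smul h1 h2 (e i)).fun_smul (c i v),
    integral_finsetSum _ fun i _ => ((h i).integrable_smul_deriv h1 h2).fun_smul (c i v),
    ← Finset.sum_neg_distrib]
  refine Finset.sum_congr rfl fun i _ => ?_
  rw [integral_smul, integral_smul, (h i).integral_eq φ h1 h2, smul_neg]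

variable [FiniteDimensional ℝ V]

theorem IsWeakLineDeriv.ae_unique [CompleteSpace F] {f f' g g' : V → F} {v : V}
    (h : IsWeakLineDeriv v f g) (h' : IsWeakLineDeriv v f' g') (hf : f =ᵐ[volume] f') :
    g =ᵐ[volume] g' := by
  refine ae_eq_of_integral_contDiff_smul_eq h.locallyIntegrable_deriv
    h'.locallyIntegrable_deriv fun φ h1 h2 => ?_
  have e1 := h.integral_eq φ h1 h2
  have e2 := h'.integral_eq φ h1 h2
  have e3 : ∫ x, (fderiv ℝ φ x v) • f x = ∫ x, (fderiv ℝ φ x v) • f' x :=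
    integral_congr_ae (by filter_upwards [hf] with x hx; rw [hx])
  rw [e3, e2] at e1
  exact (neg_injective e1).symm

theorem FermionicRegularization.HasWeakFDeriv.ae_unique [CompleteSpace F] {f f' : V → F}
    {G G' : V → V →L[ℝ] F}
    (h : HasWeakFDeriv f G) (h' : HasWeakFDeriv f' G') (hf : f =ᵐ[volume] f') :
    G =ᵐ[volume] G' := by
  let b := Module.finBasis ℝ V
  have : ∀ᵐ x, ∀ i, G x (b i) = G' x (b i) :=
    ae_all_iff.2 fun i => (h.isWeakLineDeriv (b i)).ae_unique (h'.isWeakLineDeriv (b i)) hf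
  filter_upwards [this] with x hx
  exact ContinuousLinearMap.coe_injective (b.ext hx)

theorem ae_eq_weakFDeriv [CompleteSpace F] {f : V → F} {G : V → V →L[ℝ] F}
    (h : HasWeakFDeriv f G) : weakFDeriv f =ᵐ[volume] G := by
  have hex : ∃ G, HasWeakFDeriv f G := ⟨G, h⟩
  have h2 : HasWeakFDeriv f (weakFDeriv f) := by
    unfold weakFDeriv
    rw [dif_pos hex]
    exact hex.choose_spec
  exact h2.ae_unique h ae_eq_rfl

/-- Leibniz' rule for the product with a smooth function. -/
theorem IsWeakLineDeriv.mul_smooth {f g η : V → ℝ} {v : V} (h : IsWeakLineDeriv v f g)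
    (hη : ContDiff ℝ ∞ η) :
    IsWeakLineDeriv v (fun x => f x * η x) fun x => g x * η x + f x * fderiv ℝ η x v := by
  have hη' := continuous_fderiv_apply_of_contDiff hη v
  have l1 : LocallyIntegrable (fun x => f x * η x) volume := by
    have := h.locallyIntegrable.locallyIntegrableOn Set.univ
    rw [← locallyIntegrableOn_univ]
    exact this.mul_continuousOn hη.continuous.continuousOn isOpen_univ.isLocallyClosed
  have l2 : LocallyIntegrable (fun x => g x * η x) volume := by
    have := h.locallyIntegrable_deriv.locallyIntegrableOn Set.univ
    rw [← locallyIntegrableOn_univ]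
    exact this.mul_continuousOn hη.continuous.continuousOn isOpen_univ.isLocallyClosed
  have l3 : LocallyIntegrable (fun x => f x * fderiv ℝ η x v) volume := by
    have := h.locallyIntegrable.locallyIntegrableOn Set.univ
    rw [← locallyIntegrableOn_univ]
    exact this.mul_continuousOn hη'.continuousOn isOpen_univ.isLocallyClosed
  refine ⟨l1, l2.add l3, fun φ h1 h2 => ?_⟩
  have h3 := h.integral_eq (fun x => φ x * η x) (h1.mul hη) h2.mul_right
  have e1 : ∀ x, fderiv ℝ (fun x => φ x * η x) x v
      = φ x * fderiv ℝ η x v + fderiv ℝ φ x v * η x := by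
    intro x
    rw [fderiv_fun_mul (h1.differentiable (by simp) x) (hη.differentiable (by simp) x)]
    simp [mul_comm]
  have i1 : Integrable fun x => φ x * (f x * fderiv ℝ η x v) := by
    simpa using l3.integrable_smul_left_of_hasCompactSupport h1.continuous h2
  have i2 : Integrable fun x => fderiv ℝ φ x v * (f x * η x) := by
    simpa using l1.integrable_smul_left_of_hasCompactSupport
      (continuous_fderiv_apply_of_contDiff h1 v) (h2.fderiv_apply ℝ v)
  have i3 : Integrable fun x => φ x * (g x * η x) := by
    simpa using l2.integrable_smul_left_of_hasCompactSupport h1.continuous h2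
  simp only [smul_eq_mul, e1] at h3 ⊢
  have e2 : ∀ x, (φ x * fderiv ℝ η x v + fderiv ℝ φ x v * η x) * f x
      = φ x * (f x * fderiv ℝ η x v) + fderiv ℝ φ x v * (f x * η x) := fun x => by ring
  have e3 : ∀ x, φ x * (g x * η x + f x * fderiv ℝ η x v)
      = φ x * (g x * η x) + φ x * (f x * fderiv ℝ η x v) := fun x => by ring
  have e4 : ∀ x, φ x * η x * g x = φ x * (g x * η x) := fun x => by ring
  simp_rw [e2, e4] at h3
  rw [integral_add i1 i2] at h3
  simp_rw [e3]
  rw [integral_add i3 i1]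
  linarith

variable [(volume : Measure V).IsAddHaarMeasure]

/-- The correlation function of two square-integrable functions is continuous. -/
theorem continuous_correlation {a b : V → ℝ} (ha : MemLp a 2 volume) (hb : MemLp b 2 volume) :
    Continuous fun s => ∫ x, a x * b (x + s) := by
  let τ : V → C(V, V) := fun s => ⟨fun x => x + s, by fun_prop⟩
  have hτ : Continuous τ := ContinuousMap.continuous_of_continuous_uncurry _ (by
    change Continuous fun p : V × V => p.2 + p.1
    fun_prop)
  have hmp : ∀ s, MeasurePreserving (τ s) (volume : Measure V) volume := fun s =>
    measurePreserving_add_right volume s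
  have h1 : Continuous fun s => Lp.compMeasurePreserving (τ s) (hmp s) (hb.toLp b) :=
    Continuous.compMeasurePreservingLp continuous_const hτ hmp (by simp)
  have h2 : Continuous fun s => inner ℝ (ha.toLp a)
      (Lp.compMeasurePreserving (τ s) (hmp s) (hb.toLp b)) := continuous_const.inner h1
  convert! h2 using 2 with s
  rw [L2.inner_def]
  refine integral_congr_ae ?_
  filter_upwards [ha.coeFn_toLp, Lp.coeFn_compMeasurePreserving (hb.toLp b) (hmp s),
    (hmp s).quasiMeasurePreserving.ae_eq_comp hb.coeFn_toLp] with x h1 h2 h3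
  rw [h1, h2, h3]
  simp [τ, mul_comm]

/-- Testing the correlation function of `a` and `b` against `η` gives a double integral. -/
theorem integral_mul_correlation {a b η : V → ℝ} (ha : MemLp a 2 volume)
    (hb : MemLp b 2 volume) (hb' : Measurable b)
    (hη : Continuous η) (hηc : HasCompactSupport η) :
    Integrable (fun p : V × V => η (p.2 - p.1) * a p.1 * b p.2) (volume.prod volume) ∧
    ∫ p : V × V, η (p.2 - p.1) * a p.1 * b p.2 ∂(volume.prod volume)
      = ∫ s, η s * ∫ x, a x * b (x + s) := by
  have hmp := measurePreserving_prod_sub (volume : Measure V) volume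
  have hbs : ∀ s, MemLp (fun x => b (x + s)) 2 volume := fun s =>
    hb.comp_measurePreserving (measurePreserving_add_right volume s)
  have hi : ∀ s, Integrable (fun x => a x * b (x + s)) volume := fun s =>
    ha.integrable_mul (hbs s)
  have hK : Integrable (fun p : V × V => η p.2 * a p.1 * b (p.1 + p.2))
      (volume.prod volume) := by
    have hm : AEStronglyMeasurable (fun p : V × V => η p.2 * a p.1 * b (p.1 + p.2))
        (volume.prod volume) :=
      ((hη.measurable.comp measurable_snd).aestronglyMeasurable.mul
        (ha.aestronglyMeasurable.comp_fst)).mul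
        (hb'.comp (measurable_fst.add measurable_snd)).aestronglyMeasurable
    refine (integrable_prod_iff' hm).2 ⟨ae_of_all _ fun s => ?_, ?_⟩
    · simpa only [mul_assoc] using (hi s).const_mul (η s)
    · have h1 : Continuous fun s => |η s| * ∫ x, |a x| * |b (x + s)| :=
        hη.abs.mul (continuous_correlation ha.abs hb.abs)
      have h2 : HasCompactSupport fun s => |η s| * ∫ x, |a x| * |b (x + s)| :=
        (hηc.comp_left (g := fun t : ℝ => |t|) abs_zero).mul_right
      refine (h1.integrable_of_hasCompactSupport h2).congr (ae_of_all _ fun s => ?_)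
      simp only [norm_mul, Real.norm_eq_abs, mul_assoc]
      rw [integral_const_mul]
  have heq : (fun p : V × V => η (p.2 - p.1) * a p.1 * b p.2)
      = (fun p : V × V => η p.2 * a p.1 * b (p.1 + p.2)) ∘ fun z => (z.1, z.2 - z.1) := by
    funext p
    simp
  constructor
  · rw [heq]
    exact hmp.integrable_comp_of_integrable hK
  · have h1 : ∫ p : V × V, η (p.2 - p.1) * a p.1 * b p.2 ∂(volume.prod volume)
        = ∫ p : V × V, η p.2 * a p.1 * b (p.1 + p.2) ∂(volume.prod volume) := by
      conv_rhs => rw [← hmp.map_eq]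
      rw [integral_map hmp.aemeasurable (by rw [hmp.map_eq]; exact hK.aestronglyMeasurable)]
      simp
    rw [h1, integral_prod_symm _ hK]
    refine integral_congr_ae (ae_of_all _ fun s => ?_)
    simp only [mul_assoc]
    rw [integral_const_mul]

/-- The square of a function with a square-integrable derivative. Doubling the variable, the
weak derivative of `f ⊗ f` along the diagonal is tested with functions `φ(x) η(y - x)`; this gives
Leibniz' rule after integration against every `η(s)`, and then at `s = 0` since the correlation
functions are continuous in `s`. -/
theorem IsWeakLineDeriv.sq {f g : V → ℝ} {v : V} (h : IsWeakLineDeriv v f g)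
    (hf : MemLp f 2 volume) (hg : MemLp g 2 volume) (hfm : Measurable f) (hgm : Measurable g) :
    IsWeakLineDeriv v (fun x => f x ^ 2) fun x => 2 * f x * g x := by
  have i1 : Integrable (fun x => f x ^ 2) volume := hf.integrable_sq
  have i2 : Integrable (fun x => 2 * f x * g x) volume := by
    have := (hf.integrable_mul hg).const_mul 2
    simpa only [Pi.mul_apply, mul_assoc] using this
  refine ⟨i1.locallyIntegrable, i2.locallyIntegrable, fun φ h1 h2 => ?_⟩
  have hφ' := continuous_fderiv_apply_of_contDiff h1 v
  have mul_mem : ∀ {ψ u : V → ℝ}, Continuous ψ → HasCompactSupport ψ → MemLp u 2 volume →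
      MemLp (fun x => ψ x * u x) 2 volume := by
    intro ψ u hψ hψc hu
    exact hu.mul (hψ.memLp_top_of_hasCompactSupport hψc volume)
  have m1 : MemLp (fun x => fderiv ℝ φ x v * f x) 2 volume :=
    mul_mem hφ' (h2.fderiv_apply ℝ v) hf
  have m2 : MemLp (fun x => φ x * f x) 2 volume := mul_mem h1.continuous h2 hf
  have m3 : MemLp (fun x => φ x * g x) 2 volume := mul_mem h1.continuous h2 hg
  have c1 := continuous_correlation m1 hf
  have c2 := continuous_correlation m3 hf
  have c3 := continuous_correlation m2 hg
  have key : (fun s => (∫ x, fderiv ℝ φ x v * f x * f (x + s)))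
      = fun s => -((∫ x, φ x * g x * f (x + s)) + ∫ x, φ x * f x * g (x + s)) := by
    refine (Continuous.ae_eq_iff_eq (volume : Measure V) c1 (c2.add c3).neg).1 ?_
    refine ae_eq_of_integral_contDiff_smul_eq c1.locallyIntegrable
      (c2.add c3).neg.locallyIntegrable fun η hη hηc => ?_
    have hη' := continuous_fderiv_apply_of_contDiff hη v
    obtain ⟨j1, k1⟩ := integral_mul_correlation m1 hf hfm hη.continuous hηc
    obtain ⟨j2, k2⟩ := integral_mul_correlation m3 hf hfm hη.continuous hηc
    obtain ⟨j3, k3⟩ := integral_mul_correlation m2 hg hgm hη.continuous hηc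
    obtain ⟨j4, k4⟩ := integral_mul_correlation m2 hf hfm hη' (hηc.fderiv_apply ℝ v)
    -- integration by parts in `x` for fixed `y`
    have a1 : ∀ y, (∫ x, η (y - x) * (fderiv ℝ φ x v * f x) * f y)
          - (∫ x, fderiv ℝ η (y - x) v * (φ x * f x) * f y)
        = - ∫ x, η (y - x) * (φ x * g x) * f y := by
      intro y
      have hηy : ContDiff ℝ ∞ fun x => η (y - x) := hη.comp (contDiff_const.sub contDiff_id)
      have d1 : ∀ x, fderiv ℝ (fun x => φ x * η (y - x)) x v
          = η (y - x) * fderiv ℝ φ x v - fderiv ℝ η (y - x) v * φ x := by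
        intro x
        have e1 : HasFDerivAt (fun x => η (y - x)) (-(fderiv ℝ η (y - x))) x := by
          have := (hη.differentiable (by simp) (y - x)).hasFDerivAt.comp x
            ((hasFDerivAt_id x).const_sub y)
          convert! this using 1
          ext w
          simp
        have e2 := (h1.differentiable (by simp) x).hasFDerivAt.fun_mul e1
        rw [e2.fderiv]
        simp
        ring
      have t := h.integral_eq (fun x => φ x * η (y - x)) (h1.mul hηy) h2.mul_right
      simp only [smul_eq_mul, d1] at t
      have u1 : Integrable (fun x => η (y - x) * (fderiv ℝ φ x v * f x)) volume := by
        have := h.locallyIntegrable.integrable_smul_left_of_hasCompactSupport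
          (hηy.continuous.mul hφ') ((h2.fderiv_apply ℝ v).mul_left)
        simpa only [smul_eq_mul, mul_assoc, Pi.mul_apply] using this
      have u2 : Integrable (fun x => fderiv ℝ η (y - x) v * (φ x * f x)) volume := by
        have := h.locallyIntegrable.integrable_smul_left_of_hasCompactSupport
          ((hη'.comp (continuous_sub_left y)).mul
            h1.continuous) h2.mul_left
        simpa only [smul_eq_mul, mul_assoc, Function.comp_def,
          Pi.mul_apply] using this
      rw [integral_mul_const, integral_mul_const, integral_mul_const, ← sub_mul,
        ← integral_sub u1 u2, ← neg_mul]
      congr 1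
      refine Eq.trans (integral_congr_ae (ae_of_all _ fun x => ?_)) (t.trans ?_)
      · simp only
        ring
      · congr 1
        exact integral_congr_ae (ae_of_all _ fun x => by simp only; ring)
    -- integration by parts in `y` for fixed `x`
    have a2 : ∀ x, (∫ y, fderiv ℝ η (y - x) v * (φ x * f x) * f y)
        = - ∫ y, η (y - x) * (φ x * f x) * g y := by
      intro x
      have hηx : ContDiff ℝ ∞ fun y => η (y - x) := hη.comp (contDiff_id.sub contDiff_const)
      have d1 : ∀ y, fderiv ℝ (fun y => η (y - x)) y v = fderiv ℝ η (y - x) v := by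
        intro y
        rw [fderiv_comp_sub]
      have t := h.integral_eq (fun y => η (y - x)) hηx
        (hηc.comp_homeomorph (Homeomorph.subRight x))
      simp only [smul_eq_mul, d1] at t
      have := congrArg (fun r => (φ x * f x) * r) t
      simp only [mul_neg] at this
      rw [← integral_const_mul, ← integral_const_mul] at this
      refine Eq.trans (integral_congr_ae (ae_of_all _ fun y => ?_)) (this.trans ?_)
      · simp only
        ring
      · congr 1
        exact integral_congr_ae (ae_of_all _ fun y => by simp only; ring)
    have b1 : (∫ p : V × V, η (p.2 - p.1) * (fderiv ℝ φ p.1 v * f p.1) * f p.2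
          ∂(volume.prod volume))
        - (∫ p : V × V, fderiv ℝ η (p.2 - p.1) v * (φ p.1 * f p.1) * f p.2
          ∂(volume.prod volume))
        = - ∫ p : V × V, η (p.2 - p.1) * (φ p.1 * g p.1) * f p.2 ∂(volume.prod volume) := by
      rw [integral_prod_symm _ j1, integral_prod_symm _ j4, integral_prod_symm _ j2,
        ← integral_sub j1.integral_prod_right j4.integral_prod_right, ← integral_neg]
      exact integral_congr_ae (ae_of_all _ a1)
    have b2 : (∫ p : V × V, fderiv ℝ η (p.2 - p.1) v * (φ p.1 * f p.1) * f p.2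
          ∂(volume.prod volume))
        = - ∫ p : V × V, η (p.2 - p.1) * (φ p.1 * f p.1) * g p.2 ∂(volume.prod volume) := by
      rw [integral_prod _ j4, integral_prod _ j3, ← integral_neg]
      exact integral_congr_ae (ae_of_all _ a2)
    rw [b2, k1, k2, k3] at b1
    simp only [smul_eq_mul]
    have v2 : Integrable (fun s => η s * ∫ x, φ x * g x * f (x + s)) volume :=
      (hη.continuous.mul c2).integrable_of_hasCompactSupport hηc.mul_right
    have v3 : Integrable (fun s => η s * ∫ x, φ x * f x * g (x + s)) volume :=
      (hη.continuous.mul c3).integrable_of_hasCompactSupport hηc.mul_right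
    have e5 : ∀ s, η s * (-((fun s => ∫ x, φ x * g x * f (x + s))
        + fun s => ∫ x, φ x * f x * g (x + s))) s
        = -((η s * ∫ x, φ x * g x * f (x + s)) + η s * ∫ x, φ x * f x * g (x + s)) := by
      intro s
      simp only [Pi.neg_apply, Pi.add_apply]
      ring
    simp_rw [e5]
    rw [integral_neg, integral_add v2 v3]
    linarith
  have key0 := congrFun key 0
  simp only [add_zero] at key0
  have w2 : Integrable (fun x => φ x * g x * f x) volume := m3.integrable_mul hf
  have w3 : Integrable (fun x => φ x * f x * g x) volume := m2.integrable_mul hg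
  rw [← integral_add w2 w3] at key0
  simp only [smul_eq_mul]
  refine Eq.trans (integral_congr_ae (ae_of_all _ fun x => ?_)) (key0.trans ?_)
  · simp only
    ring
  · congr 1
    exact integral_congr_ae (ae_of_all _ fun x => by simp only; ring)

end WeakDerivatives

/-! ### Translations of functions with an integrable weak derivative -/

section Translation

variable {V : Type*} [NormedAddCommGroup V] [NormedSpace ℝ V] [FiniteDimensional ℝ V]
  [MeasureSpace V] [BorelSpace V] [(volume : Measure V).IsAddHaarMeasure]

/-- Translating along a line changes an integrable function by at most the `L¹` norm of its
derivative: for almost every `x`, `f (x + v) - f x = ∫₀¹ g (x + t v) dt`. -/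
theorem IsWeakLineDeriv.lintegral_enorm_translate_sub_le {f g : V → ℝ} {v : V}
    (h : IsWeakLineDeriv v f g) (hf : Integrable f) (hg : Integrable g)
    (hgm : Measurable g) : ∫⁻ x, ‖f (x + v) - f x‖ₑ ≤ ∫⁻ x, ‖g x‖ₑ := by
  let I : Measure ℝ := volume.restrict (Set.Ioc 0 1)
  have hIf : IsFiniteMeasure I := ⟨by simp [I]⟩
  have hadd : Measurable fun p : V × ℝ => p.1 + p.2 • v := by fun_prop
  have hsub : Measurable fun p : V × ℝ => p.1 - p.2 • v := by fun_prop
  have j1 : Integrable (fun p : V × ℝ => g (p.1 + p.2 • v)) (volume.prod I) := by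
    refine (integrable_prod_iff' (hgm.comp hadd).aestronglyMeasurable).2 ⟨ae_of_all _ fun t =>
      hg.comp_add_right (t • v), ?_⟩
    exact (integrable_const (∫ x, ‖g x‖)).congr (ae_of_all _ fun t =>
      (integral_add_right_eq_self (fun x => ‖g x‖) (t • v)).symm)
  have key : (fun x => f (x + v) - f x) =ᵐ[volume] fun x => ∫ t, g (x + t • v) ∂I := by
    have i1 : Integrable (fun x => f (x + v) - f x) := (hf.comp_add_right v).sub hf
    refine ae_eq_of_integral_contDiff_smul_eq i1.locallyIntegrable
      j1.integral_prod_left.locallyIntegrable fun φ h1 h2 => ?_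
    obtain ⟨C, hC⟩ := h1.continuous.bounded_above_of_compact_support h2
    have hφ' := continuous_fderiv_apply_of_contDiff h1 v
    obtain ⟨C', hC'⟩ := hφ'.bounded_above_of_compact_support (h2.fderiv_apply ℝ v)
    have j2 : Integrable (fun p : V × ℝ => φ p.1 * g (p.1 + p.2 • v)) (volume.prod I) :=
      j1.bdd_mul (h1.continuous.comp continuous_fst).aestronglyMeasurable
        (ae_of_all _ fun p => hC p.1)
    have j3 : Integrable (fun p : V × ℝ => fderiv ℝ φ (p.1 - p.2 • v) v * f p.1)
        (volume.prod I) :=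
      hf.comp_fst I |>.bdd_mul (hφ'.measurable.comp hsub).aestronglyMeasurable
        (ae_of_all _ fun p => hC' _)
    have a1 : ∀ t : ℝ, ∫ x, φ x * g (x + t • v) = - ∫ x, fderiv ℝ φ (x - t • v) v * f x := by
      intro t
      have e := h.integral_eq (fun x => φ (x - t • v)) (h1.comp (contDiff_id.sub contDiff_const))
        (h2.comp_homeomorph (Homeomorph.subRight (t • v)))
      have e' : ∀ x, fderiv ℝ (fun x => φ (x - t • v)) x v = fderiv ℝ φ (x - t • v) v :=
        fun x => by rw [fderiv_comp_sub]
      simp only [e', smul_eq_mul] at e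
      rw [e, neg_neg, ← integral_add_right_eq_self (fun x => φ (x - t • v) * g x) (t • v)]
      simp
    have a2 : ∀ x, ∫ t, fderiv ℝ φ (x - t • v) v * f x ∂I = (φ x - φ (x - v)) * f x := by
      intro x
      rw [integral_mul_const]
      congr 1
      have hd : ∀ t : ℝ, HasDerivAt (fun t : ℝ => -φ (x - t • v)) (fderiv ℝ φ (x - t • v) v) t := by
        intro t
        have d1 : HasDerivAt (fun t : ℝ => x - t • v) (-v) t := by
          simpa using ((hasDerivAt_id t).smul_const v).const_sub x
        have := ((h1.differentiable (by simp) (x - t • v)).hasFDerivAt.comp_hasDerivAt t d1).neg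
        simp only [map_neg, neg_neg] at this
        exact this
      have := intervalIntegral.integral_eq_sub_of_hasDerivAt (a := 0) (b := 1)
        (fun t _ => hd t) ((hφ'.comp (by fun_prop : Continuous fun t : ℝ => x - t • v)
          ).intervalIntegrable 0 1)
      rw [intervalIntegral.integral_of_le zero_le_one] at this
      rw [this]
      simp
      ring
    have b1 : ∫ x, φ x * ∫ t, g (x + t • v) ∂I = - ∫ x, (φ x - φ (x - v)) * f x := by
      have e1 : ∀ x, φ x * ∫ t, g (x + t • v) ∂I = ∫ t, φ x * g (x + t • v) ∂I :=
        fun x => (integral_const_mul _ _).symm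
      simp_rw [e1, ← a2]
      have s2 := integral_integral_swap
        (f := fun x (t : ℝ) => φ x * g (x + t • v)) j2
      have s3 := integral_integral_swap
        (f := fun x (t : ℝ) => fderiv ℝ φ (x - t • v) v * f x) j3
      rw [s2, s3, ← integral_neg]
      exact integral_congr_ae (ae_of_all _ a1)
    simp only [smul_eq_mul]
    rw [b1]
    have k1 : Integrable fun x => φ x * f x :=
      hf.bdd_mul h1.continuous.aestronglyMeasurable (ae_of_all _ hC)
    have k2 : Integrable fun x => φ x * f (x + v) :=
      (hf.comp_add_right v).bdd_mul h1.continuous.aestronglyMeasurable (ae_of_all _ hC)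
    have k3 : Integrable fun x => φ (x - v) * f x :=
      hf.bdd_mul (h1.continuous.comp (by fun_prop)).aestronglyMeasurable
        (ae_of_all _ fun x => hC _)
    have e2 : ∫ x, φ x * f (x + v) = ∫ x, φ (x - v) * f x := by
      rw [← integral_add_right_eq_self (fun x => φ (x - v) * f x) v]
      simp
    simp only [mul_sub, sub_mul]
    rw [integral_sub k2 k1, integral_sub k1 k3, e2]
    ring
  calc ∫⁻ x, ‖f (x + v) - f x‖ₑ = ∫⁻ x, ‖∫ t, g (x + t • v) ∂I‖ₑ :=
        lintegral_congr_ae (key.mono fun x hx => by simp only [hx])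
    _ ≤ ∫⁻ x, ∫⁻ t, ‖g (x + t • v)‖ₑ ∂I :=
        lintegral_mono fun x => enorm_integral_le_lintegral_enorm _
    _ = ∫⁻ t, (∫⁻ x, ‖g (x + t • v)‖ₑ) ∂I :=
        lintegral_lintegral_swap (hgm.comp hadd).enorm.aemeasurable
    _ = ∫⁻ _, (∫⁻ x, ‖g x‖ₑ) ∂I := lintegral_congr fun t =>
        lintegral_add_right_eq_self (fun x => ‖g x‖ₑ) (t • v)
    _ = ∫⁻ x, ‖g x‖ₑ := by simp [I]

/-- A non-negative integrable function that is invariant under all translations vanishes: it is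
the density of a finite invariant measure. -/
theorem ae_eq_zero_of_translate [Nontrivial V] {f : V → ℝ} (hf : Integrable f)
    (hfm : Measurable f) (hf0 : ∀ x, 0 ≤ f x) (h : ∀ v, ∀ᵐ x, f (x + v) = f x) :
    f =ᵐ[volume] 0 := by
  set ν : Measure V := volume.withDensity fun x => ENNReal.ofReal (f x) with hν
  have hfin : IsFiniteMeasure ν := isFiniteMeasure_withDensity_ofReal hf.2
  have hinv : ν.IsAddLeftInvariant := by
    refine ⟨fun v => Measure.ext fun A hA => ?_⟩
    have hA' : MeasurableSet ((fun x => v + x) ⁻¹' A) := measurable_const_add v hA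
    rw [Measure.map_apply (measurable_const_add v) hA, hν, withDensity_apply _ hA',
      withDensity_apply _ hA, ← lintegral_indicator hA', ← lintegral_indicator hA,
      ← lintegral_add_left_eq_self (A.indicator fun x => ENNReal.ofReal (f x)) v]
    refine lintegral_congr_ae ?_
    filter_upwards [h v] with x hx
    by_cases hxA : v + x ∈ A
    · rw [Set.indicator_of_mem (show x ∈ (fun x => v + x) ⁻¹' A from hxA),
        Set.indicator_of_mem hxA, ← hx, add_comm]
    · rw [Set.indicator_of_notMem (show x ∉ (fun x => v + x) ⁻¹' A from hxA),
        Set.indicator_of_notMem hxA]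
  have h0 : ν = 0 := by
    by_contra hne
    have : NeZero ν := ⟨hne⟩
    have : ν.IsOpenPosMeasure := isOpenPosMeasure_of_addLeftInvariant_of_regular
    have htop := measure_univ_of_isAddLeftInvariant ν
    exact measure_ne_top ν _ htop
  have h1 := (withDensity_eq_zero_iff hfm.ennreal_ofReal.aemeasurable).1 h0
  filter_upwards [h1] with x hx
  exact le_antisymm (ENNReal.ofReal_eq_zero.1 hx) (hf0 x)

end Translation

/-! ### Tensor products and quadratic forms -/

/-- Pointwise products of square-integrable functions of one particle each. -/
theorem memLp_prod {N d : ℕ} {f : Fin N → Space d → ℝ}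
    (hf : ∀ k, MemLp (f k) 2 volume) :
    MemLp (fun X : Config N d => ∏ k, f k (X k)) 2 volume := by
  have hm : AEStronglyMeasurable (fun X : Config N d => ∏ k, f k (X k)) volume :=
    Finset.aestronglyMeasurable_fun_prod _ fun k _ =>
      (hf k).aestronglyMeasurable.comp_quasiMeasurePreserving
        (Measure.quasiMeasurePreserving_eval (fun _ : Fin N => (volume : Measure (Space d))) k)
  refine (memLp_two_iff_integrable_sq hm).2 ?_
  simp only [← Finset.prod_pow]
  exact Integrable.fintype_prod fun k => (hf k).integrable_sq

/-- The weak derivative of a tensor product in the position of the `j`-th particle. -/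
theorem isWeakLineDeriv_prod {N d : ℕ} {f : Fin N → Space d → ℝ} (hf : ∀ k, MemLp (f k) 2 volume)
    (j : Fin N) {u : Space d} {g : Space d → ℝ} (hg : MemLp g 2 volume)
    (h : IsWeakLineDeriv u (f j) g) :
    IsWeakLineDeriv (Pi.single j u : Config N d) (fun X => ∏ k, f k (X k))
      fun X => ∏ k, Function.update f j g k (X k) := by
  obtain _ | n := N
  · exact j.elim0
  have hfg : ∀ k, MemLp (Function.update f j g k) 2 volume := by
    intro k
    by_cases hk : k = j
    · subst hk
      simpa using hg
    · simpa [hk] using hf k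
  have m1 := memLp_prod hf
  have m2 := memLp_prod hfg
  refine ⟨m1.locallyIntegrable (by norm_num), m2.locallyIntegrable (by norm_num),
    fun φ h1 h2 => ?_⟩
  have hφ' := continuous_fderiv_apply_of_contDiff h1 (Pi.single j u)
  have i1 : Integrable fun X : Config (n + 1) d =>
      (fderiv ℝ φ X (Pi.single j u)) • ∏ k, f k (X k) :=
    (m1.locallyIntegrable (by norm_num)).integrable_smul_left_of_hasCompactSupport hφ'
      (h2.fderiv_apply ℝ _)
  have i2 : Integrable fun X : Config (n + 1) d =>
      φ X • ∏ k, Function.update f j g k (X k) :=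
    (m2.locallyIntegrable (by norm_num)).integrable_smul_left_of_hasCompactSupport h1.continuous h2
  -- Fubini: `split` integrates over `x_j` first, with the other particles fixed
  have hmp := (volume_preserving_piFinSuccAbove (fun _ : Fin (n + 1) => Space d) j).symm
  have hs : ∀ (X : Config n d) (x : Space d),
      (MeasurableEquiv.piFinSuccAbove (fun _ : Fin (n + 1) => Space d) j).symm (x, X)
        = j.insertNth x X := fun X x => by
    rw [MeasurableEquiv.piFinSuccAbove_symm_apply]
    rfl
  have split : ∀ F : Config (n + 1) d → ℝ, Integrable F →
      ∫ X, F X = ∫ X : Config n d, ∫ x : Space d, F (j.insertNth x X) := by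
    intro F hF
    rw [← hmp.integral_comp', Measure.volume_eq_prod, integral_prod_symm]
    · simp only [hs]
    · exact hmp.integrable_comp_of_integrable hF
  rw [split _ i1, split _ i2, ← integral_neg]
  refine integral_congr_ae (ae_of_all _ fun X => ?_)
  have hins : ∀ x : Space d, (j.insertNth x X : Config (n + 1) d)
      = j.insertNth 0 X + ContinuousLinearMap.single ℝ (fun _ : Fin (n + 1) => Space d) j x := by
    intro x
    funext k
    refine Fin.succAboveCases j ?_ (fun i => ?_) k
    · simp
    · simp [Fin.insertNth_apply_succAbove]
  have hd : ∀ x, HasFDerivAt (fun x : Space d => (j.insertNth x X : Config (n + 1) d))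
      (ContinuousLinearMap.single ℝ (fun _ : Fin (n + 1) => Space d) j) x := by
    intro x
    rw [funext hins]
    exact (ContinuousLinearMap.hasFDerivAt _).const_add _
  have hsm : ContDiff ℝ ∞ fun x : Space d => (j.insertNth x X : Config (n + 1) d) := by
    rw [funext hins]
    exact contDiff_const.add (ContinuousLinearMap.contDiff _)
  have hcl : Topology.IsClosedEmbedding
      fun x : Space d => (j.insertNth x X : Config (n + 1) d) := by
    refine Topology.IsClosedEmbedding.of_continuous_injective_isClosedMap hsm.continuous
      (fun x y hxy => ?_) ?_
    · simpa using congrFun hxy j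
    · refine (Function.LeftInverse.isClosedEmbedding (f := fun Y : Config (n + 1) d => Y j)
        (g := fun x : Space d => (j.insertNth x X : Config (n + 1) d)) (fun x => by simp)
        (continuous_apply j) hsm.continuous).isClosedMap
  have e := h.integral_eq (fun x => φ (j.insertNth x X)) (h1.comp hsm)
    (h2.comp_isClosedEmbedding hcl)
  have e1 : ∀ x, fderiv ℝ (fun x => φ (j.insertNth x X)) x u
      = fderiv ℝ φ (j.insertNth x X) (Pi.single j u) := by
    intro x
    have := (h1.differentiable (by simp) (j.insertNth x X)).hasFDerivAt.comp x (hd x)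
    erw [this.fderiv]
    rfl
  have p1 : ∀ x, ∏ k, f k ((j.insertNth x X : Config (n + 1) d) k)
      = f j x * ∏ i, f (j.succAbove i) (X i) := by
    intro x
    rw [Fin.prod_univ_succAbove _ j]
    simp
  have p2 : ∀ x, ∏ k, Function.update f j g k ((j.insertNth x X : Config (n + 1) d) k)
      = g x * ∏ i, f (j.succAbove i) (X i) := by
    intro x
    rw [Fin.prod_univ_succAbove _ j]
    simp
  simp only [p1, p2, smul_eq_mul, e1, ← mul_assoc] at e ⊢
  rw [integral_mul_const, integral_mul_const, e, neg_mul]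

/-- By uniqueness of weak derivatives, the infimum in the definition has one value. -/
theorem kineticForm_eq {N d : ℕ} {ψ : Config N d → ℂ} {G : Config N d → Config N d →L[ℝ] ℂ}
    (h : HasWeakFDeriv ψ G) : kineticForm ψ = ∫⁻ X, ∑ j : Fin N, ∑ a : Fin d,
      ‖G X (Pi.single j (EuclideanSpace.single a (1 : ℝ)))‖ₑ ^ 2 := by
  refine le_antisymm (iInf₂_le G h) (le_iInf₂ fun G' h' => le_of_eq ?_)
  refine lintegral_congr_ae ?_
  filter_upwards [h.ae_unique h' ae_eq_rfl] with X hX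
  rw [hX]

/-! ### Cutoffs, one-particle densities and the transition kernel -/

/-- A real cutoff at scale `ε`, normalized in `L²`. Of the rotation invariance only evenness is
kept. -/
structure IsCutoff {d : ℕ} (η : Space d → ℝ) (ε : ℝ) : Prop where
  contDiff : ContDiff ℝ ∞ η
  even : ∀ x, η (-x) = η x
  norm_le : ∀ x, η x ≠ 0 → ‖x‖ ≤ ε
  integral_sq : ∫ x, η x ^ 2 = 1

/-- A measurable probability density. -/
structure IsDensity {d : ℕ} (ρ : Space d → ℝ) : Prop where
  measurable : Measurable ρ
  nonneg : ∀ x, 0 ≤ ρ x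
  lintegral_eq : ∫⁻ x, ENNReal.ofReal (ρ x) = 1

/-- The density `ρ ∗ η²` of the smeared particle; it is `smoothed ρ χ ε` for `η = χ_ε`. -/
@[irreducible] noncomputable def smear {d : ℕ} (ρ η : Space d → ℝ) (z : Space d) : ℝ :=
  ∫ x, ρ x * η (z - x) ^ 2

/-- The joint density at `x, z` of a particle and of its smeared position. -/
noncomputable def smearJoint {d : ℕ} (ρ η : Space d → ℝ) (x z : Space d) : ℝ≥0∞ :=
  ENNReal.ofReal (ρ x * η (x - z) ^ 2)

/-- The conditional density of the smeared position `z` given `y`, divided by the density of `z`. -/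
noncomputable def smearWeight {d : ℕ} (ρ η : Space d → ℝ) (y z : Space d) : ℝ≥0∞ :=
  ENNReal.ofReal (η (z - y) ^ 2 / smear ρ η z)

/-- The transition density from `y` to `x`: smear `y` to `z`, then choose `x` according to its
conditional law given its smeared position `z`. -/
@[irreducible] noncomputable def transition {d : ℕ} (ρ η : Space d → ℝ) (y x : Space d) : ℝ≥0∞ :=
  ∫⁻ z, smearJoint ρ η x z * smearWeight ρ η y z

theorem IsDensity.integrable {d : ℕ} {ρ : Space d → ℝ} (hρ : IsDensity ρ) : Integrable ρ := by
  refine ⟨hρ.measurable.aestronglyMeasurable, ?_⟩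
  rw [hasFiniteIntegral_iff_ofReal (ae_of_all _ hρ.nonneg), hρ.lintegral_eq]
  exact ENNReal.one_lt_top

theorem IsDensity.integral_eq {d : ℕ} {ρ : Space d → ℝ} (hρ : IsDensity ρ) : ∫ x, ρ x = 1 := by
  rw [integral_eq_lintegral_of_nonneg_ae (ae_of_all _ hρ.nonneg)
    hρ.measurable.aestronglyMeasurable, hρ.lintegral_eq, ENNReal.toReal_one]

namespace IsCutoff

variable {d : ℕ} {η : Space d → ℝ} {ε : ℝ} (hη : IsCutoff η ε)
include hη

theorem measurable : Measurable η := hη.contDiff.continuous.measurable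

theorem hasCompactSupport : HasCompactSupport η :=
  HasCompactSupport.of_support_subset_isCompact (isCompact_closedBall 0 ε) fun x hx => by
    simpa using hη.norm_le x hx

theorem norm_le_of_fderiv_ne_zero {x : Space d} (hx : fderiv ℝ η x ≠ 0) : ‖x‖ ≤ ε := by
  have h1 : x ∈ tsupport η := support_fderiv_subset ℝ hx
  have h2 : tsupport η ⊆ Metric.closedBall 0 ε :=
    closure_minimal (fun y hy => by simpa using hη.norm_le y hy) Metric.isClosed_closedBall
  simpa using h2 h1

theorem integrable_sq : Integrable fun x => η x ^ 2 := by
  have h : HasCompactSupport fun x => η x ^ 2 := by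
    simp only [pow_two]
    exact hη.hasCompactSupport.mul_left
  exact (hη.contDiff.continuous.pow 2).integrable_of_hasCompactSupport h

theorem lintegral_sq : ∫⁻ x, ENNReal.ofReal (η x ^ 2) = 1 := by
  rw [← ofReal_integral_eq_lintegral_ofReal hη.integrable_sq (ae_of_all _ fun x => by positivity),
    hη.integral_sq, ENNReal.ofReal_one]

theorem lintegral_sq_sub_left (y : Space d) : ∫⁻ z, ENNReal.ofReal (η (z - y) ^ 2) = 1 := by
  rw [lintegral_sub_right_eq_self (fun z => ENNReal.ofReal (η z ^ 2)) y, hη.lintegral_sq]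

theorem apply_sub_comm (x z : Space d) : η (x - z) = η (z - x) := by
  rw [← hη.even, neg_sub]

variable {ρ : Space d → ℝ} (hρ : IsDensity ρ)
include hρ

theorem integrable_smear (z : Space d) : Integrable fun x => ρ x * η (z - x) ^ 2 := by
  obtain ⟨C, hC⟩ := hη.contDiff.continuous.bounded_above_of_compact_support hη.hasCompactSupport
  refine hρ.integrable.mul_bdd (c := C ^ 2) ?_ (ae_of_all _ fun x => ?_)
  · exact ((hη.measurable.comp (measurable_const.sub measurable_id)).pow_const
      2).aestronglyMeasurable
  · rw [norm_pow]
    exact pow_le_pow_left₀ (norm_nonneg _) (hC _) 2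

theorem measurable_smear : Measurable (smear ρ η) := by
  have : StronglyMeasurable fun p : Space d × Space d => ρ p.2 * η (p.1 - p.2) ^ 2 :=
    ((hρ.measurable.comp measurable_snd).mul ((hη.measurable.comp
      (measurable_fst.sub measurable_snd)).pow_const 2)).stronglyMeasurable
  unfold smear
  exact this.integral_prod_right.measurable

omit hη in
theorem smear_nonneg (z : Space d) : 0 ≤ smear ρ η z := by
  unfold smear
  exact integral_nonneg fun x => mul_nonneg (hρ.nonneg x) (sq_nonneg _)

theorem measurable_smearJoint :
    Measurable fun p : Space d × Space d => smearJoint ρ η p.1 p.2 :=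
  ((hρ.measurable.comp measurable_fst).mul ((hη.measurable.comp
    (measurable_fst.sub measurable_snd)).pow_const 2)).ennreal_ofReal

theorem measurable_smearWeight :
    Measurable fun p : Space d × Space d => smearWeight ρ η p.1 p.2 :=
  (((hη.measurable.comp (measurable_snd.sub measurable_fst)).pow_const 2).div
    ((hη.measurable_smear hρ).comp measurable_snd)).ennreal_ofReal

theorem measurable_smearJoint_comp {Ω : Type*} [MeasurableSpace Ω] {f g : Ω → Space d}
    (hf : Measurable f) (hg : Measurable g) : Measurable fun p => smearJoint ρ η (f p) (g p) :=
  Measurable.comp (g := fun p : Space d × Space d => smearJoint ρ η p.1 p.2)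
    (hη.measurable_smearJoint hρ) (hf.prodMk hg)

theorem measurable_smearWeight_comp {Ω : Type*} [MeasurableSpace Ω] {f g : Ω → Space d}
    (hf : Measurable f) (hg : Measurable g) : Measurable fun p => smearWeight ρ η (f p) (g p) := by
  have h := (hη.measurable_smear hρ).comp hg
  exact (((hη.measurable.comp (hg.sub hf)).pow_const 2).div h).ennreal_ofReal

theorem measurable_transition :
    Measurable fun p : Space d × Space d => transition ρ η p.1 p.2 := by
  have h1 : Measurable fun p : (Space d × Space d) × Space d => smearJoint ρ η p.1.2 p.2 :=
    hη.measurable_smearJoint_comp hρ measurable_fst.snd measurable_snd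
  have h2 : Measurable fun p : (Space d × Space d) × Space d => smearWeight ρ η p.1.1 p.2 :=
    hη.measurable_smearWeight_comp hρ measurable_fst.fst measurable_snd
  unfold transition
  exact Measurable.lintegral_prod_right'
    (f := fun p : (Space d × Space d) × Space d =>
      smearJoint ρ η p.1.2 p.2 * smearWeight ρ η p.1.1 p.2) (h1.mul h2)

theorem measurable_transition_comp {Ω : Type*} [MeasurableSpace Ω] {f g : Ω → Space d}
    (hf : Measurable f) (hg : Measurable g) : Measurable fun p => transition ρ η (f p) (g p) :=
  Measurable.comp (g := fun p : Space d × Space d => transition ρ η p.1 p.2)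
    (hη.measurable_transition hρ) (hf.prodMk hg)

theorem lintegral_smearJoint (z : Space d) :
    ∫⁻ x, smearJoint ρ η x z = ENNReal.ofReal (smear ρ η z) := by
  unfold smear
  rw [ofReal_integral_eq_lintegral_ofReal (hη.integrable_smear hρ z)
    (ae_of_all _ fun x => mul_nonneg (hρ.nonneg x) (sq_nonneg _))]
  exact lintegral_congr fun x => by rw [smearJoint, hη.apply_sub_comm]

omit hη in
theorem smearWeight_mul_smear (y z : Space d) :
    smearWeight ρ η y z * ENNReal.ofReal (smear ρ η z)
      = if smear ρ η z = 0 then 0 else ENNReal.ofReal (η (z - y) ^ 2) := by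
  split_ifs with h
  · simp [h]
  · have h0 : 0 < smear ρ η z := lt_of_le_of_ne (smear_nonneg hρ z) (Ne.symm h)
    rw [smearWeight, ← ENNReal.ofReal_mul (by positivity), div_mul_cancel₀ _ h]

/-- Bayes' rule: given its smeared position `z`, a particle of density `ρ` has the conditional
density `smearWeight ρ η y z * ρ y`. With `0 / 0 = 0`, its integral is zero where the
density of `z` vanishes. -/
theorem lintegral_smearWeight_mul (z : Space d) :
    ∫⁻ y, smearWeight ρ η y z * ENNReal.ofReal (ρ y) = if smear ρ η z = 0 then 0 else 1 := by
  have h1 : ∀ y, smearWeight ρ η y z * ENNReal.ofReal (ρ y)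
      = ENNReal.ofReal ((smear ρ η z)⁻¹) * smearJoint ρ η y z := by
    intro y
    rw [smearWeight, smearJoint, ← ENNReal.ofReal_mul (div_nonneg (sq_nonneg _)
      (smear_nonneg hρ z)), ← ENNReal.ofReal_mul (inv_nonneg.2 (smear_nonneg hρ z)),
      hη.apply_sub_comm z y]
    congr 1
    ring
  have h2 : Measurable fun y => smearJoint ρ η y z :=
    hη.measurable_smearJoint_comp hρ measurable_id measurable_const
  simp_rw [h1]
  rw [lintegral_const_mul _ h2, hη.lintegral_smearJoint hρ,
    ← ENNReal.ofReal_mul (inv_nonneg.2 (smear_nonneg hρ z))]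
  split_ifs with h
  · simp [h]
  · rw [inv_mul_cancel₀ h, ENNReal.ofReal_one]

/-- A smeared particle almost surely avoids the zeros of its density. -/
theorem ae_smear_ne_zero : ∀ᵐ y ∂(volume.withDensity fun x => ENNReal.ofReal (ρ x)),
    ∀ᵐ z, η (z - y) ≠ 0 → smear ρ η z ≠ 0 := by
  let A : Set (Space d) := {z | smear ρ η z = 0}
  have hA : MeasurableSet A := hη.measurable_smear hρ (measurableSet_singleton 0)
  have hm : Measurable fun p : Space d × Space d =>
      A.indicator (fun z => smearJoint ρ η p.1 z) p.2 := by
    have := (hη.measurable_smearJoint hρ).indicator (measurable_snd hA)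
    convert! this using 1
  have h0 : ∫⁻ y, ∫⁻ z, A.indicator (fun z => smearJoint ρ η y z) z = 0 := by
    rw [lintegral_lintegral_swap hm.aemeasurable]
    refine (lintegral_congr fun z => ?_).trans lintegral_zero
    by_cases hz : z ∈ A
    · simp only [Set.indicator_of_mem hz]
      rw [hη.lintegral_smearJoint hρ, show smear ρ η z = 0 from hz, ENNReal.ofReal_zero]
    · simp [Set.indicator_of_notMem hz]
  rw [lintegral_eq_zero_iff hm.lintegral_prod_right'] at h0
  rw [ae_withDensity_iff hρ.measurable.ennreal_ofReal]
  filter_upwards [h0] with y hy hρy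
  have hmy : Measurable fun z => A.indicator (fun z => smearJoint ρ η y z) z :=
    hm.comp (measurable_prodMk_left (x := y))
  rw [Pi.zero_apply, lintegral_eq_zero_iff hmy] at hy
  filter_upwards [hy] with z hz hne hz0
  rw [Pi.zero_apply, Set.indicator_of_mem (show z ∈ A from hz0), smearJoint,
    ENNReal.ofReal_eq_zero] at hz
  have h1 : 0 < ρ y := by
    by_contra hcon
    exact hρy (ENNReal.ofReal_eq_zero.2 (not_lt.1 hcon))
  rw [hη.apply_sub_comm] at hz
  have : 0 < ρ y * η (z - y) ^ 2 := by positivity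
  linarith

/-- For almost every `y` the convention `0 / 0 = 0` loses no mass. -/
theorem ae_smearWeight_mul_smear : ∀ᵐ y ∂(volume.withDensity fun x => ENNReal.ofReal (ρ x)),
    ∀ᵐ z, smearWeight ρ η y z * ENNReal.ofReal (smear ρ η z)
      = ENNReal.ofReal (η (z - y) ^ 2) := by
  filter_upwards [hη.ae_smear_ne_zero hρ] with y hy
  filter_upwards [hy] with z hz
  rw [smearWeight_mul_smear hρ]
  split_ifs with h
  · by_cases h0 : η (z - y) = 0
    · simp [h0]
    · exact absurd h (hz h0)
  · rfl

theorem lintegral_smearWeight_mul_smear :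
    ∀ᵐ y ∂(volume.withDensity fun x => ENNReal.ofReal (ρ x)),
      ∫⁻ z, smearWeight ρ η y z * ENNReal.ofReal (smear ρ η z) = 1 := by
  filter_upwards [hη.ae_smearWeight_mul_smear hρ] with y hy
  rw [lintegral_congr_ae hy, hη.lintegral_sq_sub_left]

/-- The transition density is a probability density. -/
theorem lintegral_transition : ∀ᵐ y ∂(volume.withDensity fun x => ENNReal.ofReal (ρ x)),
    ∫⁻ x, transition ρ η y x = 1 := by
  filter_upwards [hη.lintegral_smearWeight_mul_smear hρ] with y hy
  have hm : Measurable fun p : Space d × Space d =>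
      smearJoint ρ η p.1 p.2 * smearWeight ρ η y p.2 :=
    (hη.measurable_smearJoint hρ).mul (hη.measurable_smearWeight_comp hρ
      measurable_const measurable_snd)
  unfold transition
  rw [lintegral_lintegral_swap hm.aemeasurable, ← hy]
  refine lintegral_congr fun z => ?_
  have h2 : Measurable fun x => smearJoint ρ η x z :=
    hη.measurable_smearJoint_comp hρ measurable_id measurable_const
  rw [lintegral_mul_const _ h2, hη.lintegral_smearJoint hρ, mul_comm]

/-- The density `ρ` is stationary for the transition. -/
theorem lintegral_transition_mul : ∀ᵐ x, ∫⁻ y, transition ρ η y x * ENNReal.ofReal (ρ y)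
    = ENNReal.ofReal (ρ x) := by
  have h := hη.ae_smear_ne_zero hρ
  rw [ae_withDensity_iff hρ.measurable.ennreal_ofReal] at h
  filter_upwards [h] with x hx
  have hm : Measurable fun p : Space d × Space d =>
      smearJoint ρ η x p.2 * smearWeight ρ η p.1 p.2 :=
    (hη.measurable_smearJoint_comp hρ measurable_const measurable_snd).mul
      (hη.measurable_smearWeight hρ)
  have e1 : ∀ y, transition ρ η y x * ENNReal.ofReal (ρ y)
      = ∫⁻ z, smearJoint ρ η x z * smearWeight ρ η y z * ENNReal.ofReal (ρ y) := fun y => by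
    have hy : Measurable fun z => smearJoint ρ η x z * smearWeight ρ η y z :=
      (hη.measurable_smearJoint_comp hρ measurable_const measurable_id).mul
        (hη.measurable_smearWeight_comp hρ measurable_const measurable_id)
    rw [transition, lintegral_mul_const _ hy]
  simp_rw [e1]
  rw [lintegral_lintegral_swap
    (hm.mul (hρ.measurable.ennreal_ofReal.comp measurable_fst)).aemeasurable]
  have e2 : ∀ z, ∫⁻ y, smearJoint ρ η x z * smearWeight ρ η y z * ENNReal.ofReal (ρ y)
      = smearJoint ρ η x z * if smear ρ η z = 0 then 0 else 1 := by
    intro z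
    simp_rw [mul_assoc]
    rw [lintegral_const_mul, hη.lintegral_smearWeight_mul hρ]
    exact (hη.measurable_smearWeight_comp hρ measurable_id measurable_const).mul
      hρ.measurable.ennreal_ofReal
  simp_rw [e2]
  have e3 : ∀ z, smearJoint ρ η x z = ENNReal.ofReal (ρ x) * ENNReal.ofReal (η (z - x) ^ 2) :=
    fun z => by rw [smearJoint, ENNReal.ofReal_mul (hρ.nonneg x), hη.apply_sub_comm]
  by_cases h0 : ENNReal.ofReal (ρ x) = 0
  · simp [e3, h0]
  · have e4 : (fun z => smearJoint ρ η x z * if smear ρ η z = 0 then 0 else 1)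
        =ᵐ[volume] fun z => ENNReal.ofReal (ρ x) * ENNReal.ofReal (η (z - x) ^ 2) := by
      filter_upwards [hx h0] with z hz
      split_ifs with hz0
      · have : η (z - x) = 0 := by
          by_contra hne
          exact hz hne hz0
        simp [this]
      · rw [mul_one, e3]
    rw [lintegral_congr_ae e4, lintegral_const_mul' _ _ ENNReal.ofReal_ne_top,
      hη.lintegral_sq_sub_left, mul_one]

omit hρ in
theorem norm_sub_le_of_smearJoint_ne_zero {x z : Space d} (h : smearJoint ρ η x z ≠ 0) :
    ‖x - z‖ ≤ ε := by
  refine hη.norm_le _ fun h0 => h ?_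
  simp [smearJoint, h0]

omit hρ in
theorem norm_sub_le_of_smearWeight_ne_zero {y z : Space d} (h : smearWeight ρ η y z ≠ 0) :
    ‖z - y‖ ≤ ε := by
  refine hη.norm_le _ fun h0 => h ?_
  simp [smearWeight, h0]

omit hρ in
/-- A particle moves by at most `ε` in the smearing and by at most `ε` in the choice of `x`. -/
theorem norm_sub_le_of_transition_ne_zero {y x : Space d} (h : transition ρ η y x ≠ 0) :
    ‖x - y‖ ≤ 2 * ε := by
  unfold transition at h
  by_contra hlt
  refine h ((lintegral_congr fun z => ?_).trans lintegral_zero)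
  by_contra hne
  have h1 := hη.norm_sub_le_of_smearJoint_ne_zero (left_ne_zero_of_mul hne)
  have h2 := hη.norm_sub_le_of_smearWeight_ne_zero (right_ne_zero_of_mul hne)
  have h3 := norm_sub_le_norm_sub_add_norm_sub x z y
  exact hlt (by linarith)

end IsCutoff

/-! ### Rescaling -/

section Rescale

variable {d : ℕ} {χ : Space d → ℝ} {ε : ℝ}

/-- The prefactor of `χ_ε` is the one for which squares keep their integral. -/
theorem integral_rescale (hε : 0 < ε) (F : Space d → ℝ) :
    ∫ x : Space d, (ε ^ (-(d : ℝ) / 2)) ^ 2 * F (ε⁻¹ • x) = ∫ x, F x := by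
  rw [integral_const_mul, Measure.integral_comp_smul]
  have h1 : (ε ^ (-(d : ℝ) / 2)) ^ 2 = (ε ^ d)⁻¹ := by
    rw [← Real.rpow_natCast, ← Real.rpow_mul hε.le, ← Real.rpow_natCast ε d, ← Real.rpow_neg hε.le]
    congr 1
    push_cast
    ring
  rw [h1, finrank_euclideanSpace_fin, smul_eq_mul, inv_pow, inv_inv, abs_of_pos (by positivity),
    ← mul_assoc, inv_mul_cancel₀ (by positivity), one_mul]

theorem isCutoff_rescale (hε : 0 < ε) (h1 : ContDiff ℝ ∞ χ)
    (h2 : ∀ x y : Space d, ‖x‖ = ‖y‖ → χ x = χ y)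
    (h3 : Function.support χ ⊆ Metric.closedBall 0 1) (h4 : ∫ x, χ x ^ 2 = 1) :
    IsCutoff (rescale χ ε) ε where
  contDiff := contDiff_const.mul (h1.comp (contDiff_const_smul _))
  even x := by
    unfold rescale
    rw [h2 (ε⁻¹ • -x) (ε⁻¹ • x) (by simp)]
  norm_le x hx := by
    have h5 : χ (ε⁻¹ • x) ≠ 0 := right_ne_zero_of_mul hx
    have h6 := h3 h5
    rw [mem_closedBall_zero_iff, norm_smul, norm_inv, Real.norm_of_nonneg hε.le,
      inv_mul_le_iff₀ hε] at h6
    linarith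
  integral_sq := by
    rw [← h4, ← integral_rescale hε fun u => χ u ^ 2]
    simp only [rescale, mul_pow]

theorem integral_norm_sq_mul_rescale (hε : 0 < ε) :
    ∫ x, ‖x‖ ^ 2 * rescale χ ε x ^ 2 = ε ^ 2 * ∫ u, ‖u‖ ^ 2 * χ u ^ 2 := by
  rw [← integral_rescale hε (fun u => ‖u‖ ^ 2 * χ u ^ 2), ← integral_const_mul]
  congr 1
  funext x
  rw [rescale, norm_smul, norm_inv, Real.norm_of_nonneg hε.le]
  field_simp

theorem integral_norm_fderiv_rescale_sq (hε : 0 < ε) (h1 : ContDiff ℝ ∞ χ) :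
    ∫ x, ‖fderiv ℝ (rescale χ ε) x‖ ^ 2 = 1 / ε ^ 2 * ∫ x, ‖fderiv ℝ χ x‖ ^ 2 := by
  rw [← integral_rescale hε (fun u => ‖fderiv ℝ χ u‖ ^ 2), ← integral_const_mul]
  congr 1
  funext x
  have hd : HasFDerivAt (rescale χ ε)
      ((ε ^ (-(d : ℝ) / 2)) • ((fderiv ℝ χ (ε⁻¹ • x)).comp
        (ε⁻¹ • ContinuousLinearMap.id ℝ (Space d)))) x :=
    ((h1.differentiable (by simp) (ε⁻¹ • x)).hasFDerivAt.comp x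
      ((hasFDerivAt_id x).const_smul ε⁻¹)).const_mul _
  rw [hd.fderiv, ContinuousLinearMap.comp_smul, ContinuousLinearMap.comp_id, norm_smul, norm_smul,
    norm_inv, Real.norm_of_nonneg hε.le, Real.norm_of_nonneg (by positivity)]
  field_simp

end Rescale

/-! ### Marginals of densities on products -/

theorem map_fst_withDensity_prod {A B : Type*} [MeasurableSpace A] [MeasurableSpace B]
    {μ : Measure A} {ν : Measure B} [SFinite μ] [SFinite ν] {f : A × B → ℝ≥0∞}
    (hf : Measurable f) : ((μ.prod ν).withDensity f).map Prod.fst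
      = μ.withDensity fun a => ∫⁻ b, f (a, b) ∂ν := by
  refine Measure.ext fun s hs => ?_
  rw [Measure.map_apply measurable_fst hs, withDensity_apply _ (measurable_fst hs),
    withDensity_apply _ hs, ← Set.prod_univ, setLIntegral_prod _ hf.aemeasurable.restrict]
  simp

theorem map_snd_withDensity_prod {A B : Type*} [MeasurableSpace A] [MeasurableSpace B]
    {μ : Measure A} {ν : Measure B} [SFinite μ] [SFinite ν] {f : A × B → ℝ≥0∞}
    (hf : Measurable f) : ((μ.prod ν).withDensity f).map Prod.snd
      = ν.withDensity fun b => ∫⁻ a, f (a, b) ∂μ := by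
  refine Measure.ext fun s hs => ?_
  rw [Measure.map_apply measurable_snd hs, withDensity_apply _ (measurable_snd hs),
    withDensity_apply _ hs, ← Set.univ_prod, setLIntegral_prod_symm _ hf.aemeasurable.restrict]
  simp

/-! ### The mean displacement of the transition -/

namespace IsCutoff

variable {d : ℕ} {η : Space d → ℝ} {ε : ℝ} (hη : IsCutoff η ε)
include hη

theorem integrable_sq_smul : Integrable fun u => (η u ^ 2) • u := by
  have h : HasCompactSupport fun x => (η x ^ 2) • x := by
    simp only [pow_two, mul_smul]
    exact hη.hasCompactSupport.smul_right
  exact ((hη.contDiff.continuous.pow 2).smul continuous_id).integrable_of_hasCompactSupport h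

theorem integral_sq_smul : ∫ u, (η u ^ 2) • u = 0 := by
  have h := integral_neg_eq_self (fun u : Space d => (η u ^ 2) • u) volume
  simp only [hη.even, smul_neg, integral_neg] at h
  have h2 : (2 : ℝ) • ∫ u, (η u ^ 2) • u = 0 := by
    rw [two_smul]
    nth_rewrite 1 [← h]
    exact neg_add_cancel _
  exact (smul_eq_zero.1 h2).resolve_left two_ne_zero

theorem integrable_norm_sq_mul : Integrable fun u => ‖u‖ ^ 2 * η u ^ 2 := by
  have h : HasCompactSupport fun u => ‖u‖ ^ 2 * η u ^ 2 := by
    simp only [pow_two, ← mul_assoc]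
    exact hη.hasCompactSupport.mul_left
  exact ((continuous_norm.pow 2).mul (hη.contDiff.continuous.pow 2)).integrable_of_hasCompactSupport
    h

variable {ρ : Space d → ℝ} (hρ : IsDensity ρ)
include hρ

/-- The smeared displacement `∫ ρ(x) η(x - z)² (x - z) dx` is a commutator: since `u ↦ η(u)² u` is
odd, `ρ(z + u)` may be replaced by `ρ(z + u) - ρ(z)`. -/
theorem lintegral_enorm_displacement_le {G : Space d → Space d →L[ℝ] ℝ} (hG : HasWeakFDeriv ρ G)
    (hGi : Integrable G) (hGm : StronglyMeasurable G) :
    ∫⁻ z, ‖∫ x, (ρ x * η (x - z) ^ 2) • (x - z)‖ₑ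
      ≤ ENNReal.ofReal (∫ x, ‖G x‖) * ENNReal.ofReal (∫ u, ‖u‖ ^ 2 * η u ^ 2) := by
  have hcont : Continuous fun u : Space d => (η u ^ 2) • u :=
    (hη.contDiff.continuous.pow 2).smul continuous_id
  obtain ⟨C, hC⟩ := hcont.bounded_above_of_compact_support (by
    simp only [pow_two, mul_smul]
    exact hη.hasCompactSupport.smul_right)
  have h1 : ∀ z, ∫ x, (ρ x * η (x - z) ^ 2) • (x - z)
      = ∫ u, (ρ (u + z) - ρ z) • ((η u ^ 2) • u) := by
    intro z
    rw [← integral_add_right_eq_self _ z]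
    simp only [add_sub_cancel_right]
    have i1 : Integrable fun u => ρ (u + z) • ((η u ^ 2) • u) :=
      (hρ.integrable.comp_add_right z).smul_bdd
        C hcont.aestronglyMeasurable (ae_of_all _ hC)
    have i2 : Integrable fun u => ρ z • ((η u ^ 2) • u) := hη.integrable_sq_smul.smul (ρ z)
    simp only [sub_smul]
    rw [integral_sub i1 i2, integral_smul, hη.integral_sq_smul, smul_zero, sub_zero]
    exact integral_congr_ae (ae_of_all _ fun u => mul_smul _ _ _)
  have hm : Measurable fun p : Space d × Space d => ‖ρ (p.2 + p.1) - ρ p.1‖ₑ :=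
    ((hρ.measurable.comp (measurable_snd.add measurable_fst)).sub
      (hρ.measurable.comp measurable_fst)).enorm
  have hm2 : Measurable fun u : Space d => ‖(η u ^ 2) • u‖ₑ :=
    ((hη.contDiff.continuous.pow 2).smul continuous_id).measurable.enorm
  calc ∫⁻ z, ‖∫ x, (ρ x * η (x - z) ^ 2) • (x - z)‖ₑ
      ≤ ∫⁻ z, ∫⁻ u, ‖ρ (u + z) - ρ z‖ₑ * ‖(η u ^ 2) • u‖ₑ := by
        refine lintegral_mono fun z => ?_
        rw [h1]
        refine (enorm_integral_le_lintegral_enorm _).trans (le_of_eq ?_)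
        exact lintegral_congr fun u => enorm_smul _ _
    _ = ∫⁻ u, (∫⁻ z, ‖ρ (z + u) - ρ z‖ₑ) * ‖(η u ^ 2) • u‖ₑ := by
        rw [lintegral_lintegral_swap (hm.mul (hm2.comp measurable_snd)).aemeasurable]
        refine lintegral_congr fun u => ?_
        rw [lintegral_mul_const]
        · simp only [add_comm u]
        · exact hm.comp measurable_prodMk_right
    _ ≤ ∫⁻ u, (∫⁻ x, ‖G x‖ₑ) * ENNReal.ofReal (‖u‖ ^ 2 * η u ^ 2) := by
        refine lintegral_mono fun u => ?_
        have hGu : Measurable fun x => G x u :=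
          ((ContinuousLinearMap.apply ℝ ℝ u).continuous.comp_stronglyMeasurable hGm).measurable
        have hGui : Integrable fun x => G x u :=
          (ContinuousLinearMap.apply ℝ ℝ u).integrable_comp hGi
        have h2 := (hG.isWeakLineDeriv u).lintegral_enorm_translate_sub_le hρ.integrable hGui hGu
        have h3 : ∫⁻ x, ‖G x u‖ₑ ≤ (∫⁻ x, ‖G x‖ₑ) * ‖u‖ₑ := by
          rw [← lintegral_mul_const' _ _ (by finiteness)]
          exact lintegral_mono fun x => (G x).le_opENorm u
        have h4 : ‖u‖ₑ * ‖(η u ^ 2) • u‖ₑ = ENNReal.ofReal (‖u‖ ^ 2 * η u ^ 2) := by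
          rw [← ofReal_norm, ← ofReal_norm, ← ENNReal.ofReal_mul (norm_nonneg _), norm_smul,
            Real.norm_of_nonneg (sq_nonneg _)]
          congr 1
          ring
        calc _ ≤ (∫⁻ x, ‖G x‖ₑ) * ‖u‖ₑ * ‖(η u ^ 2) • u‖ₑ := by
              gcongr
              exact h2.trans h3
          _ = _ := by rw [mul_assoc, h4]
    _ = ENNReal.ofReal (∫ x, ‖G x‖) * ENNReal.ofReal (∫ u, ‖u‖ ^ 2 * η u ^ 2) := by
        have hfin : ∫⁻ x, ‖G x‖ₑ ≠ ⊤ := hGi.2.ne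
        rw [lintegral_const_mul' _ _ hfin, ofReal_integral_norm_eq_lintegral_enorm hGi,
          ofReal_integral_eq_lintegral_ofReal hη.integrable_norm_sq_mul
            (ae_of_all _ fun u => by positivity)]

/-- The mean displacement under the transition started at `y`, averaged over the law of `y`. The
step from `y` to the smeared position `z` has mean zero, since `η` is even; only the step from `z`
to `x` contributes. -/
theorem lintegral_enorm_drift_le {G : Space d → Space d →L[ℝ] ℝ} (hG : HasWeakFDeriv ρ G)
    (hGi : Integrable G) (hGm : StronglyMeasurable G) :
    ∫⁻ y, ‖∫ x, (x - y) ∂(volume.withDensity (transition ρ η y))‖ₑ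
        ∂(volume.withDensity fun x => ENNReal.ofReal (ρ x))
      ≤ ENNReal.ofReal (∫ x, ‖G x‖) * ENNReal.ofReal (∫ u, ‖u‖ ^ 2 * η u ^ 2) := by
  set b : Space d → Space d := fun z => ∫ x, (ρ x * η (x - z) ^ 2) • (x - z) with hb
  have hbm : Measurable b := by
    have : StronglyMeasurable fun p : Space d × Space d =>
        (ρ p.2 * η (p.2 - p.1) ^ 2) • (p.2 - p.1) :=
      (((hρ.measurable.comp measurable_snd).mul ((hη.measurable.comp
        (measurable_snd.sub measurable_fst)).pow_const 2)).smul
        (measurable_snd.sub measurable_fst)).stronglyMeasurable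
    exact this.integral_prod_right.measurable
  have hW : Measurable fun p : Space d × Space d => smearWeight ρ η p.1 p.2 :=
    hη.measurable_smearWeight hρ
  have key : ∀ᵐ y ∂(volume.withDensity fun x => ENNReal.ofReal (ρ x)),
      ‖∫ x, (x - y) ∂(volume.withDensity (transition ρ η y))‖ₑ
        ≤ ∫⁻ z, smearWeight ρ η y z * ‖b z‖ₑ := by
    filter_upwards [hη.lintegral_transition hρ, hη.ae_smearWeight_mul_smear hρ] with y hy1 hy2
    have hf : Measurable fun p : Space d × Space d =>
        smearJoint ρ η p.1 p.2 * smearWeight ρ η y p.2 :=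
      (hη.measurable_smearJoint hρ).mul (hη.measurable_smearWeight_comp hρ measurable_const
        measurable_snd)
    set J : Measure (Space d × Space d) := (volume.prod volume).withDensity fun p =>
      smearJoint ρ η p.1 p.2 * smearWeight ρ η y p.2 with hJ
    have hJ1 : J.map Prod.fst = volume.withDensity (transition ρ η y) := by
      rw [hJ, map_fst_withDensity_prod hf]
      exact congrArg _ (funext fun x => by rw [transition])
    have hJ2 : J.map Prod.snd = volume.withDensity fun z => ENNReal.ofReal (η (z - y) ^ 2) := by
      rw [hJ, map_snd_withDensity_prod hf]
      refine withDensity_congr_ae ?_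
      filter_upwards [hy2] with z hz
      have hmz : Measurable fun x => smearJoint ρ η x z :=
        hη.measurable_smearJoint_comp hρ measurable_id measurable_const
      rw [← hz, lintegral_mul_const _ hmz, hη.lintegral_smearJoint hρ, mul_comm]
    have hJfin : IsFiniteMeasure J := by
      refine ⟨?_⟩
      have : J Set.univ = J.map Prod.fst Set.univ := by
        rw [Measure.map_apply measurable_fst MeasurableSet.univ, Set.preimage_univ]
      rw [this, hJ1, withDensity_apply _ MeasurableSet.univ, Measure.restrict_univ, hy1]
      exact ENNReal.one_lt_top
    have hJae : ∀ᵐ p ∂J, ‖p.1 - p.2‖ ≤ ε ∧ ‖p.2 - y‖ ≤ ε := by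
      rw [hJ, ae_withDensity_iff hf]
      exact ae_of_all _ fun p hp =>
        ⟨hη.norm_sub_le_of_smearJoint_ne_zero (left_ne_zero_of_mul hp),
          hη.norm_sub_le_of_smearWeight_ne_zero (right_ne_zero_of_mul hp)⟩
    have i1 : Integrable (fun p : Space d × Space d => p.1 - p.2) J :=
      Integrable.of_bound (measurable_fst.sub measurable_snd).aestronglyMeasurable ε
        (hJae.mono fun p hp => hp.1)
    have i2 : Integrable (fun p : Space d × Space d => p.2 - y) J :=
      Integrable.of_bound (measurable_snd.sub measurable_const).aestronglyMeasurable ε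
        (hJae.mono fun p hp => hp.2)
    have e1 : ∫ x, (x - y) ∂(volume.withDensity (transition ρ η y))
        = ∫ p, (p.1 - p.2) ∂J + ∫ p, (p.2 - y) ∂J := by
      have hsub : Measurable fun x : Space d => x - y := measurable_id.sub measurable_const
      rw [← integral_add i1 i2, ← hJ1, integral_map measurable_fst.aemeasurable
        hsub.aestronglyMeasurable]
      simp
    have e2 : ∫ p, (p.2 - y) ∂J = 0 := by
      have : ∫ p, (p.2 - y) ∂J = ∫ z, (z - y) ∂(J.map Prod.snd) :=
        (integral_map measurable_snd.aemeasurable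
          (measurable_id.sub measurable_const).aestronglyMeasurable).symm
      have hηy : Measurable fun z => ENNReal.ofReal (η (z - y) ^ 2) :=
        ((hη.measurable.comp (measurable_id.sub measurable_const)).pow_const 2).ennreal_ofReal
      rw [this, hJ2, integral_withDensity_eq_integral_toReal_smul hηy
        (ae_of_all _ fun _ => ENNReal.ofReal_lt_top)]
      simp only [ENNReal.toReal_ofReal (sq_nonneg _)]
      rw [integral_sub_right_eq_self (fun u => (η u ^ 2) • u) y, hη.integral_sq_smul]
    rw [e1, e2, add_zero, hJ, integral_withDensity_eq_integral_toReal_smul hf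
      (ae_of_all _ fun p => ENNReal.mul_lt_top ENNReal.ofReal_lt_top ENNReal.ofReal_lt_top)]
    have i3 : Integrable (fun p : Space d × Space d =>
        (smearJoint ρ η p.1 p.2 * smearWeight ρ η y p.2).toReal • (p.1 - p.2))
        (volume.prod volume) :=
      (integrable_withDensity_iff_integrable_smul' hf
        (ae_of_all _ fun p => ENNReal.mul_lt_top ENNReal.ofReal_lt_top ENNReal.ofReal_lt_top)).1 i1
    rw [integral_prod_symm _ i3]
    refine (enorm_integral_le_lintegral_enorm _).trans (le_of_eq ?_)
    refine lintegral_congr fun z => ?_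
    have e3 : ∀ x, (smearJoint ρ η x z * smearWeight ρ η y z).toReal • (x - z)
        = (smearWeight ρ η y z).toReal • ((ρ x * η (x - z) ^ 2) • (x - z)) := by
      intro x
      rw [ENNReal.toReal_mul, mul_comm, mul_smul, smearJoint,
        ENNReal.toReal_ofReal (mul_nonneg (hρ.nonneg x) (sq_nonneg _))]
    simp only [e3]
    rw [integral_smul, enorm_smul, Real.enorm_of_nonneg ENNReal.toReal_nonneg,
      ENNReal.ofReal_toReal (by simp [smearWeight])]
  refine (lintegral_mono_ae key).trans ?_
  have hm : Measurable fun p : Space d × Space d => smearWeight ρ η p.1 p.2 * ‖b p.2‖ₑ :=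
    hW.mul (hbm.enorm.comp measurable_snd)
  rw [lintegral_withDensity_eq_lintegral_mul _ hρ.measurable.ennreal_ofReal
    hm.lintegral_prod_right']
  refine le_trans ?_ (hη.lintegral_enorm_displacement_le hρ hG hGi hGm)
  calc ∫⁻ y, ENNReal.ofReal (ρ y) * ∫⁻ z, smearWeight ρ η y z * ‖b z‖ₑ
      = ∫⁻ y, ∫⁻ z, ENNReal.ofReal (ρ y) * (smearWeight ρ η y z * ‖b z‖ₑ) :=
        lintegral_congr fun y => (lintegral_const_mul' _ _ ENNReal.ofReal_ne_top).symm
    _ = ∫⁻ z, ∫⁻ y, ENNReal.ofReal (ρ y) * (smearWeight ρ η y z * ‖b z‖ₑ) :=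
        lintegral_lintegral_swap
          ((hρ.measurable.ennreal_ofReal.comp measurable_fst).mul hm).aemeasurable
    _ = ∫⁻ z, (∫⁻ y, smearWeight ρ η y z * ENNReal.ofReal (ρ y)) * ‖b z‖ₑ := by
        refine lintegral_congr fun z => ?_
        rw [← lintegral_mul_const]
        · exact lintegral_congr fun y => by ring
        · have hz : Measurable fun y => smearWeight ρ η y z :=
            hη.measurable_smearWeight_comp hρ measurable_id measurable_const
          exact hz.mul hρ.measurable.ennreal_ofReal
    _ ≤ ∫⁻ z, ‖b z‖ₑ := by
        refine lintegral_mono fun z => ?_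
        rw [hη.lintegral_smearWeight_mul hρ]
        split_ifs <;> simp

end IsCutoff

namespace IsCutoff

variable {d : ℕ} {ρ η : Space d → ℝ} {ε : ℝ}

theorem measurable_transition_right (hη : IsCutoff η ε) (hρ : IsDensity ρ) (y : Space d) :
    Measurable (transition ρ η y) :=
  hη.measurable_transition_comp hρ measurable_const measurable_id

theorem measurable_transition_left (hη : IsCutoff η ε) (hρ : IsDensity ρ) (x : Space d) :
    Measurable fun y => transition ρ η y x :=
  hη.measurable_transition_comp hρ measurable_id measurable_const

/-- Measurability in `y`, which is a parameter of the measure: the integral against the transition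
density agrees almost everywhere with an integral against Lebesgue measure. -/
theorem aemeasurable_enorm_drift (hη : IsCutoff η ε) (hρ : IsDensity ρ) :
    AEMeasurable (fun y => ‖∫ x, (x - y) ∂(volume.withDensity (transition ρ η y))‖ₑ)
      (volume.withDensity fun x => ENNReal.ofReal (ρ x)) := by
  have hm : StronglyMeasurable fun p : Space d × Space d =>
      (transition ρ η p.1 p.2).toReal • (p.2 - p.1) :=
    ((hη.measurable_transition hρ).ennreal_toReal.smul
      (measurable_snd.sub measurable_fst)).stronglyMeasurable
  refine ⟨fun y => ‖∫ x, (transition ρ η y x).toReal • (x - y)‖ₑ,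
    hm.integral_prod_right.measurable.enorm, ?_⟩
  filter_upwards [hη.lintegral_transition hρ] with y hy
  have hfin : ∀ᵐ x, transition ρ η y x < ⊤ :=
    ae_lt_top (hη.measurable_transition_right hρ y) (by rw [hy]; exact ENNReal.one_ne_top)
  rw [integral_withDensity_eq_integral_toReal_smul (hη.measurable_transition_right hρ y) hfin]

end IsCutoff

/-! ### The coupling of `P` and its regularization -/

/-- The law of `(Y, X)` when `Y` has law `P` and, given `Y`, the particles `x_k` are independent
with densities `transition ρ η y_k`. -/
noncomputable def coupling {N d : ℕ} (P : Measure (Config N d)) (ρ η : Space d → ℝ) :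
    Measure (Config N d × Config N d) :=
  (P.prod volume).withDensity fun p => ∏ k, transition ρ η (p.1 k) (p.2 k)

theorem FermionicRegularization.IsMarginalDensity.isDensity {N d : ℕ} [NeZero N]
    {P : Measure (Config N d)} [IsProbabilityMeasure P] {ρ : Space d → ℝ}
    (hρ : IsMarginalDensity P ρ) : IsDensity ρ where
  measurable := hρ.measurable
  nonneg := hρ.nonneg
  lintegral_eq := by
    have h := congrArg (fun μ => μ Set.univ) hρ.marginal_eq
    rw [Measure.map_apply (measurable_pi_apply 0) MeasurableSet.univ, Set.preimage_univ,
      measure_univ, withDensity_apply _ MeasurableSet.univ, Measure.restrict_univ] at h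
    exact h.symm

theorem FermionicRegularization.IsMarginalDensity.map_eval {N d : ℕ} [NeZero N]
    {P : Measure (Config N d)} {ρ : Space d → ℝ} (hρ : IsMarginalDensity P ρ)
    (hP : IsSymmetricMeasure P) (k : Fin N) :
    P.map (fun X => X k) = volume.withDensity fun x => ENNReal.ofReal (ρ x) := by
  rw [← hρ.marginal_eq]
  conv_rhs => rw [← hP (Equiv.swap 0 k)]
  rw [Measure.map_map (measurable_pi_apply 0)
    (measurePreserving_comp_perm (d := d) (Equiv.swap 0 k)).measurable]
  exact congrArg (fun f => Measure.map f P) (funext fun X => by simp)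

/-- By symmetry, a property that holds almost surely for one particle holds for all of them. -/
theorem FermionicRegularization.IsMarginalDensity.ae_forall {N d : ℕ} [NeZero N]
    {P : Measure (Config N d)} {ρ : Space d → ℝ} (hρ : IsMarginalDensity P ρ)
    (hP : IsSymmetricMeasure P) {p : Space d → Prop}
    (h : ∀ᵐ y ∂(volume.withDensity fun x => ENNReal.ofReal (ρ x)), p y) :
    ∀ᵐ Y ∂P, ∀ k, p (Y k) := by
  rw [ae_all_iff]
  intro k
  rw [← hρ.map_eval hP k] at h
  exact ae_of_ae_map (measurable_pi_apply k).aemeasurable h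

theorem smoothed_eq_smear {d : ℕ} (ρ χ : Space d → ℝ) (ε : ℝ) (z : Space d) :
    smoothed ρ χ ε z = smear ρ (rescale χ ε) z := by
  rw [smoothed, smear]

theorem ofReal_weight {N d : ℕ} {ρ χ : Space d → ℝ} {ε : ℝ} (hρ : IsDensity ρ)
    (Y Z : Config N d) : ENNReal.ofReal (weight ρ χ ε Y Z)
      = ∏ k, smearWeight ρ (rescale χ ε) (Y k) (Z k) := by
  rw [weight, ENNReal.ofReal_prod_of_nonneg fun k _ => div_nonneg (sq_nonneg _)
    (by rw [smoothed_eq_smear]; exact IsCutoff.smear_nonneg hρ _)]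
  simp only [smoothed_eq_smear, smearWeight]

theorem regularizedMeasure_eq_withDensity {N d : ℕ} {P : Measure (Config N d)}
    {ρ χ : Space d → ℝ} {ε : ℝ} (hρ : IsDensity ρ) :
    regularizedMeasure P ρ χ ε = volume.withDensity fun X =>
      ∫⁻ q : Config N d × Config N d, ∏ k, (smearJoint ρ (rescale χ ε) (X k) (q.2 k)
        * smearWeight ρ (rescale χ ε) (q.1 k) (q.2 k)) ∂(P.prod volume) := by
  unfold regularizedMeasure
  congr 1
  funext X
  refine lintegral_congr fun q => ?_
  have p1 : ∀ k, 0 ≤ ρ (X k) * rescale χ ε (X k - q.2 k) ^ 2 := fun k =>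
    mul_nonneg (hρ.nonneg _) (sq_nonneg _)
  rw [ENNReal.ofReal_mul (Finset.prod_nonneg fun k _ => p1 k), ofReal_weight hρ,
    ENNReal.ofReal_prod_of_nonneg fun k _ => p1 k, ← Finset.prod_mul_distrib]
  simp only [smearJoint]

/-- The integral over `Z` factorizes into the transition densities of the particles. -/
theorem regularizedMeasure_eq {N d : ℕ} {P : Measure (Config N d)} [IsProbabilityMeasure P]
    {ρ χ : Space d → ℝ} {ε : ℝ} (hη : IsCutoff (rescale χ ε) ε) (hρ : IsDensity ρ) :
    regularizedMeasure P ρ χ ε = volume.withDensity fun X =>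
      ∫⁻ Y, ∏ k, transition ρ (rescale χ ε) (Y k) (X k) ∂P := by
  rw [regularizedMeasure_eq_withDensity hρ]
  congr 1
  funext X
  have hm : ∀ k : Fin N, Measurable fun q : Config N d × Config N d =>
      smearJoint ρ (rescale χ ε) (X k) (q.2 k)
        * smearWeight ρ (rescale χ ε) (q.1 k) (q.2 k) := fun k =>
    (hη.measurable_smearJoint_comp hρ measurable_const
      ((measurable_pi_apply k).comp measurable_snd)).mul
    (hη.measurable_smearWeight_comp hρ ((measurable_pi_apply k).comp measurable_fst)
      ((measurable_pi_apply k).comp measurable_snd))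
  rw [lintegral_prod _ (Finset.measurable_fun_prod _ fun k _ => hm k).aemeasurable]
  refine lintegral_congr fun Y => ?_
  simp only [transition]
  refine lintegral_pi_prod (fun _ => volume) (fun k z => smearJoint ρ (rescale χ ε) (X k) z
    * smearWeight ρ (rescale χ ε) (Y k) z) fun k => ?_
  exact (hη.measurable_smearJoint_comp hρ measurable_const measurable_id).mul
    (hη.measurable_smearWeight_comp hρ measurable_const measurable_id)

theorem measurable_prod_transition {N d : ℕ} {ρ η : Space d → ℝ} {ε : ℝ} (hη : IsCutoff η ε)
    (hρ : IsDensity ρ) :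
    Measurable fun p : Config N d × Config N d => ∏ k, transition ρ η (p.1 k) (p.2 k) :=
  Finset.measurable_fun_prod _ fun k _ => hη.measurable_transition_comp hρ
    ((measurable_pi_apply k).comp measurable_fst) ((measurable_pi_apply k).comp measurable_snd)

theorem measurable_prod_transition_right {N d : ℕ} {ρ η : Space d → ℝ} {ε : ℝ}
    (hη : IsCutoff η ε) (hρ : IsDensity ρ) (Y : Config N d) :
    Measurable fun X : Config N d => ∏ k, transition ρ η (Y k) (X k) :=
  Finset.measurable_fun_prod _ fun k _ =>
    (hη.measurable_transition_right hρ (Y k)).comp (measurable_pi_apply k)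

/-- Under the coupling no particle moves by more than `2ε`. -/
theorem ae_coupling {N d : ℕ} {P : Measure (Config N d)} {ρ η : Space d → ℝ} {ε : ℝ}
    (hη : IsCutoff η ε) (hρ : IsDensity ρ) :
    ∀ᵐ p ∂(coupling P ρ η), ∀ k, ‖p.2 k - p.1 k‖ ≤ 2 * ε := by
  rw [coupling, ae_withDensity_iff (measurable_prod_transition hη hρ)]
  exact ae_of_all _ fun p hp k =>
    hη.norm_sub_le_of_transition_ne_zero (Finset.prod_ne_zero_iff.1 hp k (Finset.mem_univ k))

/-- The second marginal of the coupling is the regularized measure. -/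
theorem coupling_map_snd {N d : ℕ} {P : Measure (Config N d)} [IsProbabilityMeasure P]
    {ρ χ : Space d → ℝ} {ε : ℝ} (hη : IsCutoff (rescale χ ε) ε) (hρ : IsDensity ρ) :
    (coupling P ρ (rescale χ ε)).map Prod.snd = regularizedMeasure P ρ χ ε := by
  rw [coupling, map_snd_withDensity_prod (measurable_prod_transition hη hρ),
    regularizedMeasure_eq hη hρ]

section Coupling

variable {N d : ℕ} [NeZero N] {P : Measure (Config N d)} [IsProbabilityMeasure P]
  {ρ η : Space d → ℝ} {ε : ℝ}

/-- Given `Y`, the particles are independent, with a probability law for each. -/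
theorem ae_withDensity_prod_transition (hη : IsCutoff η ε) (hP : IsSymmetricMeasure P)
    (hρ : IsMarginalDensity P ρ) :
    ∀ᵐ Y ∂P, (∀ k, IsProbabilityMeasure (volume.withDensity (transition ρ η (Y k)))) ∧
      ∀ k, Measure.map (fun X : Config N d => X k)
        (volume.withDensity fun X : Config N d => ∏ k, transition ρ η (Y k) (X k))
          = volume.withDensity (transition ρ η (Y k)) := by
  filter_upwards [hρ.ae_forall hP (hη.lintegral_transition hρ.isDensity)] with Y hY
  have hprob : ∀ k, IsProbabilityMeasure (volume.withDensity (transition ρ η (Y k))) := fun k =>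
    ⟨by rw [withDensity_apply _ MeasurableSet.univ, Measure.restrict_univ, hY k]⟩
  refine ⟨hprob, fun k => ?_⟩
  have := withDensity_prod_eq_pi (volume : Measure (Space d)) (fun k => transition ρ η (Y k))
    fun k => hη.measurable_transition_right hρ.isDensity _
  rw [volume_pi, this]
  exact (measurePreserving_eval (fun k => volume.withDensity (transition ρ η (Y k))) k).map_eq

/-- The transition densities have total mass one, so that the first marginal is `P`. -/
theorem coupling_map_fst (hη : IsCutoff η ε) (hP : IsSymmetricMeasure P)
    (hρ : IsMarginalDensity P ρ) : (coupling P ρ η).map Prod.fst = P := by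
  rw [coupling, map_fst_withDensity_prod (measurable_prod_transition hη hρ.isDensity)]
  conv_rhs => rw [← withDensity_one (μ := P)]
  refine withDensity_congr_ae ?_
  filter_upwards [hρ.ae_forall hP (hη.lintegral_transition hρ.isDensity)] with Y hY
  refine (lintegral_pi_prod (fun _ => volume) (fun k x => transition ρ η (Y k) x)
    fun k => hη.measurable_transition_right hρ.isDensity _).trans ?_
  simp [hY]

theorem isProbabilityMeasure_coupling (hη : IsCutoff η ε) (hP : IsSymmetricMeasure P)
    (hρ : IsMarginalDensity P ρ) : IsProbabilityMeasure (coupling P ρ η) := by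
  refine ⟨?_⟩
  have h := congrArg (fun μ => μ Set.univ) (coupling_map_fst hη hP hρ)
  rw [Measure.map_apply measurable_fst MeasurableSet.univ, Set.preimage_univ] at h
  rw [h, measure_univ]

/-- Each particle of `X` has the density `ρ`, which is stationary for the transition. -/
theorem lintegral_eval_coupling (hη : IsCutoff η ε) (hP : IsSymmetricMeasure P)
    (hρ : IsMarginalDensity P ρ) (k : Fin N) {f : Space d → ℝ≥0∞} (hf : Measurable f) :
    ∫⁻ p, f (p.2 k) ∂(coupling P ρ η) = ∫⁻ x, f x * ENNReal.ofReal (ρ x) := by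
  have hm := measurable_prod_transition (N := N) hη hρ.isDensity
  have hfk : Measurable fun p : Config N d × Config N d => f (p.2 k) :=
    hf.comp ((measurable_pi_apply k).comp measurable_snd)
  have hT : Measurable fun p : Space d × Space d => transition ρ η p.1 p.2 * f p.2 :=
    (hη.measurable_transition hρ.isDensity).mul (hf.comp measurable_snd)
  rw [coupling, lintegral_withDensity_eq_lintegral_mul _ hm hfk,
    lintegral_prod _ (hm.mul hfk).aemeasurable]
  have e1 : ∀ᵐ Y ∂P, ∫⁻ X : Config N d, ((fun p : Config N d × Config N d =>
      ∏ k, transition ρ η (p.1 k) (p.2 k)) * fun p : Config N d × Config N d => f (p.2 k)) (Y, X)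
      = ∫⁻ x, transition ρ η (Y k) x * f x := by
    filter_upwards [ae_withDensity_prod_transition hη hP hρ] with Y hY
    have hmY := measurable_prod_transition_right hη hρ.isDensity Y
    have hmk : Measurable (transition ρ η (Y k)) :=
      hη.measurable_transition_right hρ.isDensity _
    have h1 := lintegral_withDensity_eq_lintegral_mul volume hmY
      (hf.comp (measurable_pi_apply k))
    have h2 := lintegral_withDensity_eq_lintegral_mul volume hmk hf
    have h3 := lintegral_map (μ := volume.withDensity fun X : Config N d =>
      ∏ k, transition ρ η (Y k) (X k)) hf (measurable_pi_apply k)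
    rw [hY.2 k] at h3
    exact h1.symm.trans (h3.symm.trans h2)
  rw [lintegral_congr_ae e1]
  have hT' : Measurable fun y => ∫⁻ x, transition ρ η y x * f x := hT.lintegral_prod_right'
  have e2 := lintegral_map (μ := P) hT' (measurable_pi_apply k)
  rw [hρ.map_eval hP k] at e2
  rw [← e2, lintegral_withDensity_eq_lintegral_mul _ hρ.measurable.ennreal_ofReal
    hT']
  calc ∫⁻ y, ENNReal.ofReal (ρ y) * ∫⁻ x, transition ρ η y x * f x
      = ∫⁻ y, ∫⁻ x, ENNReal.ofReal (ρ y) * (transition ρ η y x * f x) :=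
        lintegral_congr fun y => (lintegral_const_mul' _ _ ENNReal.ofReal_ne_top).symm
    _ = ∫⁻ x, ∫⁻ y, ENNReal.ofReal (ρ y) * (transition ρ η y x * f x) :=
        lintegral_lintegral_swap
          ((hρ.measurable.ennreal_ofReal.comp measurable_fst).mul hT).aemeasurable
    _ = ∫⁻ x, f x * ∫⁻ y, transition ρ η y x * ENNReal.ofReal (ρ y) := by
        refine lintegral_congr fun x => ?_
        have hx : Measurable fun y => transition ρ η y x :=
          hη.measurable_transition_left hρ.isDensity _
        have hx' : Measurable fun y => transition ρ η y x * ENNReal.ofReal (ρ y) :=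
          hx.mul hρ.measurable.ennreal_ofReal
        rw [← lintegral_const_mul _ hx']
        exact lintegral_congr fun y => by ring
    _ = ∫⁻ x, f x * ENNReal.ofReal (ρ x) := by
        refine lintegral_congr_ae ?_
        filter_upwards [hη.lintegral_transition_mul hρ.isDensity] with x hx
        rw [hx]

theorem regularizedMeasure_map_eval {χ : Space d → ℝ} (hη : IsCutoff (rescale χ ε) ε)
    (hP : IsSymmetricMeasure P) (hρ : IsMarginalDensity P ρ) (k : Fin N) :
    (regularizedMeasure P ρ χ ε).map (fun X => X k)
      = volume.withDensity fun x => ENNReal.ofReal (ρ x) := by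
  rw [← coupling_map_snd hη hρ.isDensity, Measure.map_map (measurable_pi_apply k) measurable_snd]
  refine Measure.ext_of_lintegral _ fun f hf => ?_
  rw [lintegral_map hf ((measurable_pi_apply k).comp measurable_snd),
    lintegral_withDensity_eq_lintegral_mul _ hρ.measurable.ennreal_ofReal hf]
  refine (lintegral_eval_coupling hη hP hρ k hf).trans (lintegral_congr fun x => ?_)
  rw [Pi.mul_apply, mul_comm]

theorem isProbabilityMeasure_regularizedMeasure {χ : Space d → ℝ}
    (hη : IsCutoff (rescale χ ε) ε) (hP : IsSymmetricMeasure P) (hρ : IsMarginalDensity P ρ) :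
    IsProbabilityMeasure (regularizedMeasure P ρ χ ε) := by
  have := isProbabilityMeasure_coupling hη hP hρ
  rw [← coupling_map_snd hη hρ.isDensity]
  exact Measure.isProbabilityMeasure_map measurable_snd.aemeasurable

/-- Conditioning on `Y`, a bounded vector field contracted with the displacement of one particle
averages to its contraction with the mean displacement. -/
theorem enorm_integral_displacement_le (hη : IsCutoff η ε) (hP : IsSymmetricMeasure P)
    (hρ : IsMarginalDensity P ρ) {G : Space d → Space d →L[ℝ] ℝ} (hG : HasWeakFDeriv ρ G)
    (hGi : Integrable G) (hGm : StronglyMeasurable G) (j : Fin N)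
    {L : Config N d → Space d →L[ℝ] ℝ} (hL : AEStronglyMeasurable L P) {C : ℝ}
    (hC : ∀ᵐ Y ∂P, ‖L Y‖ ≤ C) :
    Integrable (fun p : Config N d × Config N d => L p.1 (p.2 j - p.1 j)) (coupling P ρ η) ∧
    ‖∫ p : Config N d × Config N d, L p.1 (p.2 j - p.1 j) ∂(coupling P ρ η)‖ₑ
      ≤ ENNReal.ofReal C *
        (ENNReal.ofReal (∫ x, ‖G x‖) * ENNReal.ofReal (∫ u, ‖u‖ ^ 2 * η u ^ 2)) := by
  have hfst := coupling_map_fst hη hP hρ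
  have hprob := isProbabilityMeasure_coupling hη hP hρ
  have hm := measurable_prod_transition (N := N) hη hρ.isDensity
  have hL' : AEStronglyMeasurable (fun p : Config N d × Config N d => L p.1)
      (coupling P ρ η) := by
    rw [← hfst] at hL
    exact hL.comp_measurable measurable_fst
  have hC' : ∀ᵐ p ∂(coupling P ρ η), ‖L p.1‖ ≤ C := by
    rw [← hfst] at hC
    exact ae_of_ae_map measurable_fst.aemeasurable hC
  have hdm : Measurable fun p : Config N d × Config N d => p.2 j - p.1 j :=
    ((measurable_pi_apply j).comp measurable_snd).sub ((measurable_pi_apply j).comp measurable_fst)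
  have hint : Integrable (fun p : Config N d × Config N d => L p.1 (p.2 j - p.1 j))
      (coupling P ρ η) := by
    refine Integrable.of_bound (C := C * (2 * ε)) ?_ ?_
    · exact (ContinuousLinearMap.apply ℝ ℝ : Space d →L[ℝ] _).aestronglyMeasurable_comp₂
        hdm.aestronglyMeasurable hL'
    · filter_upwards [hC', ae_coupling hη hρ.isDensity] with p h1 h2
      refine ((L p.1).le_opNorm _).trans ?_
      exact mul_le_mul h1 (h2 j) (norm_nonneg _) ((norm_nonneg _).trans h1)
  refine ⟨hint, ?_⟩
  have hfin : ∀ᵐ p ∂(P.prod (volume : Measure (Config N d))),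
      ∏ k, transition ρ η (p.1 k) (p.2 k) < ⊤ := by
    refine ae_lt_top hm ?_
    have h1 := hprob.measure_univ
    rw [coupling, withDensity_apply _ MeasurableSet.univ, Measure.restrict_univ] at h1
    rw [h1]
    exact ENNReal.one_ne_top
  have hint' := (integrable_withDensity_iff_integrable_smul' hm hfin).1 hint
  rw [coupling, integral_withDensity_eq_integral_toReal_smul hm hfin, integral_prod _ hint']
  refine (enorm_integral_le_lintegral_enorm _).trans ?_
  have hfin' := Measure.ae_ae_of_ae_prod hfin
  have key : ∀ᵐ Y ∂P, ‖∫ X : Config N d, (∏ k, transition ρ η (Y k) (X k)).toReal •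
      L Y (X j - Y j)‖ₑ ≤ ENNReal.ofReal C *
        ‖∫ x, (x - Y j) ∂(volume.withDensity (transition ρ η (Y j)))‖ₑ := by
    filter_upwards [hfin', ae_withDensity_prod_transition hη hP hρ, hC] with Y h1 h2 h3
    have hmY := measurable_prod_transition_right hη hρ.isDensity Y
    have hmj : Measurable (transition ρ η (Y j)) :=
      hη.measurable_transition_right hρ.isDensity _
    have hprobj := h2.1 j
    have hsub : Measurable fun x : Space d => x - Y j := measurable_id.sub measurable_const
    rw [← integral_withDensity_eq_integral_toReal_smul hmY h1]
    have e1 : ∫ X : Config N d, L Y (X j - Y j)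
        ∂(volume.withDensity fun X : Config N d => ∏ k, transition ρ η (Y k) (X k))
        = ∫ x, L Y (x - Y j) ∂(volume.withDensity (transition ρ η (Y j))) := by
      rw [← h2.2 j, integral_map (measurable_pi_apply j).aemeasurable
        ((L Y).continuous.measurable.comp hsub).aestronglyMeasurable]
    have hi : Integrable (fun x => x - Y j) (volume.withDensity (transition ρ η (Y j))) := by
      refine Integrable.of_bound hsub.aestronglyMeasurable (2 * ε) ?_
      rw [ae_withDensity_iff hmj]
      exact ae_of_all _ fun x hx => hη.norm_sub_le_of_transition_ne_zero hx
    rw [e1, (L Y).integral_comp_comm hi]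
    refine ((L Y).le_opENorm _).trans ?_
    gcongr
    rw [← ofReal_norm]
    exact ENNReal.ofReal_le_ofReal h3
  refine (lintegral_mono_ae key).trans ?_
  rw [lintegral_const_mul' _ _ ENNReal.ofReal_ne_top]
  gcongr
  refine le_trans (le_of_eq ?_) (hη.lintegral_enorm_drift_le hρ.isDensity hG hGi hGm)
  have hdrift := hη.aemeasurable_enorm_drift hρ.isDensity
  rw [← hρ.map_eval hP j] at hdrift ⊢
  exact (lintegral_map' hdrift (measurable_pi_apply j).aemeasurable).symm

end Coupling

/-! ### Separated configurations and Taylor's formula on them -/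

theorem isClosed_separated (N d : ℕ) (r : ℝ) : IsClosed (separated N d r) := by
  have : separated N d r = ⋂ (i : Fin N) (j : Fin N) (_ : i ≠ j),
      {X : Config N d | r ≤ ‖X i - X j‖} := by
    ext X
    simp [separated]
  rw [this]
  refine isClosed_iInter fun i => isClosed_iInter fun j => isClosed_iInter fun _ => ?_
  exact isClosed_le continuous_const ((continuous_apply i).sub (continuous_apply j)).norm

/-- At a configuration `X`, the separated set contains the convex set of all `W` with
`⟨w_i - w_j, x_i - x_j⟩ ≥ |x_i - x_j|²`, whose interior contains `2 X`. -/
theorem uniqueDiffOn_separated (N d : ℕ) {r : ℝ} (hr : 0 < r) :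
    UniqueDiffOn ℝ (separated N d r) := by
  intro X hX
  let K : Set (Config N d) :=
    {W | ∀ i j, i ≠ j → ‖X i - X j‖ ^ 2 ≤ inner ℝ (W i - W j) (X i - X j)}
  have hXpos : ∀ i j, i ≠ j → 0 < ‖X i - X j‖ := fun i j hij => hr.trans_le (hX i j hij)
  have hKS : K ⊆ separated N d r := by
    intro W hW i j hij
    have h1 := (hW i j hij).trans (real_inner_le_norm _ _)
    rw [pow_two] at h1
    exact (hX i j hij).trans (le_of_mul_le_mul_right h1 (hXpos i j hij))
  have hconv : Convex ℝ K := by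
    intro U hU W hW a b ha hb hab i j hij
    have h1 := hU i j hij
    have h2 := hW i j hij
    have e : (a • U + b • W) i - (a • U + b • W) j = a • (U i - U j) + b • (W i - W j) := by
      simp only [Pi.add_apply, Pi.smul_apply, smul_sub]
      abel
    rw [e, inner_add_left, real_inner_smul_left, real_inner_smul_left]
    have h3 : ‖X i - X j‖ ^ 2 = a * ‖X i - X j‖ ^ 2 + b * ‖X i - X j‖ ^ 2 := by
      rw [← add_mul, hab, one_mul]
    rw [h3]
    gcongr
  have hopen : IsOpen {W : Config N d |
      ∀ i j, i ≠ j → ‖X i - X j‖ ^ 2 < inner ℝ (W i - W j) (X i - X j)} := by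
    simp only [Set.ofPred_forall]
    refine isOpen_iInter_of_finite fun i => isOpen_iInter_of_finite fun j =>
      isOpen_iInter_of_finite fun _ => ?_
    exact isOpen_lt continuous_const
      (((continuous_apply i).sub (continuous_apply j)).inner continuous_const)
  have hint : (interior K).Nonempty := by
    refine ⟨(2 : ℝ) • X, interior_maximal (fun W hW i j hij => (hW i j hij).le) hopen ?_⟩
    intro i j hij
    have h1 := hXpos i j hij
    rw [Pi.smul_apply, Pi.smul_apply, ← smul_sub, real_inner_smul_left,
      real_inner_self_eq_norm_sq]
    nlinarith [pow_pos h1 2]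
  have hXK : X ∈ K := fun i j _ => (real_inner_self_eq_norm_sq _).ge
  exact (uniqueDiffWithinAt_convex hconv hint (subset_closure hXK)).mono hKS

/-- If each particle moves by at most `r`, a distance decreases by at most `2r`. -/
theorem add_smul_mem_separated {N d : ℕ} {α r : ℝ} {Y V : Config N d}
    (hY : Y ∈ separated N d α) (hV : ∀ k, ‖V k‖ ≤ r) {t : ℝ} (ht : t ∈ Set.Icc (0 : ℝ) 1) :
    Y + t • V ∈ separated N d (α - 2 * r) := by
  intro i j hij
  have h1 := hY i j hij
  have h2 : ∀ k, ‖t • V k‖ ≤ r := fun k => by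
    rw [norm_smul, Real.norm_of_nonneg ht.1]
    exact (mul_le_of_le_one_left (norm_nonneg _) ht.2).trans (hV k)
  have e : Y i - Y j = ((Y + t • V) i - (Y + t • V) j) - (t • V i - t • V j) := by
    simp only [Pi.add_apply, Pi.smul_apply]
    abel
  have h3 : ‖Y i - Y j‖ ≤ ‖(Y + t • V) i - (Y + t • V) j‖ + (‖t • V i‖ + ‖t • V j‖) := by
    rw [e]
    exact (norm_sub_le _ _).trans (by gcongr; exact norm_sub_le _ _)
  linarith [h2 i, h2 j]

theorem fderivWithin_apply_eq_sum {N d : ℕ} {F : Type*} [NormedAddCommGroup F] [NormedSpace ℝ F]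
    (S : Set (Config N d)) (f : Config N d → F) (X V : Config N d) :
    fderivWithin ℝ f S X V = ∑ j, gradWithin S j f X (V j) := by
  have h := congrArg (fderivWithin ℝ f S X) (Finset.univ_sum_single V)
  rw [map_sum] at h
  exact h.symm

/-- The first-order Taylor estimate along a segment in `S`. -/
theorem abs_sub_le_of_gradWithin_le {N d : ℕ} {S : Set (Config N d)} {Φ : Config N d → ℝ}
    (hΦ : DifferentiableOn ℝ Φ S) {Y V : Config N d} {R : ℝ} (hR : 0 ≤ R)
    (hmem : ∀ t ∈ Set.Icc (0 : ℝ) 1, Y + t • V ∈ S) (hV : ∀ k, ‖V k‖ ≤ R) {C : Fin N → ℝ}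
    (hC : ∀ j, ∀ X ∈ S, ‖gradWithin S j Φ X‖ ≤ C j) :
    |Φ (Y + V) - Φ Y| ≤ R * ∑ j, C j := by
  have hγ : ∀ t : ℝ, HasDerivAt (fun t : ℝ => Y + t • V) V t := fun t => by
    simpa using ((hasDerivAt_id t).smul_const V).const_add Y
  have hd : ∀ t ∈ Set.Icc (0 : ℝ) 1, HasDerivWithinAt (fun t : ℝ => Φ (Y + t • V))
      (fderivWithin ℝ Φ S (Y + t • V) V) (Set.Icc 0 1) t := fun t ht =>
    ((hΦ _ (hmem t ht)).hasFDerivWithinAt).comp_hasDerivWithinAt t (hγ t).hasDerivWithinAt hmem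
  have hb : ∀ t ∈ Set.Icc (0 : ℝ) 1, ‖fderivWithin ℝ Φ S (Y + t • V) V‖ ≤ R * ∑ j, C j := by
    intro t ht
    rw [fderivWithin_apply_eq_sum, Finset.mul_sum]
    refine (norm_sum_le _ _).trans (Finset.sum_le_sum fun j _ => ?_)
    refine ((gradWithin S j Φ _).le_opNorm _).trans ?_
    rw [mul_comm]
    exact mul_le_mul (hV j) (hC j _ (hmem t ht)) (norm_nonneg _) hR
  have := (convex_Icc (0 : ℝ) 1).norm_image_sub_le_of_norm_hasDerivWithin_le hd hb
    (Set.left_mem_Icc.2 zero_le_one) (Set.right_mem_Icc.2 zero_le_one)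
  simpa using this

theorem contDiffOn_gradWithin {N d : ℕ} {S : Set (Config N d)} (hS : UniqueDiffOn ℝ S)
    {Φ : Config N d → ℝ} (hΦ : ContDiffOn ℝ 2 Φ S) (j : Fin N) :
    ContDiffOn ℝ 1 (gradWithin S j Φ) S :=
  (hΦ.fderivWithin hS (by norm_num)).clm_comp contDiffOn_const

/-- The second-order Taylor estimate along a segment in `S`. -/
theorem abs_sub_sub_le_of_gradWithin_le {N d : ℕ} {S : Set (Config N d)} (hS : UniqueDiffOn ℝ S)
    {Φ : Config N d → ℝ} (hΦ : ContDiffOn ℝ 2 Φ S) {Y V : Config N d} {R : ℝ} (hR : 0 ≤ R)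
    (hmem : ∀ t ∈ Set.Icc (0 : ℝ) 1, Y + t • V ∈ S) (hV : ∀ k, ‖V k‖ ≤ R)
    {H : Fin N → Fin N → ℝ}
    (hH : ∀ j k, ∀ X ∈ S, ‖gradWithin S j (gradWithin S k Φ) X‖ ≤ H j k) :
    |Φ (Y + V) - Φ Y - ∑ k, gradWithin S k Φ Y (V k)| ≤ R ^ 2 / 2 * ∑ j, ∑ k, H j k := by
  set M := R ^ 2 * ∑ j, ∑ k, H j k with hM
  have hγ : ∀ t : ℝ, HasDerivAt (fun t : ℝ => Y + t • V) V t := fun t => by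
    simpa using ((hasDerivAt_id t).smul_const V).const_add Y
  have hΦd : DifferentiableOn ℝ Φ S := hΦ.differentiableOn (by norm_num)
  have hd : ∀ t ∈ Set.Icc (0 : ℝ) 1, HasDerivWithinAt (fun t : ℝ => Φ (Y + t • V))
      (∑ k, gradWithin S k Φ (Y + t • V) (V k)) (Set.Icc 0 1) t := fun t ht => by
    rw [← fderivWithin_apply_eq_sum]
    exact ((hΦd _ (hmem t ht)).hasFDerivWithinAt).comp_hasDerivWithinAt t
      (hγ t).hasDerivWithinAt hmem
  have hd2 : ∀ t ∈ Set.Icc (0 : ℝ) 1, HasDerivWithinAt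
      (fun t : ℝ => ∑ k, gradWithin S k Φ (Y + t • V) (V k))
      (∑ k, (fderivWithin ℝ (gradWithin S k Φ) S (Y + t • V) V) (V k)) (Set.Icc 0 1) t := by
    intro t ht
    refine HasDerivWithinAt.fun_sum fun k _ => ?_
    have h1 : DifferentiableOn ℝ (gradWithin S k Φ) S :=
      (contDiffOn_gradWithin hS hΦ k).differentiableOn (by norm_num)
    have h2 := ((h1 _ (hmem t ht)).hasFDerivWithinAt).comp_hasDerivWithinAt t
      (hγ t).hasDerivWithinAt hmem
    exact ((ContinuousLinearMap.apply ℝ ℝ (V k)).hasFDerivAt.comp_hasDerivWithinAt t h2)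
  have hb2 : ∀ t ∈ Set.Icc (0 : ℝ) 1,
      ‖∑ k, (fderivWithin ℝ (gradWithin S k Φ) S (Y + t • V) V) (V k)‖ ≤ M := by
    intro t ht
    have e : ∑ k, (fderivWithin ℝ (gradWithin S k Φ) S (Y + t • V) V) (V k)
        = ∑ j, ∑ k, gradWithin S j (gradWithin S k Φ) (Y + t • V) (V j) (V k) := by
      rw [Finset.sum_comm]
      refine Finset.sum_congr rfl fun k _ => ?_
      rw [fderivWithin_apply_eq_sum, sum_apply]
    rw [e, hM, Finset.mul_sum]
    refine (norm_sum_le _ _).trans (Finset.sum_le_sum fun j _ => ?_)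
    rw [Finset.mul_sum]
    refine (norm_sum_le _ _).trans (Finset.sum_le_sum fun k _ => ?_)
    have h1 := hH j k _ (hmem t ht)
    calc ‖gradWithin S j (gradWithin S k Φ) (Y + t • V) (V j) (V k)‖
        ≤ ‖gradWithin S j (gradWithin S k Φ) (Y + t • V)‖ * ‖V j‖ * ‖V k‖ :=
          ContinuousLinearMap.le_opNorm₂ _ _ _
      _ ≤ H j k * R * R := by
          have h0 := (norm_nonneg _).trans h1
          exact mul_le_mul (mul_le_mul h1 (hV j) (norm_nonneg _) h0) (hV k) (norm_nonneg _)
            (mul_nonneg h0 hR)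
      _ = R ^ 2 * H j k := by ring
  have hlip : ∀ t ∈ Set.Icc (0 : ℝ) 1, ‖(∑ k, gradWithin S k Φ (Y + t • V) (V k))
      - ∑ k, gradWithin S k Φ Y (V k)‖ ≤ M * t := by
    intro t ht
    have := (convex_Icc (0 : ℝ) 1).norm_image_sub_le_of_norm_hasDerivWithin_le hd2 hb2
      (Set.left_mem_Icc.2 zero_le_one) ht
    simpa [abs_of_nonneg ht.1] using this
  have hmain := image_norm_le_of_norm_deriv_right_le_deriv_boundary'
    (f := fun t : ℝ => Φ (Y + t • V) - Φ Y - t * ∑ k, gradWithin S k Φ Y (V k))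
    (f' := fun t => (∑ k, gradWithin S k Φ (Y + t • V) (V k)) - ∑ k, gradWithin S k Φ Y (V k))
    (a := 0) (b := 1) (B := fun t => M * t ^ 2 / 2) (B' := fun t => M * t) ?_ ?_ ?_ ?_ ?_ ?_
    (Set.right_mem_Icc.2 zero_le_one)
  · have h2 : M * (1 : ℝ) ^ 2 / 2 = R ^ 2 / 2 * ∑ j, ∑ k, H j k := by rw [hM]; ring
    rw [h2] at hmain
    simpa using hmain
  · intro t ht
    exact ((hd t ht).continuousWithinAt.sub continuousWithinAt_const).sub
      (continuousWithinAt_id.mul continuousWithinAt_const)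
  · intro t ht
    have h1 : HasDerivWithinAt (fun t : ℝ => Φ (Y + t • V) - Φ Y
        - t * ∑ k, gradWithin S k Φ Y (V k)) ((∑ k, gradWithin S k Φ (Y + t • V) (V k))
          - 1 * ∑ k, gradWithin S k Φ Y (V k)) (Set.Icc 0 1) t :=
      ((hd t (Set.Ico_subset_Icc_self ht)).sub_const _).sub
        ((hasDerivWithinAt_id t _).mul_const _)
    rw [one_mul] at h1
    exact h1.mono_of_mem_nhdsWithin (Icc_mem_nhdsGE_of_mem ht)
  · simp
  · exact (by fun_prop : Continuous fun t : ℝ => M * t ^ 2 / 2).continuousOn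
  · intro t _
    have h1 : HasDerivAt (fun t : ℝ => M * t ^ 2 / 2) (M * (2 * t) / 2) t := by
      simpa using (((hasDerivAt_id t).pow 2).const_mul M).div_const 2
    have h2 : M * (2 * t) / 2 = M * t := by ring
    rw [h2] at h1
    exact h1.hasDerivWithinAt
  · intro t ht
    exact hlip t (Set.Ico_subset_Icc_self ht)

/-! ### The gradient of the density -/

theorem FermionicRegularization.MemH1.exists_stronglyMeasurable {d : ℕ} {f : Space d → ℝ}
    (h : MemH1 f) : ∃ G, StronglyMeasurable G ∧ HasWeakFDeriv f G ∧ MemLp G 2 volume := by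
  obtain ⟨-, G, hG, hG2⟩ := h
  obtain ⟨G', hm, he⟩ := hG2.aestronglyMeasurable
  refine ⟨G', hm, ⟨hG.locallyIntegrable, hG.locallyIntegrable_deriv.congr he,
    fun φ h1 h2 v => ?_⟩, (memLp_congr_ae he).1 hG2⟩
  rw [hG.integral_eq φ h1 h2 v]
  congr 1
  refine integral_congr_ae ?_
  filter_upwards [he] with x hx
  rw [hx]

/-- The density `ρ = (√ρ)²` has the weak gradient `2 √ρ ∇√ρ`, which is integrable. -/
theorem hasWeakFDeriv_of_sqrt {d : ℕ} {ρ : Space d → ℝ} (hρm : Measurable ρ)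
    (hρ0 : ∀ x, 0 ≤ ρ x) (h2 : MemLp (fun x => Real.sqrt (ρ x)) 2 volume)
    {G : Space d → Space d →L[ℝ] ℝ} (hGm : StronglyMeasurable G)
    (hG : HasWeakFDeriv (fun x => Real.sqrt (ρ x)) G) (hG2 : MemLp G 2 volume) :
    HasWeakFDeriv ρ (fun x => (2 * Real.sqrt (ρ x)) • G x) ∧
      Integrable (fun x => (2 * Real.sqrt (ρ x)) • G x) ∧
      StronglyMeasurable (fun x => (2 * Real.sqrt (ρ x)) • G x) := by
  have hi : Integrable (fun x => (2 * Real.sqrt (ρ x)) • G x) := by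
    have := (hG2.smul (r := 1) h2).const_smul (2 : ℝ)
    rw [memLp_one_iff_integrable] at this
    refine this.congr (ae_of_all _ fun x => ?_)
    simp only [Pi.smul_apply, Pi.smul_apply', smul_smul]
  have hsq : ρ = fun x => Real.sqrt (ρ x) ^ 2 := funext fun x => (Real.sq_sqrt (hρ0 x)).symm
  have hρi : LocallyIntegrable ρ volume := by
    rw [hsq]
    exact h2.integrable_sq.locallyIntegrable
  refine ⟨⟨hρi, hi.locallyIntegrable, fun φ h1 hc v => ?_⟩, hi, ?_⟩
  · have h3 := (hG.isWeakLineDeriv v).sq h2 ((ContinuousLinearMap.apply ℝ ℝ v).comp_memLp' hG2)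
      hρm.sqrt ((ContinuousLinearMap.apply ℝ ℝ v).continuous.comp_stronglyMeasurable
        hGm).measurable
    rw [← hsq] at h3
    exact h3.integral_eq φ h1 hc
  · exact (hρm.sqrt.const_mul 2).stronglyMeasurable.smul hGm

theorem nontrivial_space {d : ℕ} (hd : 0 < d) : Nontrivial (Space d) :=
  Module.nontrivial_of_finrank_pos (R := ℝ) (by simpa using hd)

/-- A probability density is not translation invariant, so that its gradient cannot vanish. -/
theorem integral_norm_weak_gradient_pos {d : ℕ} (hd : 0 < d) {ρ : Space d → ℝ}
    (hρ : IsDensity ρ) {G : Space d → Space d →L[ℝ] ℝ} (hG : HasWeakFDeriv ρ G)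
    (hGi : Integrable G) (hGm : StronglyMeasurable G) : 0 < ∫ x, ‖G x‖ := by
  have := nontrivial_space hd
  refine lt_of_le_of_ne (integral_nonneg fun _ => norm_nonneg _) fun h0 => ?_
  have hG0 : G =ᵐ[volume] 0 := by
    have := (integral_eq_zero_iff_of_nonneg (fun _ => norm_nonneg _) hGi.norm).1 h0.symm
    filter_upwards [this] with x hx
    simpa using hx
  have hz : ρ =ᵐ[volume] 0 := by
    refine ae_eq_zero_of_translate hρ.integrable hρ.measurable hρ.nonneg fun v => ?_
    have h1 := (hG.isWeakLineDeriv v).lintegral_enorm_translate_sub_le hρ.integrable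
      ((ContinuousLinearMap.apply ℝ ℝ v).integrable_comp hGi)
      ((ContinuousLinearMap.apply ℝ ℝ v).continuous.comp_stronglyMeasurable hGm).measurable
    have h2 : ∫⁻ x, ‖G x v‖ₑ = 0 := by
      rw [lintegral_congr_ae (g := fun _ => 0) (hG0.mono fun x hx => by simp [hx])]
      simp
    have h3 : Measurable fun x => ‖ρ (x + v) - ρ x‖ₑ :=
      ((hρ.measurable.comp (measurable_id.add_const v)).sub hρ.measurable).enorm
    rw [h2, nonpos_iff_eq_zero, lintegral_eq_zero_iff h3] at h1
    filter_upwards [h1] with x hx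
    simpa [sub_eq_zero] using hx
  have h3 := hρ.lintegral_eq
  rw [lintegral_congr_ae (g := fun _ => 0) (hz.mono fun x hx => by simp [hx])] at h3
  simp at h3

/-- Positive dimension is needed: on a point, `‖u‖` vanishes identically. -/
theorem IsCutoff.integral_norm_sq_mul_pos {d : ℕ} (hd : 0 < d) {η : Space d → ℝ} {ε : ℝ}
    (hη : IsCutoff η ε) : 0 < ∫ u, ‖u‖ ^ 2 * η u ^ 2 := by
  have := nontrivial_space hd
  refine lt_of_le_of_ne (integral_nonneg fun _ => by positivity) fun h0 => ?_
  have h1 := (integral_eq_zero_iff_of_nonneg (fun _ => by positivity)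
    hη.integrable_norm_sq_mul).1 h0.symm
  have h2 : ∫ x, η x ^ 2 = 0 := by
    refine integral_eq_zero_of_ae ?_
    filter_upwards [h1, compl_mem_ae_iff.2 (measure_singleton (0 : Space d))] with x hx hx0
    have : x ≠ 0 := hx0
    simpa [this] using hx
  rw [hη.integral_sq] at h2
  exact one_ne_zero h2

/-! ### Comparison of the potential energies -/

theorem aestronglyMeasurable_of_continuousOn {X E : Type*} [TopologicalSpace X]
    [MeasurableSpace X] [OpensMeasurableSpace X] [NormedAddCommGroup E] [SecondCountableTopology X]
    {μ : Measure X} {S : Set X} {f : X → E} (hf : ContinuousOn f S) (hS : IsClosed S)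
    (h : μ Sᶜ = 0) : AEStronglyMeasurable f μ := by
  have := hf.aestronglyMeasurable (μ := μ) hS.measurableSet
  rwa [Measure.restrict_eq_self_of_ae_mem (mem_ae_iff.2 h)] at this

theorem enorm_le_supNorm {N d : ℕ} {F : Type*} [NormedAddCommGroup F] {S : Set (Config N d)}
    {f : Config N d → F} {X : Config N d} (hX : X ∈ S) : ‖f X‖ₑ ≤ supNorm S f :=
  le_iSup₂ (f := fun X (_ : X ∈ S) => ‖f X‖ₑ) X hX

theorem norm_le_toReal_supNorm {N d : ℕ} {F : Type*} [NormedAddCommGroup F]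
    {S : Set (Config N d)} {f : Config N d → F} (h : supNorm S f ≠ ⊤) {X : Config N d}
    (hX : X ∈ S) : ‖f X‖ ≤ (supNorm S f).toReal := by
  rw [← toReal_enorm]
  exact ENNReal.toReal_mono h (enorm_le_supNorm hX)

theorem measure_compl_separated_sub {N d : ℕ} {P : Measure (Config N d)} {ε α : ℝ} (hε : 0 < ε)
    (hsupp : P (separated N d α)ᶜ = 0) :
    P (separated N d (α - 4 * ε))ᶜ = 0 :=
  measure_mono_null (Set.compl_subset_compl.2
    fun (X : Config N d) (hX : X ∈ separated N d α) i j hij =>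
      (by linarith : α - 4 * ε ≤ α).trans (hX i j hij)) hsupp

section Potential

variable {N d : ℕ} [NeZero N] {P : Measure (Config N d)} [IsProbabilityMeasure P]
  {ρ χ : Space d → ℝ} {ε α : ℝ}

/-- The segment from `Y` to `X` stays in the separated configurations, so that Taylor's formula
applies along it. -/
theorem ae_coupling_segment (hη : IsCutoff (rescale χ ε) ε) (hP : IsSymmetricMeasure P)
    (hρ : IsMarginalDensity P ρ) (hsupp : P (separated N d α)ᶜ = 0) :
    ∀ᵐ p ∂(coupling P ρ (rescale χ ε)),
      (∀ t ∈ Set.Icc (0 : ℝ) 1, p.1 + t • (p.2 - p.1) ∈ separated N d (α - 4 * ε)) ∧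
      ∀ k, ‖(p.2 - p.1) k‖ ≤ 2 * ε := by
  have h1 : ∀ᵐ p ∂(coupling P ρ (rescale χ ε)), p.1 ∈ separated N d α := by
    have h0 : ∀ᵐ Y ∂P, Y ∈ separated N d α := mem_ae_iff.2 hsupp
    rw [← coupling_map_fst hη hP hρ] at h0
    exact ae_of_ae_map measurable_fst.aemeasurable h0
  filter_upwards [h1, ae_coupling hη hρ.isDensity] with p hp1 hp2
  refine ⟨fun t ht => ?_, hp2⟩
  have := add_smul_mem_separated hp1 (V := p.2 - p.1) hp2 ht
  rwa [show α - 2 * (2 * ε) = α - 4 * ε by ring] at this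

theorem regularizedMeasure_compl_separated (hη : IsCutoff (rescale χ ε) ε)
    (hP : IsSymmetricMeasure P) (hρ : IsMarginalDensity P ρ)
    (hsupp : P (separated N d α)ᶜ = 0) :
    regularizedMeasure P ρ χ ε (separated N d (α - 4 * ε))ᶜ = 0 := by
  rw [← coupling_map_snd hη hρ.isDensity, Measure.map_apply measurable_snd
    (isClosed_separated N d _).measurableSet.compl]
  have h : ∀ᵐ p ∂(coupling P ρ (rescale χ ε)), p.2 ∈ separated N d (α - 4 * ε) := by
    filter_upwards [ae_coupling_segment hη hP hρ hsupp] with p hp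
    have := hp.1 1 (Set.right_mem_Icc.2 zero_le_one)
    rwa [one_smul, add_sub_cancel] at this
  exact ae_iff.1 h

/-- If the gradients are bounded, `Φ(X) - Φ(Y)` is bounded under the coupling. -/
theorem integrable_regularizedMeasure_iff (hη : IsCutoff (rescale χ ε) ε) (hε : 0 < ε)
    (hP : IsSymmetricMeasure P) (hρ : IsMarginalDensity P ρ)
    (hsupp : P (separated N d α)ᶜ = 0) {Φ : Config N d → ℝ}
    (hΦ : ContDiffOn ℝ 2 Φ (separated N d (α - 4 * ε)))
    (hgrad : ∀ j, supNorm (separated N d (α - 4 * ε))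
      (gradWithin (separated N d (α - 4 * ε)) j Φ) < ⊤) :
    Integrable Φ (regularizedMeasure P ρ χ ε) ↔ Integrable Φ P := by
  have hm1 : AEStronglyMeasurable Φ (regularizedMeasure P ρ χ ε) :=
    aestronglyMeasurable_of_continuousOn hΦ.continuousOn (isClosed_separated N d _)
      (regularizedMeasure_compl_separated hη hP hρ hsupp)
  have hm2 : AEStronglyMeasurable Φ P :=
    aestronglyMeasurable_of_continuousOn hΦ.continuousOn (isClosed_separated N d _)
      (measure_compl_separated_sub hε hsupp)
  have hfst := coupling_map_fst hη hP hρ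
  have hsnd := coupling_map_snd (P := P) hη hρ.isDensity
  have hprob := isProbabilityMeasure_coupling hη hP hρ
  rw [← hsnd] at hm1 ⊢
  conv_rhs => rw [← hfst]
  rw [← hfst] at hm2
  rw [integrable_map_measure hm1 measurable_snd.aemeasurable,
    integrable_map_measure hm2 measurable_fst.aemeasurable]
  have hb : Integrable (fun p => Φ p.2 - Φ p.1) (coupling P ρ (rescale χ ε)) := by
    refine Integrable.of_bound ((hm1.comp_measurable measurable_snd).sub
      (hm2.comp_measurable measurable_fst))
      (2 * ε * ∑ j, (supNorm (separated N d (α - 4 * ε))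
      (gradWithin (separated N d (α - 4 * ε)) j Φ)).toReal) ?_
    filter_upwards [ae_coupling_segment hη hP hρ hsupp] with p hp
    have := abs_sub_le_of_gradWithin_le (hΦ.differentiableOn (by norm_num)) (by positivity)
      hp.1 hp.2 fun j X hX => norm_le_toReal_supNorm (hgrad j).ne hX
    rwa [add_sub_cancel] at this
  constructor
  · intro h
    exact (h.sub hb).congr (ae_of_all _ fun p => by simp)
  · intro h
    exact (h.add hb).congr (ae_of_all _ fun p => by simp)

/-- Taylor's formula under the coupling. The first-order terms are averaged by
`enorm_integral_displacement_le`. -/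
theorem ofReal_abs_integral_sub_le (hd : 0 < d) (hχ : IsCutoff χ 1)
    (hη : IsCutoff (rescale χ ε) ε) (hε : 0 < ε) (hεα : ε < α / 4)
    (hP : IsSymmetricMeasure P) (hρ : IsMarginalDensity P ρ)
    (hsupp : P (separated N d α)ᶜ = 0) {G : Space d → Space d →L[ℝ] ℝ} (hG : HasWeakFDeriv ρ G)
    (hGi : Integrable G) (hGm : StronglyMeasurable G) {Φ : Config N d → ℝ}
    (hΦ : ContDiffOn ℝ 2 Φ (separated N d (α - 4 * ε)))
    (hi1 : Integrable Φ (regularizedMeasure P ρ χ ε)) (hi2 : Integrable Φ P) :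
    ENNReal.ofReal |(∫ X, Φ X ∂(regularizedMeasure P ρ χ ε)) - ∫ X, Φ X ∂P| ≤
      ENNReal.ofReal (ε ^ 2) *
        ((∑ j, supNorm (separated N d (α - 4 * ε))
              (gradWithin (separated N d (α - 4 * ε)) j Φ)
            * ENNReal.ofReal (∫ x, ‖G x‖)
            * ENNReal.ofReal (∫ u, ‖u‖ ^ 2 * χ u ^ 2))
          + 2 * ∑ j, ∑ k, supNorm (separated N d (α - 4 * ε))
              (gradWithin (separated N d (α - 4 * ε)) j
                (gradWithin (separated N d (α - 4 * ε)) k Φ))) := by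
  set S := separated N d (α - 4 * ε) with hS
  have hSu : UniqueDiffOn ℝ S := uniqueDiffOn_separated N d (by linarith)
  have hε2 : ENNReal.ofReal (ε ^ 2) ≠ 0 := by simpa using by positivity
  have hGpos : ENNReal.ofReal (∫ x, ‖G x‖) ≠ 0 := by
    simpa using integral_norm_weak_gradient_pos hd hρ.isDensity hG hGi hGm
  have hχpos : ENNReal.ofReal (∫ u, ‖u‖ ^ 2 * χ u ^ 2) ≠ 0 := by
    simpa using hχ.integral_norm_sq_mul_pos hd
  -- an infinite supremum makes the right side infinite, because its cofactors are positive
  by_cases hgrad : ∃ j, supNorm S (gradWithin S j Φ) = ⊤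
  · obtain ⟨j, hj⟩ := hgrad
    refine le_top.trans_eq (Eq.symm ?_)
    rw [ENNReal.mul_eq_top, ENNReal.add_eq_top]
    refine Or.inl ⟨hε2, Or.inl (ENNReal.sum_eq_top.2 ⟨j, Finset.mem_univ j, ?_⟩)⟩
    rw [hj, ENNReal.top_mul hGpos, ENNReal.top_mul hχpos]
  by_cases hhess : ∃ j k, supNorm S (gradWithin S j (gradWithin S k Φ)) = ⊤
  · obtain ⟨j, k, hjk⟩ := hhess
    refine le_top.trans_eq (Eq.symm ?_)
    rw [ENNReal.mul_eq_top, ENNReal.add_eq_top]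
    refine Or.inl ⟨hε2, Or.inr (ENNReal.mul_eq_top.2 (Or.inl ⟨two_ne_zero, ?_⟩))⟩
    exact ENNReal.sum_eq_top.2 ⟨j, Finset.mem_univ j,
      ENNReal.sum_eq_top.2 ⟨k, Finset.mem_univ k, hjk⟩⟩
  push Not at hgrad hhess
  set C : Fin N → ℝ := fun j => (supNorm S (gradWithin S j Φ)).toReal
  set H : Fin N → Fin N → ℝ := fun j k =>
    (supNorm S (gradWithin S j (gradWithin S k Φ))).toReal
  have hC : ∀ j, ∀ X ∈ S, ‖gradWithin S j Φ X‖ ≤ C j := fun j X hX =>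
    norm_le_toReal_supNorm (hgrad j) hX
  have hH : ∀ j k, ∀ X ∈ S, ‖gradWithin S j (gradWithin S k Φ) X‖ ≤ H j k := fun j k X hX =>
    norm_le_toReal_supNorm (hhess j k) hX
  have hPS := measure_compl_separated_sub (d := d) hε hsupp
  have hfst := coupling_map_fst hη hP hρ
  have hsnd := coupling_map_snd (P := P) hη hρ.isDensity
  have hprob := isProbabilityMeasure_coupling hη hP hρ
  set Q := coupling P ρ (rescale χ ε)
  have j1 : Integrable (fun p => Φ p.2) Q := by
    rw [← hsnd] at hi1
    exact hi1.comp_measurable measurable_snd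
  have j2 : Integrable (fun p => Φ p.1) Q := by
    rw [← hfst] at hi2
    exact hi2.comp_measurable measurable_fst
  have e1 : ∫ X, Φ X ∂(regularizedMeasure P ρ χ ε) = ∫ p, Φ p.2 ∂Q := by
    have hm := hi1.aestronglyMeasurable
    rw [← hsnd] at hm ⊢
    exact integral_map measurable_snd.aemeasurable hm
  have e2 : ∫ X, Φ X ∂P = ∫ p, Φ p.1 ∂Q := by
    have hm := hi2.aestronglyMeasurable
    rw [← hfst] at hm
    conv_lhs => rw [← hfst]
    exact integral_map measurable_fst.aemeasurable hm
  have hfirst := fun k => enorm_integral_displacement_le hη hP hρ hG hGi hGm k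
    (L := gradWithin S k Φ) (C := C k)
    (aestronglyMeasurable_of_continuousOn (contDiffOn_gradWithin hSu hΦ k).continuousOn
      (isClosed_separated N d _) hPS)
    (by
      filter_upwards [mem_ae_iff.2 hPS] with Y hY
      exact hC k Y hY)
  have j3 : Integrable (fun p : Config N d × Config N d =>
      ∑ k, gradWithin S k Φ p.1 (p.2 k - p.1 k)) Q :=
    integrable_finsetSum _ fun k _ => (hfirst k).1
  have e3 : ∫ X, Φ X ∂(regularizedMeasure P ρ χ ε) - ∫ X, Φ X ∂P
      = ∫ p, (Φ p.2 - Φ p.1 - ∑ k, gradWithin S k Φ p.1 (p.2 k - p.1 k)) ∂Q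
        + ∑ k, ∫ p, gradWithin S k Φ p.1 (p.2 k - p.1 k) ∂Q := by
    rw [integral_sub (j1.sub' j2) j3, integral_sub j1 j2,
      integral_finsetSum _ fun k _ => (hfirst k).1, e1, e2]
    ring
  have hsecond : ‖∫ p, (Φ p.2 - Φ p.1 - ∑ k, gradWithin S k Φ p.1 (p.2 k - p.1 k)) ∂Q‖
      ≤ (2 * ε) ^ 2 / 2 * ∑ j, ∑ k, H j k := by
    refine (norm_integral_le_of_norm_le_const (C := (2 * ε) ^ 2 / 2 * ∑ j, ∑ k, H j k)
      ?_).trans_eq (by simp)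
    filter_upwards [ae_coupling_segment hη hP hρ hsupp] with p hp
    have := abs_sub_sub_le_of_gradWithin_le hSu hΦ (by positivity) hp.1 hp.2 hH
    rwa [add_sub_cancel] at this
  have hC' : ∀ j, ENNReal.ofReal (C j) = supNorm S (gradWithin S j Φ) := fun j =>
    ENNReal.ofReal_toReal (hgrad j)
  have hH' : ENNReal.ofReal (∑ j, ∑ k, H j k)
      = ∑ j, ∑ k, supNorm S (gradWithin S j (gradWithin S k Φ)) := by
    rw [ENNReal.ofReal_sum_of_nonneg fun j _ => Finset.sum_nonneg fun k _ =>
      ENNReal.toReal_nonneg]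
    refine Finset.sum_congr rfl fun j _ => ?_
    rw [ENNReal.ofReal_sum_of_nonneg fun k _ => ENNReal.toReal_nonneg]
    exact Finset.sum_congr rfl fun k _ => ENNReal.ofReal_toReal (hhess j k)
  rw [← Real.norm_eq_abs, ofReal_norm, e3]
  refine (enorm_add_le _ _).trans ?_
  rw [mul_add, add_comm]
  gcongr
  · refine (enorm_sum_le _ _).trans ?_
    rw [Finset.mul_sum]
    refine Finset.sum_le_sum fun k _ => (hfirst k).2.trans (le_of_eq ?_)
    rw [integral_norm_sq_mul_rescale hε, hC', ENNReal.ofReal_mul (by positivity)]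
    ring
  · rw [← ofReal_norm]
    refine (ENNReal.ofReal_le_ofReal hsecond).trans (le_of_eq ?_)
    rw [← hH', ← ENNReal.ofReal_ofNat 2, ← ENNReal.ofReal_mul (by norm_num),
      ← ENNReal.ofReal_mul (by positivity)]
    congr 1
    ring

/-- Lipschitz functions suffice for weak convergence, and the coupling moves no particle by more
than `2ε`. -/
theorem norm_integral_sub_le_of_lipschitz (hη : IsCutoff (rescale χ ε) ε) (hε : 0 < ε)
    (hP : IsSymmetricMeasure P) (hρ : IsMarginalDensity P ρ) {f : Config N d → ℝ} {L : NNReal}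
    (hL : LipschitzWith L f) {C : ℝ} (hC : ∀ X Y, dist (f X) (f Y) ≤ C) :
    ‖∫ X, f X ∂(regularizedMeasure P ρ χ ε) - ∫ X, f X ∂P‖ ≤ L * (2 * ε) := by
  have hfst := coupling_map_fst hη hP hρ
  have hsnd := coupling_map_snd (P := P) hη hρ.isDensity
  have hprob := isProbabilityMeasure_coupling hη hP hρ
  have hm : Measurable f := hL.continuous.measurable
  have hb : ∀ X, ‖f X‖ ≤ ‖f 0‖ + C := fun X => by
    have := hC X 0
    rw [dist_eq_norm] at this
    have h2 := norm_le_norm_add_norm_sub' (f X) (f 0)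
    linarith
  have e1 : ∫ X, f X ∂(regularizedMeasure P ρ χ ε)
      = ∫ p, f p.2 ∂(coupling P ρ (rescale χ ε)) := by
    rw [← hsnd]
    exact integral_map measurable_snd.aemeasurable hm.aestronglyMeasurable
  have e2 : ∫ X, f X ∂P = ∫ p, f p.1 ∂(coupling P ρ (rescale χ ε)) := by
    conv_lhs => rw [← hfst]
    exact integral_map measurable_fst.aemeasurable hm.aestronglyMeasurable
  have i1 : Integrable (fun p => f p.2) (coupling P ρ (rescale χ ε)) :=
    Integrable.of_bound (hm.comp measurable_snd).aestronglyMeasurable _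
      (ae_of_all _ fun p => hb p.2)
  have i2 : Integrable (fun p => f p.1) (coupling P ρ (rescale χ ε)) :=
    Integrable.of_bound (hm.comp measurable_fst).aestronglyMeasurable _
      (ae_of_all _ fun p => hb p.1)
  rw [e1, e2, ← integral_sub i1 i2]
  refine (norm_integral_le_of_norm_le_const (C := L * (2 * ε)) ?_).trans_eq (by simp)
  filter_upwards [ae_coupling hη hρ.isDensity] with p hp
  rw [← dist_eq_norm]
  refine (hL.dist_le_mul _ _).trans ?_
  gcongr
  rw [dist_eq_norm]
  exact (pi_norm_le_iff_of_nonneg (by positivity)).2 hp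

theorem tendsto_integral_regularizedMeasure
    (hη : ∀ ε, 0 < ε → IsCutoff (rescale χ ε) ε) (hP : IsSymmetricMeasure P)
    (hρ : IsMarginalDensity P ρ) (f : BoundedContinuousFunction (Config N d) ℝ) :
    Tendsto (fun ε : ℝ => ∫ X, f X ∂(regularizedMeasure P ρ χ ε)) (𝓝[>] 0)
      (𝓝 (∫ X, f X ∂P)) := by
  classical
  -- the filter `𝓝[>] 0` only sees `ε > 0`; elsewhere `P` serves as a dummy probability measure
  have hprob : ∀ ε : ℝ, IsProbabilityMeasure
      (if 0 < ε then regularizedMeasure P ρ χ ε else P) := by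
    intro ε
    split_ifs with h
    · exact isProbabilityMeasure_regularizedMeasure (hη ε h) hP hρ
    · infer_instance
  let μ : ℝ → ProbabilityMeasure (Config N d) := fun ε => ⟨_, hprob ε⟩
  have hμ : ∀ ε : ℝ, 0 < ε → (μ ε : Measure (Config N d)) = regularizedMeasure P ρ χ ε :=
    fun ε hε => if_pos hε
  let μ₀ : ProbabilityMeasure (Config N d) := ⟨P, inferInstance⟩
  have key : Tendsto μ (𝓝[>] 0) (𝓝 μ₀) := by
    rw [tendsto_iff_forall_lipschitz_integral_tendsto]
    rintro g ⟨C, hC⟩ ⟨L, hL⟩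
    rw [tendsto_iff_norm_sub_tendsto_zero]
    have hlim : Tendsto (fun ε : ℝ => (L : ℝ) * (2 * ε)) (𝓝[>] 0) (𝓝 0) := by
      have : Tendsto (fun ε : ℝ => (L : ℝ) * (2 * ε)) (𝓝 0) (𝓝 ((L : ℝ) * (2 * 0))) :=
        (by fun_prop : Continuous fun ε : ℝ => (L : ℝ) * (2 * ε)).tendsto 0
      rw [mul_zero, mul_zero] at this
      exact this.mono_left nhdsWithin_le_nhds
    refine squeeze_zero' (Eventually.of_forall fun _ => norm_nonneg _) ?_ hlim
    filter_upwards [self_mem_nhdsWithin] with ε hε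
    rw [hμ ε hε]
    exact norm_integral_sub_le_of_lipschitz (hη ε hε) hε hP hρ hL hC
  rw [ProbabilityMeasure.tendsto_iff_forall_integral_tendsto] at key
  refine (key f).congr' ?_
  filter_upwards [self_mem_nhdsWithin] with ε hε
  rw [hμ ε hε]

end Potential

/-! ### Localized orbitals and their kinetic energy -/

theorem enorm_sq_eq_ofReal (a : ℝ) : ‖a‖ₑ ^ 2 = ENNReal.ofReal (a ^ 2) := by
  rw [← ofReal_norm, ← ENNReal.ofReal_pow (norm_nonneg _), Real.norm_eq_abs, sq_abs]

theorem sum_sq_apply_single {d : ℕ} (L : Space d →L[ℝ] ℝ) :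
    ∑ a, L (EuclideanSpace.single a 1) ^ 2 = ‖L‖ ^ 2 := by
  obtain ⟨v, rfl⟩ := (InnerProductSpace.toDual ℝ (Space d)).surjective L
  rw [LinearIsometryEquiv.norm_map, EuclideanSpace.real_norm_sq_eq]
  refine Finset.sum_congr rfl fun a _ => ?_
  rw [InnerProductSpace.toDual_apply_apply, EuclideanSpace.inner_single_right]
  simp

/-- The orbital `√ρ η(· - z)`. -/
noncomputable def orbital {d : ℕ} (ρ η : Space d → ℝ) (z x : Space d) : ℝ :=
  Real.sqrt (ρ x) * η (x - z)

/-- The derivative of `orbital ρ η z` in the direction `v`, if `G` is the derivative of `√ρ`. -/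
noncomputable def orbitalDeriv {d : ℕ} (ρ : Space d → ℝ) (G : Space d → Space d →L[ℝ] ℝ)
    (η : Space d → ℝ) (v z x : Space d) : ℝ :=
  G x v * η (x - z) + Real.sqrt (ρ x) * fderiv ℝ η (x - z) v

namespace IsCutoff

variable {d : ℕ} {ρ η : Space d → ℝ} {ε : ℝ} {G : Space d → Space d →L[ℝ] ℝ}

theorem continuous_fderiv_apply (hη : IsCutoff η ε) (v : Space d) :
    Continuous fun x => fderiv ℝ η x v :=
  continuous_fderiv_apply_of_contDiff hη.contDiff v

theorem measurable_orbital_comp (hη : IsCutoff η ε) (hρ : Measurable ρ) {Ω : Type*}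
    [MeasurableSpace Ω] {f g : Ω → Space d} (hf : Measurable f) (hg : Measurable g) :
    Measurable fun p => orbital ρ η (f p) (g p) :=
  (hρ.sqrt.comp hg).mul (hη.measurable.comp (hg.sub hf))

theorem measurable_orbitalDeriv_comp (hη : IsCutoff η ε) (hρ : Measurable ρ)
    (hG : StronglyMeasurable G) (v : Space d) {Ω : Type*} [MeasurableSpace Ω]
    {f g : Ω → Space d} (hf : Measurable f) (hg : Measurable g) :
    Measurable fun p => orbitalDeriv ρ G η v (f p) (g p) := by
  have h1 : Measurable fun x => G x v :=
    ((ContinuousLinearMap.apply ℝ ℝ v).continuous.comp_stronglyMeasurable hG).measurable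
  exact ((h1.comp hg).mul (hη.measurable.comp (hg.sub hf))).add ((hρ.sqrt.comp hg).mul
    ((hη.continuous_fderiv_apply v).measurable.comp (hg.sub hf)))

theorem norm_sub_le_of_orbital_ne_zero (hη : IsCutoff η ε) {z x : Space d}
    (h : orbital ρ η z x ≠ 0) : ‖x - z‖ ≤ ε :=
  hη.norm_le _ (right_ne_zero_of_mul h)

theorem norm_sub_le_of_orbitalDeriv_ne_zero (hη : IsCutoff η ε) {v z x : Space d}
    (h : orbitalDeriv ρ G η v z x ≠ 0) : ‖x - z‖ ≤ ε := by
  by_contra hlt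
  refine h ?_
  have h1 : η (x - z) = 0 := by_contra fun h0 => hlt (hη.norm_le _ h0)
  have h2 : fderiv ℝ η (x - z) = 0 :=
    by_contra fun h0 => hlt (hη.norm_le_of_fderiv_ne_zero h0)
  simp [orbitalDeriv, h1, h2]

theorem enorm_orbital_sq (hρ : IsDensity ρ) (z x : Space d) :
    ‖orbital ρ η z x‖ₑ ^ 2 = smearJoint ρ η x z := by
  rw [enorm_sq_eq_ofReal, orbital, mul_pow, Real.sq_sqrt (hρ.nonneg x), smearJoint]

theorem memLp_mul_translate {f κ : Space d → ℝ} (hf : MemLp f 2 volume) (hκ : Continuous κ)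
    (hκc : HasCompactSupport κ) (z : Space d) :
    MemLp (fun x => f x * κ (x - z)) 2 volume := by
  obtain ⟨C, hC⟩ := hκ.bounded_above_of_compact_support hκc
  refine hf.of_le_mul (c := C) (hf.aestronglyMeasurable.mul
    (hκ.comp (continuous_id.sub continuous_const)).aestronglyMeasurable)
    (ae_of_all _ fun x => ?_)
  rw [norm_mul, mul_comm]
  exact mul_le_mul_of_nonneg_right (hC _) (norm_nonneg _)

theorem memLp_orbital (hη : IsCutoff η ε) (h2 : MemLp (fun x => Real.sqrt (ρ x)) 2 volume)
    (z : Space d) : MemLp (orbital ρ η z) 2 volume :=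
  memLp_mul_translate h2 hη.contDiff.continuous hη.hasCompactSupport z

theorem memLp_orbitalDeriv (hη : IsCutoff η ε) (h2 : MemLp (fun x => Real.sqrt (ρ x)) 2 volume)
    (hG2 : MemLp G 2 volume) (v z : Space d) : MemLp (orbitalDeriv ρ G η v z) 2 volume :=
  (memLp_mul_translate ((ContinuousLinearMap.apply ℝ ℝ v).comp_memLp' hG2)
    hη.contDiff.continuous hη.hasCompactSupport z).add
  (memLp_mul_translate h2 (hη.continuous_fderiv_apply v) (hη.hasCompactSupport.fderiv_apply ℝ v) z)

theorem isWeakLineDeriv_orbital (hη : IsCutoff η ε)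
    (hG : HasWeakFDeriv (fun x => Real.sqrt (ρ x)) G) (v z : Space d) :
    IsWeakLineDeriv v (orbital ρ η z) (orbitalDeriv ρ G η v z) := by
  have h := (hG.isWeakLineDeriv v).mul_smooth (η := fun x => η (x - z))
    (hη.contDiff.comp (contDiff_id.sub contDiff_const))
  have e : ∀ x, fderiv ℝ (fun x => η (x - z)) x = fderiv ℝ η (x - z) := fun x =>
    fderiv_comp_sub _
  simp only [e] at h
  exact h

/-- Where `ρ ∗ η²` vanishes, so do the orbital and its derivative, and setting `0 / 0 = 0` in the
weight loses no kinetic energy. -/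
theorem lintegral_orbitalDeriv_sq_of_smear_eq_zero (hη : IsCutoff η ε) (hρ : IsDensity ρ)
    (hG : HasWeakFDeriv (fun x => Real.sqrt (ρ x)) G) (v : Space d) {z : Space d}
    (hz : smear ρ η z = 0) : ∫⁻ x, ‖orbitalDeriv ρ G η v z x‖ₑ ^ 2 = 0 := by
  have h1 : ∫⁻ x, ‖orbital ρ η z x‖ₑ ^ 2 = 0 := by
    simp only [enorm_orbital_sq hρ]
    rw [hη.lintegral_smearJoint hρ, hz, ENNReal.ofReal_zero]
  have hm : Measurable (orbital ρ η z) :=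
    hη.measurable_orbital_comp hρ.measurable measurable_const measurable_id
  rw [lintegral_eq_zero_iff (hm.enorm.pow_const 2)] at h1
  have h2 : orbital ρ η z =ᵐ[volume] fun _ => 0 := by
    filter_upwards [h1] with x hx
    simpa using hx
  have h3 : IsWeakLineDeriv v (fun _ : Space d => (0 : ℝ)) fun _ => 0 :=
    ⟨locallyIntegrable_zero (ε'' := ℝ), locallyIntegrable_zero (ε'' := ℝ), by simp⟩
  have h4 := (hη.isWeakLineDeriv_orbital hG v z).ae_unique h3 h2
  rw [lintegral_congr_ae (g := fun _ => 0) (h4.mono fun x hx => by simp [hx]), lintegral_zero]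

/-- `η ∂η` is odd; it is the cross term in the kinetic energy of an orbital, averaged over `z`. -/
theorem integral_mul_fderiv (hη : IsCutoff η ε) (v : Space d) :
    ∫ u, η u * fderiv ℝ η u v = 0 := by
  have h1 : ∀ u, fderiv ℝ η (-u) v = - fderiv ℝ η u v := by
    intro u
    have h2 : HasFDerivAt (fun x => η (-x)) ((fderiv ℝ η (-u)).comp
        (-ContinuousLinearMap.id ℝ (Space d))) u :=
      (hη.contDiff.differentiable (by simp) (-u)).hasFDerivAt.comp u (hasFDerivAt_id u).neg
    simp only [hη.even] at h2
    rw [h2.fderiv]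
    simp
  have h3 := integral_neg_eq_self (fun u => η u * fderiv ℝ η u v) volume
  simp only [h1, hη.even, mul_neg, integral_neg] at h3
  linarith

theorem lintegral_orbitalDeriv_sq_left (hη : IsCutoff η ε) (hρ : IsDensity ρ) (v x : Space d) :
    ∫⁻ z, ‖orbitalDeriv ρ G η v z x‖ₑ ^ 2
      = ENNReal.ofReal (G x v ^ 2 + ρ x * ∫ u, fderiv ℝ η u v ^ 2) := by
  have c1 := hη.contDiff.continuous
  have c2 := hη.continuous_fderiv_apply v
  have s1 := hη.hasCompactSupport
  have s2 := hη.hasCompactSupport.fderiv_apply ℝ v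
  have i2 : Integrable fun u => η u * fderiv ℝ η u v :=
    (c1.mul c2).integrable_of_hasCompactSupport s1.mul_right
  have i3 : Integrable fun u => fderiv ℝ η u v ^ 2 := by
    simp only [pow_two]
    exact (c2.mul c2).integrable_of_hasCompactSupport s2.mul_right
  simp only [enorm_sq_eq_ofReal]
  have e : ∀ u, (G x v * η u + Real.sqrt (ρ x) * fderiv ℝ η u v) ^ 2
      = G x v ^ 2 * η u ^ 2 + 2 * G x v * Real.sqrt (ρ x) * (η u * fderiv ℝ η u v)
        + ρ x * fderiv ℝ η u v ^ 2 := by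
    intro u
    have := Real.sq_sqrt (hρ.nonneg x)
    calc _ = G x v ^ 2 * η u ^ 2 + 2 * G x v * Real.sqrt (ρ x) * (η u * fderiv ℝ η u v)
        + Real.sqrt (ρ x) ^ 2 * fderiv ℝ η u v ^ 2 := by ring
      _ = _ := by rw [this]
  have e2 := lintegral_sub_left_eq_self (μ := (volume : Measure (Space d))) (fun u =>
    ENNReal.ofReal ((G x v * η u + Real.sqrt (ρ x) * fderiv ℝ η u v) ^ 2)) x
  refine e2.trans ?_
  simp only [e]
  have i4 : Integrable fun u => G x v ^ 2 * η u ^ 2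
      + 2 * G x v * Real.sqrt (ρ x) * (η u * fderiv ℝ η u v) :=
    (hη.integrable_sq.const_mul _).add (i2.const_mul _)
  have i5 : Integrable fun u => G x v ^ 2 * η u ^ 2
      + 2 * G x v * Real.sqrt (ρ x) * (η u * fderiv ℝ η u v) + ρ x * fderiv ℝ η u v ^ 2 :=
    i4.add (i3.const_mul _)
  rw [← ofReal_integral_eq_lintegral_ofReal i5]
  · congr 1
    rw [integral_add i4 (i3.const_mul (ρ x)), integral_add (hη.integrable_sq.const_mul (G x v ^ 2))
      (i2.const_mul (2 * G x v * Real.sqrt (ρ x))), integral_const_mul, integral_const_mul,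
      integral_const_mul, hη.integral_mul_fderiv, hη.integral_sq]
    ring
  · refine ae_of_all _ fun u => ?_
    beta_reduce
    rw [← e]
    positivity

/-- The localized orbitals share the kinetic energy of `√ρ` and add that of `η`; the cross terms
vanish upon integration over `z` since `η ∇η` is odd. -/
theorem sum_lintegral_orbitalDeriv_sq (hη : IsCutoff η ε) (hρ : IsDensity ρ)
    (hGm : StronglyMeasurable G) (hG2 : MemLp G 2 volume) :
    ∑ a : Fin d, ∫⁻ z, ∫⁻ x, ‖orbitalDeriv ρ G η (EuclideanSpace.single a 1) z x‖ₑ ^ 2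
      = ENNReal.ofReal ((∫ x, ‖G x‖ ^ 2) + ∫ u, ‖fderiv ℝ η u‖ ^ 2) := by
  have iG : Integrable fun x => ‖G x‖ ^ 2 := hG2.integrable_norm_pow two_ne_zero
  have ia : ∀ a : Fin d, Integrable fun u => fderiv ℝ η u (EuclideanSpace.single a 1) ^ 2 := by
    intro a
    simp only [pow_two]
    exact ((hη.continuous_fderiv_apply _).mul (hη.continuous_fderiv_apply
      _)).integrable_of_hasCompactSupport (hη.hasCompactSupport.fderiv_apply ℝ _).mul_right
  have e1 : ∀ a : Fin d,
      ∫⁻ z, ∫⁻ x, ‖orbitalDeriv ρ G η (EuclideanSpace.single a 1) z x‖ₑ ^ 2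
      = ∫⁻ x, ENNReal.ofReal (G x (EuclideanSpace.single a 1) ^ 2
        + ρ x * ∫ u, fderiv ℝ η u (EuclideanSpace.single a 1) ^ 2) := by
    intro a
    rw [lintegral_lintegral_swap ((hη.measurable_orbitalDeriv_comp hρ.measurable hGm _
      measurable_fst measurable_snd).enorm.pow_const 2).aemeasurable]
    exact lintegral_congr fun x => hη.lintegral_orbitalDeriv_sq_left hρ _ x
  have hnn : ∀ x (a : Fin d), 0 ≤ G x (EuclideanSpace.single a 1) ^ 2
        + ρ x * ∫ u, fderiv ℝ η u (EuclideanSpace.single a 1) ^ 2 := fun x a =>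
    add_nonneg (sq_nonneg _) (mul_nonneg (hρ.nonneg x) (integral_nonneg fun u => sq_nonneg _))
  have hm : ∀ a : Fin d, Measurable fun x => ENNReal.ofReal (G x (EuclideanSpace.single a 1) ^ 2
        + ρ x * ∫ u, fderiv ℝ η u (EuclideanSpace.single a 1) ^ 2) := fun a =>
    ((((ContinuousLinearMap.apply ℝ ℝ _).continuous.comp_stronglyMeasurable
      hGm).measurable.pow_const 2).add (hρ.measurable.mul_const _)).ennreal_ofReal
  simp only [e1]
  rw [← lintegral_finsetSum _ fun a _ => hm a]
  have e2 : ∀ x, ∑ a : Fin d, ENNReal.ofReal (G x (EuclideanSpace.single a 1) ^ 2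
        + ρ x * ∫ u, fderiv ℝ η u (EuclideanSpace.single a 1) ^ 2)
      = ENNReal.ofReal (‖G x‖ ^ 2 + ρ x * ∫ u, ‖fderiv ℝ η u‖ ^ 2) := by
    intro x
    rw [← ENNReal.ofReal_sum_of_nonneg fun a _ => hnn x a, Finset.sum_add_distrib,
      sum_sq_apply_single, ← Finset.mul_sum, ← integral_finsetSum _ fun a _ => ia a]
    simp only [sum_sq_apply_single]
  simp only [e2]
  have iρ : Integrable fun x => ρ x * ∫ u, ‖fderiv ℝ η u‖ ^ 2 := hρ.integrable.mul_const _
  have it : Integrable fun x => ‖G x‖ ^ 2 + ρ x * ∫ u, ‖fderiv ℝ η u‖ ^ 2 := iG.add iρ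
  rw [← ofReal_integral_eq_lintegral_ofReal it (ae_of_all _ fun x => add_nonneg (sq_nonneg _)
      (mul_nonneg (hρ.nonneg x) (integral_nonneg fun u => sq_nonneg _))),
    integral_add iG iρ, integral_mul_const, hρ.integral_eq, one_mul]

end IsCutoff

/-! ### Slater determinants of localized orbitals -/

/-- The alternating sum `(N!)^{-1/2} ∑_σ sign(σ) ∏_k o_k(z_{σ(k)}, x_k)`. For `o_k = o`, this is the
Slater determinant of the orbitals `o(z_l, ·)`; its derivative in the variable `x_j` is obtained by
changing `o_j`, which is why the orbital may depend on the slot `k`. -/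
noncomputable def slaterAt {N d : ℕ} (o : Fin N → Space d → Space d → ℝ) (Z X : Config N d) : ℝ :=
  (Real.sqrt (Nat.factorial N : ℝ))⁻¹ *
    ∑ σ : Equiv.Perm (Fin N), (((Equiv.Perm.sign σ : ℤˣ) : ℤ) : ℝ) * ∏ k, o k (Z (σ k)) (X k)

section Slater

variable {N d : ℕ} {o : Fin N → Space d → Space d → ℝ} {ε : ℝ}

theorem slaterFun_ofReal (φ : Fin N → Space d → ℝ) (X : Config N d) :
    slaterFun (fun k x => ((φ k x : ℝ) : ℂ)) X =
      (((Real.sqrt (Nat.factorial N : ℝ))⁻¹ * ∑ σ : Equiv.Perm (Fin N),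
        (((Equiv.Perm.sign σ : ℤˣ) : ℤ) : ℝ) * ∏ k, φ (σ k) (X k) : ℝ) : ℂ) := by
  rw [slaterFun]
  push_cast
  rfl

theorem measurable_slaterAt (ho : ∀ k, Measurable fun p : Space d × Space d => o k p.1 p.2)
    {Ω : Type*} [MeasurableSpace Ω] {f g : Ω → Config N d} (hf : Measurable f)
    (hg : Measurable g) : Measurable fun p => slaterAt o (f p) (g p) := by
  refine measurable_const.mul (Finset.measurable_fun_sum _ fun σ _ => measurable_const.mul
    (Finset.measurable_fun_prod _ fun k _ => ?_))
  exact (ho k).comp (((measurable_pi_apply (σ k)).comp hf).prodMk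
    ((measurable_pi_apply k).comp hg))

theorem memLp_slaterAt (ho : ∀ k z, MemLp (o k z) 2 volume) (Z : Config N d) :
    MemLp (slaterAt o Z) 2 volume := by
  have h1 : ∀ σ : Equiv.Perm (Fin N), MemLp (fun X : Config N d =>
      (((Equiv.Perm.sign σ : ℤˣ) : ℤ) : ℝ) * ∏ k, o k (Z (σ k)) (X k)) 2 volume := fun σ =>
    (memLp_prod fun k => ho k (Z (σ k))).const_mul _
  have h2 : MemLp (fun X : Config N d => ∑ σ : Equiv.Perm (Fin N),
      (((Equiv.Perm.sign σ : ℤˣ) : ℤ) : ℝ) * ∏ k, o k (Z (σ k)) (X k)) 2 volume :=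
    memLp_finsetSum _ fun σ _ => h1 σ
  exact h2.const_mul _

theorem IsWeakLineDeriv.const_mul {V : Type*} [NormedAddCommGroup V] [NormedSpace ℝ V]
    [MeasureSpace V] {f g : V → ℝ} {v : V} (h : IsWeakLineDeriv v f g) (c : ℝ) :
    IsWeakLineDeriv v (fun x => c * f x) fun x => c * g x := by
  refine ⟨h.locallyIntegrable.smul c, h.locallyIntegrable_deriv.smul c, fun φ h1 h2 => ?_⟩
  have := congrArg (c * ·) (h.integral_eq φ h1 h2)
  simp only [smul_eq_mul, mul_neg, ← integral_const_mul] at this ⊢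
  simp only [mul_left_comm c] at this
  exact this

theorem IsWeakLineDeriv.sum {V ι : Type*} [NormedAddCommGroup V] [NormedSpace ℝ V]
    [MeasureSpace V] [BorelSpace V] (s : Finset ι) {f g : ι → V → ℝ} {v : V}
    (h : ∀ i, IsWeakLineDeriv v (f i) (g i)) :
    IsWeakLineDeriv v (fun x => ∑ i ∈ s, f i x) fun x => ∑ i ∈ s, g i x := by
  have hl : ∀ (f : ι → V → ℝ), (∀ i, LocallyIntegrable (f i) volume) →
      LocallyIntegrable (fun x => ∑ i ∈ s, f i x) volume := by
    classical
    intro f hf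
    induction s using Finset.induction_on with
    | empty =>
      simp only [Finset.sum_empty]
      exact locallyIntegrable_zero (ε'' := ℝ)
    | insert i s hi ih =>
      simp only [Finset.sum_insert hi]
      exact (hf i).add ih
  refine ⟨hl f fun i => (h i).locallyIntegrable, hl g fun i => (h i).locallyIntegrable_deriv,
    fun φ h1 h2 => ?_⟩
  simp only [Finset.smul_sum]
  rw [integral_finsetSum _ fun i _ => (h i).integrable_fderiv_smul h1 h2 v,
    integral_finsetSum _ fun i _ => (h i).integrable_smul_deriv h1 h2, ← Finset.sum_neg_distrib]
  exact Finset.sum_congr rfl fun i _ => (h i).integral_eq φ h1 h2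

/-- The derivative of a Slater determinant in the position of the `j`-th particle. -/
theorem isWeakLineDeriv_slaterAt {φ φ' : Space d → Space d → ℝ} {u : Space d}
    (hφ : ∀ z, MemLp (φ z) 2 volume) (hφ' : ∀ z, MemLp (φ' z) 2 volume)
    (h : ∀ z, IsWeakLineDeriv u (φ z) (φ' z)) (j : Fin N) (Z : Config N d) :
    IsWeakLineDeriv (Pi.single j u : Config N d) (slaterAt (fun _ => φ) Z)
      (slaterAt (Function.update (fun _ => φ) j φ') Z) := by
  refine (IsWeakLineDeriv.sum _ fun σ => ?_).const_mul _
  have h1 := (isWeakLineDeriv_prod (fun k => hφ (Z (σ k))) j (hφ' (Z (σ j)))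
    (h (Z (σ j)))).const_mul (((Equiv.Perm.sign σ : ℤˣ) : ℤ) : ℝ)
  convert! h1 using 5 with X k
  by_cases hk : k = j
  · subst hk
    simp
  · simp [hk]

/-- Two distinct permutations differ at some `k`, which makes their product vanish. -/
theorem sq_sum_sign_mul_prod {a : Fin N → Fin N → ℝ}
    (h : ∀ k l l', l ≠ l' → a k l * a k l' = 0) :
    (∑ σ : Equiv.Perm (Fin N), (((Equiv.Perm.sign σ : ℤˣ) : ℤ) : ℝ) * ∏ k, a k (σ k)) ^ 2
      = ∑ σ : Equiv.Perm (Fin N), ∏ k, a k (σ k) ^ 2 := by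
  rw [pow_two, Finset.sum_mul_sum]
  refine Finset.sum_congr rfl fun σ _ => ?_
  rw [Finset.sum_eq_single σ]
  · have hs : (((Equiv.Perm.sign σ : ℤˣ) : ℤ) : ℝ) * (((Equiv.Perm.sign σ : ℤˣ) : ℤ) : ℝ) = 1 := by
      rw [← Int.cast_mul, ← Units.val_mul, Int.units_mul_self]
      simp
    rw [mul_mul_mul_comm, hs, one_mul, ← Finset.prod_mul_distrib]
    exact Finset.prod_congr rfl fun k _ => (pow_two _).symm
  · intro τ _ hτ
    obtain ⟨k, hk⟩ : ∃ k, σ k ≠ τ k := by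
      by_contra hne
      push Not at hne
      exact hτ (Equiv.ext fun k => (hne k).symm)
    rw [mul_mul_mul_comm, ← Finset.prod_mul_distrib,
      Finset.prod_eq_zero (Finset.mem_univ k) (h k _ _ hk), mul_zero]
  · exact fun hσ => (hσ (Finset.mem_univ _)).elim

/-- If the points `z_l` are more than `2ε` apart, orbitals localized in balls of radius `ε` have
disjoint supports, and no exchange terms appear. -/
theorem enorm_slaterAt_sq (hs : ∀ k z x, o k z x ≠ 0 → ‖x - z‖ ≤ ε) {Z : Config N d}
    (hZ : ∀ l l', l ≠ l' → 2 * ε < ‖Z l - Z l'‖) (X : Config N d) :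
    ‖slaterAt o Z X‖ₑ ^ 2 = (Nat.factorial N : ℝ≥0∞)⁻¹ *
      ∑ σ : Equiv.Perm (Fin N), ∏ k, ‖o k (Z (σ k)) (X k)‖ₑ ^ 2 := by
  have h : ∀ k l l', l ≠ l' → o k (Z l) (X k) * o k (Z l') (X k) = 0 := by
    intro k l l' hl
    by_contra hne
    have h1 := hs k _ _ (left_ne_zero_of_mul hne)
    have h2 := hs k _ _ (right_ne_zero_of_mul hne)
    have h3 := hZ l l' hl
    have h4 : ‖Z l - Z l'‖ ≤ ‖X k - Z l'‖ + ‖X k - Z l‖ := by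
      rw [show Z l - Z l' = (X k - Z l') - (X k - Z l) by abel]
      exact norm_sub_le _ _
    linarith
  have hN : (0 : ℝ) < Nat.factorial N := by exact_mod_cast Nat.factorial_pos N
  rw [enorm_sq_eq_ofReal, slaterAt, mul_pow,
    sq_sum_sign_mul_prod (a := fun k l => o k (Z l) (X k)) h, inv_pow, Real.sq_sqrt hN.le,
    ENNReal.ofReal_mul (by positivity), ENNReal.ofReal_inv_of_pos hN,
    ENNReal.ofReal_natCast, ENNReal.ofReal_sum_of_nonneg fun σ _ => Finset.prod_nonneg fun k _ =>
      sq_nonneg _]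
  congr 1
  refine Finset.sum_congr rfl fun σ _ => ?_
  rw [ENNReal.ofReal_prod_of_nonneg fun k _ => sq_nonneg _]
  exact Finset.prod_congr rfl fun k _ => (enorm_sq_eq_ofReal _).symm

theorem lintegral_enorm_slaterAt_sq
    (ho : ∀ k, Measurable fun p : Space d × Space d => o k p.1 p.2)
    (hs : ∀ k z x, o k z x ≠ 0 → ‖x - z‖ ≤ ε) {Z : Config N d}
    (hZ : ∀ l l', l ≠ l' → 2 * ε < ‖Z l - Z l'‖) :
    ∫⁻ X, ‖slaterAt o Z X‖ₑ ^ 2 = (Nat.factorial N : ℝ≥0∞)⁻¹ *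
      ∑ σ : Equiv.Perm (Fin N), ∏ k, ∫⁻ x, ‖o k (Z (σ k)) x‖ₑ ^ 2 := by
  have hm : ∀ k z, Measurable fun x => ‖o k z x‖ₑ ^ 2 := fun k z =>
    ((ho k).comp (measurable_const.prodMk measurable_id)).enorm.pow_const 2
  simp only [enorm_slaterAt_sq hs hZ]
  have hp : ∀ σ : Equiv.Perm (Fin N), Measurable fun X : Config N d =>
      ∏ k, ‖o k (Z (σ k)) (X k)‖ₑ ^ 2 := fun σ =>
    Finset.measurable_fun_prod _ fun k _ => (hm k (Z (σ k))).comp (measurable_pi_apply k)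
  rw [lintegral_const_mul _ (Finset.measurable_fun_sum _ fun σ _ => hp σ),
    lintegral_finsetSum _ fun σ _ => hp σ]
  congr 1
  exact Finset.sum_congr rfl fun σ _ => lintegral_pi_prod (fun _ => volume)
    (fun k x => ‖o k (Z (σ k)) x‖ₑ ^ 2) fun k => hm k _

end Slater

/-! ### Mixtures of Slater determinants -/

/-- The weight `w_ε(Y, Z)` of the mixture, in `[0, ∞]`. -/
noncomputable def mixWeight {N d : ℕ} (ρ η : Space d → ℝ) (q : Config N d × Config N d) : ℝ≥0∞ :=
  ∏ k, smearWeight ρ η (q.1 k) (q.2 k)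

theorem IsCutoff.measurable_mixWeight {N d : ℕ} {ρ η : Space d → ℝ} {ε : ℝ} (hη : IsCutoff η ε)
    (hρ : IsDensity ρ) : Measurable (mixWeight (N := N) ρ η) :=
  Finset.measurable_fun_prod _ fun k _ => hη.measurable_smearWeight_comp hρ
    ((measurable_pi_apply k).comp measurable_fst) ((measurable_pi_apply k).comp measurable_snd)

/-- The smeared positions that carry weight are more than `2ε` apart: those of `Y` are at distance
at least `α > 4ε`, and each moves by at most `ε`. -/
theorem IsCutoff.ae_mixWeight_separated {N d : ℕ} {P : Measure (Config N d)} [SFinite P]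
    {ρ η : Space d → ℝ} {ε α : ℝ} (hη : IsCutoff η ε) (hα : 4 * ε < α)
    (hsupp : P (separated N d α)ᶜ = 0) : ∀ᵐ q ∂(P.prod (volume : Measure (Config N d))),
      mixWeight ρ η q ≠ 0 → ∀ l l', l ≠ l' → 2 * ε < ‖q.2 l - q.2 l'‖ := by
  have h0 : ∀ᵐ Y ∂P, Y ∈ separated N d α := mem_ae_iff.2 hsupp
  filter_upwards [Measure.quasiMeasurePreserving_fst.ae h0] with q hq hw l l' hl
  have h1 := hq l l' hl
  have h2 : ∀ k, ‖q.2 k - q.1 k‖ ≤ ε := fun k =>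
    hη.norm_sub_le_of_smearWeight_ne_zero (Finset.prod_ne_zero_iff.1 hw k (Finset.mem_univ k))
  have h3 : ‖q.1 l - q.1 l'‖ ≤ ‖q.2 l - q.2 l'‖ + (‖q.2 l - q.1 l‖ + ‖q.2 l' - q.1 l'‖) := by
    rw [show q.1 l - q.1 l' = (q.2 l - q.2 l') - ((q.2 l - q.1 l) - (q.2 l' - q.1 l')) by abel]
    exact (norm_sub_le _ _).trans (by gcongr; exact norm_sub_le _ _)
  linarith [h2 l, h2 l']

theorem lintegral_comp_perm {N d : ℕ} {P : Measure (Config N d)} [SFinite P]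
    (hP : IsSymmetricMeasure P) (σ : Equiv.Perm (Fin N))
    {f : Config N d × Config N d → ℝ≥0∞} (hf : Measurable f) :
    ∫⁻ q, f (q.1 ∘ σ, q.2 ∘ σ) ∂(P.prod volume) = ∫⁻ q, f q ∂(P.prod volume) := by
  have h1 : MeasurePreserving (fun X : Config N d => X ∘ σ) P P :=
    ⟨(measurePreserving_comp_perm (d := d) σ).measurable, hP σ⟩
  exact (h1.prod (measurePreserving_comp_perm (d := d) σ)).lintegral_comp hf

section Mixture

variable {N d : ℕ} {P : Measure (Config N d)} [IsProbabilityMeasure P]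
  {ρ η : Space d → ℝ} {ε α : ℝ}

/-- The diagonal of the mixture is the density of the regularized measure: by symmetry, each of the
`N!` permutations contributes equally. -/
theorem lintegral_mixWeight_mul_enorm_slaterAt_sq (hη : IsCutoff η ε) (hα : 4 * ε < α)
    (hP : IsSymmetricMeasure P) (hρ : IsDensity ρ) (hsupp : P (separated N d α)ᶜ = 0)
    (X : Config N d) :
    ∫⁻ q, mixWeight ρ η q * ‖slaterAt (fun _ => orbital ρ η) q.2 X‖ₑ ^ 2 ∂(P.prod volume)
      = ∫⁻ q : Config N d × Config N d, ∏ k, (smearJoint ρ η (X k) (q.2 k)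
        * smearWeight ρ η (q.1 k) (q.2 k)) ∂(P.prod volume) := by
  have hN : (Nat.factorial N : ℝ≥0∞) ≠ 0 := by exact_mod_cast Nat.factorial_ne_zero N
  have hmf : ∀ σ : Equiv.Perm (Fin N), Measurable fun q : Config N d × Config N d =>
      mixWeight ρ η q * ∏ k, smearJoint ρ η (X k) (q.2 (σ k)) := fun σ =>
    (hη.measurable_mixWeight hρ).mul (Finset.measurable_fun_prod _ fun k _ =>
      hη.measurable_smearJoint_comp hρ measurable_const
        ((measurable_pi_apply (σ k)).comp measurable_snd))
  have e1 : ∫⁻ q, mixWeight ρ η q * ‖slaterAt (fun _ => orbital ρ η) q.2 X‖ₑ ^ 2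
        ∂(P.prod volume)
      = ∫⁻ q : Config N d × Config N d, (Nat.factorial N : ℝ≥0∞)⁻¹ *
        ∑ σ : Equiv.Perm (Fin N), mixWeight ρ η q * ∏ k, smearJoint ρ η (X k) (q.2 (σ k))
        ∂(P.prod volume) := by
    refine lintegral_congr_ae ?_
    filter_upwards [hη.ae_mixWeight_separated (ρ := ρ) hα hsupp] with q hq
    by_cases hw : mixWeight ρ η q = 0
    · simp [hw]
    rw [enorm_slaterAt_sq (fun k z x h => hη.norm_sub_le_of_orbital_ne_zero h) (hq hw),
      ← Finset.mul_sum, mul_left_comm]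
    simp only [IsCutoff.enorm_orbital_sq hρ]
  have e2 : ∀ σ : Equiv.Perm (Fin N),
      ∫⁻ q : Config N d × Config N d, mixWeight ρ η q * ∏ k, smearJoint ρ η (X k) (q.2 (σ k))
        ∂(P.prod volume) = ∫⁻ q : Config N d × Config N d, ∏ k, (smearJoint ρ η (X k) (q.2 k)
        * smearWeight ρ η (q.1 k) (q.2 k)) ∂(P.prod volume) := by
    intro σ
    have h1 := lintegral_comp_perm hP σ (hmf 1)
    simp only [Equiv.Perm.coe_one, id_eq, Function.comp_apply] at h1
    calc _ = ∫⁻ q : Config N d × Config N d, mixWeight ρ η (q.1 ∘ σ, q.2 ∘ σ)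
          * ∏ k, smearJoint ρ η (X k) (q.2 (σ k)) ∂(P.prod volume) := by
          refine lintegral_congr fun q => ?_
          congr 1
          exact (Equiv.prod_comp σ fun k => smearWeight ρ η (q.1 k) (q.2 k)).symm
      _ = _ := h1
      _ = _ := lintegral_congr fun q => by
          rw [mixWeight, ← Finset.prod_mul_distrib]
          exact Finset.prod_congr rfl fun k _ => mul_comm _ _
  rw [e1, lintegral_const_mul _ (Finset.measurable_fun_sum _ fun σ _ => hmf σ),
    lintegral_finsetSum _ fun σ _ => hmf σ, Finset.sum_congr rfl fun σ _ => e2 σ,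
    Finset.sum_const, Finset.card_univ, Fintype.card_perm, Fintype.card_fin, nsmul_eq_mul,
    ← mul_assoc, ENNReal.inv_mul_cancel hN (ENNReal.natCast_ne_top _), one_mul]

/-- Summed over `j`, the derivative of a Slater determinant in `x_j` falls on each of the `N`
orbitals once, for every permutation. -/
theorem sum_prod_update_perm (m F : Space d → ℝ≥0∞) (Z : Config N d) :
    ∑ j, ((Nat.factorial N : ℝ≥0∞)⁻¹ *
      ∑ σ : Equiv.Perm (Fin N), ∏ k, Function.update (fun _ => m) j F k (Z (σ k)))
      = ∑ l, ∏ k, Function.update (fun _ => m) l F k (Z k) := by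
  have hN : (Nat.factorial N : ℝ≥0∞) ≠ 0 := by exact_mod_cast Nat.factorial_ne_zero N
  rw [← Finset.mul_sum, Finset.sum_comm]
  have e : ∀ σ : Equiv.Perm (Fin N),
      ∑ j, ∏ k, Function.update (fun _ => m) j F k (Z (σ k))
        = ∑ l, ∏ k, Function.update (fun _ => m) l F k (Z k) := by
    intro σ
    refine Eq.trans ?_ (Equiv.sum_comp σ fun l =>
      ∏ k, Function.update (fun _ => m) l F k (Z k))
    refine Finset.sum_congr rfl fun j _ => ?_
    refine Eq.trans ?_ (Equiv.prod_comp σ fun k =>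
      Function.update (fun _ => m) (σ j) F k (Z k))
    refine Finset.prod_congr rfl fun k _ => ?_
    by_cases h : k = j
    · subst h
      simp
    · rw [Function.update_of_ne h, Function.update_of_ne (fun h' => h (σ.injective h'))]
  rw [Finset.sum_congr rfl fun σ _ => e σ, Finset.sum_const, Finset.card_univ, Fintype.card_perm,
    Fintype.card_fin, nsmul_eq_mul, ← mul_assoc,
    ENNReal.inv_mul_cancel hN (ENNReal.natCast_ne_top _), one_mul]

variable [NeZero N]

/-- Integrating the weights against `∏_k (ρ ∗ η²)(z_k)`, with the `l`-th factor replaced by `F z_l`: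
the other factors integrate to one, and the `l`-th weight averages to one over `y_l`. -/
theorem lintegral_mixWeight_mul_prod_update (hη : IsCutoff η ε) (hP : IsSymmetricMeasure P)
    (hρ : IsMarginalDensity P ρ) {F : Space d → ℝ≥0∞} (hF : Measurable F)
    (hF0 : ∀ z, smear ρ η z = 0 → F z = 0) (l : Fin N) :
    ∫⁻ q : Config N d × Config N d, mixWeight ρ η q *
      ∏ k, Function.update (fun _ z => ENNReal.ofReal (smear ρ η z)) l F k (q.2 k)
      ∂(P.prod volume) = ∫⁻ z, F z := by
  have hd := hρ.isDensity
  have hu : ∀ k, Measurable (Function.update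
      (fun _ z => ENNReal.ofReal (smear ρ η z)) l F k) := by
    intro k
    by_cases h : k = l
    · subst h
      simpa using hF
    · rw [Function.update_of_ne h]
      exact (hη.measurable_smear hd).ennreal_ofReal
  have hm : Measurable fun q : Config N d × Config N d => mixWeight ρ η q *
      ∏ k, Function.update (fun _ z => ENNReal.ofReal (smear ρ η z)) l F k (q.2 k) :=
    (hη.measurable_mixWeight hd).mul (Finset.measurable_fun_prod _ fun k _ =>
      (hu k).comp ((measurable_pi_apply k).comp measurable_snd))
  have hW : ∀ y, Measurable (smearWeight ρ η y) := fun y =>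
    hη.measurable_smearWeight_comp hd measurable_const measurable_id
  have hWF : Measurable fun p : Space d × Space d => smearWeight ρ η p.1 p.2 * F p.2 :=
    (hη.measurable_smearWeight hd).mul (hF.comp measurable_snd)
  have hWF' : Measurable fun y => ∫⁻ z, smearWeight ρ η y z * F z := hWF.lintegral_prod_right'
  rw [lintegral_prod _ hm.aemeasurable]
  have e1 : ∀ᵐ Y ∂P, ∫⁻ Z : Config N d, mixWeight ρ η (Y, Z) *
      ∏ k, Function.update (fun _ z => ENNReal.ofReal (smear ρ η z)) l F k (Z k)
      = ∫⁻ z, smearWeight ρ η (Y l) z * F z := by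
    filter_upwards [hρ.ae_forall hP (hη.lintegral_smearWeight_mul_smear hd)] with Y hY
    simp only [mixWeight, ← Finset.prod_mul_distrib]
    rw [show ∫⁻ Z : Config N d, ∏ k, (smearWeight ρ η (Y k) (Z k) *
      Function.update (fun _ z => ENNReal.ofReal (smear ρ η z)) l F k (Z k))
      = ∏ k, ∫⁻ z, smearWeight ρ η (Y k) z *
      Function.update (fun _ z => ENNReal.ofReal (smear ρ η z)) l F k z from
      lintegral_pi_prod (fun _ => volume) (fun k z => smearWeight ρ η (Y k) z *
        Function.update (fun _ z => ENNReal.ofReal (smear ρ η z)) l F k z)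
        fun k => (hW _).mul (hu k)]
    rw [Finset.prod_eq_single l]
    · simp
    · intro k _ hk
      simp only [Function.update_of_ne hk]
      exact hY k
    · exact fun h => (h (Finset.mem_univ _)).elim
  rw [lintegral_congr_ae e1, ← lintegral_map (μ := P) hWF' (measurable_pi_apply l),
    hρ.map_eval hP l, lintegral_withDensity_eq_lintegral_mul _ hρ.measurable.ennreal_ofReal hWF']
  calc ∫⁻ y, ENNReal.ofReal (ρ y) * ∫⁻ z, smearWeight ρ η y z * F z
      = ∫⁻ y, ∫⁻ z, ENNReal.ofReal (ρ y) * (smearWeight ρ η y z * F z) :=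
        lintegral_congr fun y => (lintegral_const_mul' _ _ ENNReal.ofReal_ne_top).symm
    _ = ∫⁻ z, ∫⁻ y, ENNReal.ofReal (ρ y) * (smearWeight ρ η y z * F z) :=
        lintegral_lintegral_swap
          ((hρ.measurable.ennreal_ofReal.comp measurable_fst).mul hWF).aemeasurable
    _ = ∫⁻ z, (∫⁻ y, smearWeight ρ η y z * ENNReal.ofReal (ρ y)) * F z := by
        refine lintegral_congr fun z => ?_
        have hz : Measurable fun y => smearWeight ρ η y z * ENNReal.ofReal (ρ y) :=
          (hη.measurable_smearWeight_comp hd measurable_id measurable_const).mul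
            hρ.measurable.ennreal_ofReal
        rw [← lintegral_mul_const _ hz]
        exact lintegral_congr fun y => by ring
    _ = ∫⁻ z, F z := by
        refine lintegral_congr fun z => ?_
        rw [hη.lintegral_smearWeight_mul hd]
        split_ifs with h
        · rw [hF0 z h, mul_zero]
        · rw [one_mul]

/-- The kinetic energy of the mixture: each of the `N` orbitals contributes as a single particle
would. -/
theorem sum_lintegral_mixWeight_mul_deriv_sq (hη : IsCutoff η ε) (hα : 4 * ε < α)
    (hP : IsSymmetricMeasure P) (hρ : IsMarginalDensity P ρ)
    (hsupp : P (separated N d α)ᶜ = 0) {G : Space d → Space d →L[ℝ] ℝ}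
    (hGm : StronglyMeasurable G) (hG : HasWeakFDeriv (fun x => Real.sqrt (ρ x)) G)
    (hG2 : MemLp G 2 volume) :
    ∑ j : Fin N, ∑ a : Fin d, ∫⁻ q : Config N d × Config N d, mixWeight ρ η q *
      (∫⁻ X, ‖slaterAt (Function.update (fun _ => orbital ρ η) j
        (orbitalDeriv ρ G η (EuclideanSpace.single a 1))) q.2 X‖ₑ ^ 2) ∂(P.prod volume)
      = ENNReal.ofReal (N * ((∫ x, ‖G x‖ ^ 2) + ∫ u, ‖fderiv ℝ η u‖ ^ 2)) := by
  have hd := hρ.isDensity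
  have hmo : Measurable fun p : Space d × Space d => orbital ρ η p.1 p.2 :=
    hη.measurable_orbital_comp hρ.measurable measurable_fst measurable_snd
  have hmd : ∀ v, Measurable fun p : Space d × Space d => orbitalDeriv ρ G η v p.1 p.2 := fun v =>
    hη.measurable_orbitalDeriv_comp hρ.measurable hGm v measurable_fst measurable_snd
  have key : ∀ v, ∑ j : Fin N, ∫⁻ q : Config N d × Config N d, mixWeight ρ η q *
      (∫⁻ X, ‖slaterAt (Function.update (fun _ => orbital ρ η) j
        (orbitalDeriv ρ G η v)) q.2 X‖ₑ ^ 2) ∂(P.prod volume)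
      = N * ∫⁻ z, ∫⁻ x, ‖orbitalDeriv ρ G η v z x‖ₑ ^ 2 := by
    intro v
    set F : Space d → ℝ≥0∞ := fun z => ∫⁻ x, ‖orbitalDeriv ρ G η v z x‖ₑ ^ 2 with hFdef
    have hF : Measurable F := ((hmd v).enorm.pow_const 2).lintegral_prod_right'
    have hF0 : ∀ z, smear ρ η z = 0 → F z = 0 := fun z hz =>
      hη.lintegral_orbitalDeriv_sq_of_smear_eq_zero hd hG v hz
    have hu : ∀ j k, Measurable fun p : Space d × Space d => Function.update
        (fun _ : Fin N => orbital ρ η) j (orbitalDeriv ρ G η v) k p.1 p.2 := by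
      intro j k
      by_cases h : k = j
      · subst h
        simpa using hmd v
      · simpa only [Function.update_of_ne h] using hmo
    have hus : ∀ (j k : Fin N) z x, Function.update
        (fun _ : Fin N => orbital ρ η) j (orbitalDeriv ρ G η v) k z x ≠ 0 → ‖x - z‖ ≤ ε := by
      intro j k z x h0
      by_cases h : k = j
      · subst h
        rw [Function.update_self] at h0
        exact hη.norm_sub_le_of_orbitalDeriv_ne_zero h0
      · rw [Function.update_of_ne h] at h0
        exact hη.norm_sub_le_of_orbital_ne_zero h0
    have hint : ∀ (j k : Fin N) z, ∫⁻ x, ‖Function.update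
        (fun _ : Fin N => orbital ρ η) j (orbitalDeriv ρ G η v) k z x‖ₑ ^ 2
        = Function.update (fun _ z => ENNReal.ofReal (smear ρ η z)) j F k z := by
      intro j k z
      by_cases h : k = j
      · subst h
        simp [hFdef]
      · simp only [Function.update_of_ne h, IsCutoff.enorm_orbital_sq hd,
          hη.lintegral_smearJoint hd]
    have hmj : ∀ j : Fin N, Measurable fun q : Config N d × Config N d => mixWeight ρ η q *
      ∫⁻ X, ‖slaterAt (Function.update (fun _ => orbital ρ η) j
        (orbitalDeriv ρ G η v)) q.2 X‖ₑ ^ 2 := by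
      intro j
      have h1 : Measurable fun p : (Config N d × Config N d) × Config N d =>
          ‖slaterAt (Function.update (fun _ => orbital ρ η) j
            (orbitalDeriv ρ G η v)) p.1.2 p.2‖ₑ ^ 2 :=
        (measurable_slaterAt (hu j) measurable_fst.snd measurable_snd).enorm.pow_const 2
      exact (hη.measurable_mixWeight hd).mul h1.lintegral_prod_right'
    have hml : ∀ l : Fin N, Measurable fun q : Config N d × Config N d => mixWeight ρ η q *
        ∏ k, Function.update (fun _ z => ENNReal.ofReal (smear ρ η z)) l F k (q.2 k) := by
      intro l
      have hul : ∀ k, Measurable (Function.update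
          (fun _ z => ENNReal.ofReal (smear ρ η z)) l F k) := by
        intro k
        by_cases h : k = l
        · subst h
          simpa using hF
        · rw [Function.update_of_ne h]
          exact (hη.measurable_smear hd).ennreal_ofReal
      exact (hη.measurable_mixWeight hd).mul (Finset.measurable_fun_prod _ fun k _ =>
        (hul k).comp ((measurable_pi_apply k).comp measurable_snd))
    rw [← lintegral_finsetSum _ fun j _ => hmj j]
    have e1 : ∫⁻ q : Config N d × Config N d, ∑ j : Fin N, mixWeight ρ η q *
        (∫⁻ X, ‖slaterAt (Function.update (fun _ => orbital ρ η) j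
          (orbitalDeriv ρ G η v)) q.2 X‖ₑ ^ 2) ∂(P.prod volume)
        = ∫⁻ q : Config N d × Config N d, ∑ l : Fin N, mixWeight ρ η q *
          ∏ k, Function.update (fun _ z => ENNReal.ofReal (smear ρ η z)) l F k (q.2 k)
          ∂(P.prod volume) := by
      refine lintegral_congr_ae ?_
      filter_upwards [hη.ae_mixWeight_separated (ρ := ρ) hα hsupp] with q hq
      rw [← Finset.mul_sum, ← Finset.mul_sum]
      by_cases hw : mixWeight ρ η q = 0
      · simp [hw]
      congr 1
      rw [← sum_prod_update_perm]
      refine Finset.sum_congr rfl fun j _ => ?_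
      rw [lintegral_enorm_slaterAt_sq (hu j) (hus j) (hq hw)]
      simp only [hint]
    rw [e1, lintegral_finsetSum _ fun l _ => hml l, Finset.sum_congr rfl fun l _ =>
      lintegral_mixWeight_mul_prod_update hη hP hρ hF hF0 l, Finset.sum_const, Finset.card_univ,
      Fintype.card_fin, nsmul_eq_mul]
  rw [Finset.sum_comm, Finset.sum_congr rfl fun a _ => key _, ← Finset.mul_sum,
    hη.sum_lintegral_orbitalDeriv_sq hd hGm hG2, ENNReal.ofReal_mul (Nat.cast_nonneg N),
    ENNReal.ofReal_natCast]

end Mixture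

/-! ### The trial vectors in the fermionic space -/

instance fact_two_ne_top : Fact ((2 : ℝ≥0∞) ≠ ⊤) := ⟨ENNReal.ofNat_ne_top⟩

instance secondCountableTopology_fermionic (N d : ℕ) :
    SecondCountableTopology (Fermionic N d) :=
  inferInstanceAs (SecondCountableTopology (antisymmetric N d))

/-- The inclusion of the fermionic space in `L²`. -/
noncomputable def fermionicIncl (N d : ℕ) :
    Fermionic N d →L[ℂ] Lp ℂ 2 (volume : Measure (Config N d)) :=
  (antisymmetric N d).subtypeL

theorem enorm_toL2 {N d : ℕ} (ψ : Fermionic N d) : ‖ψ.toL2‖ₑ = ‖ψ‖ₑ := rfl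

theorem enorm_Lp_two_sq {X E : Type*} [MeasurableSpace X] [NormedAddCommGroup E] {μ : Measure X}
    (f : Lp E 2 μ) : ‖f‖ₑ ^ 2 = ∫⁻ x, ‖f x‖ₑ ^ 2 ∂μ := by
  have h := eLpNorm_nnreal_pow_eq_lintegral (μ := μ) (f := f) (p := 2) two_ne_zero
  rw [Lp.enorm_def]
  simpa using h

/-- A real square-integrable function as an element of the complex space `L²`. -/
noncomputable def ofRealLp {X : Type*} [MeasurableSpace X] {μ : Measure X} {f : X → ℝ}
    (hf : MemLp f 2 μ) : Lp ℂ 2 μ :=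
  (MemLp.ofReal (K := ℂ) hf).toLp

theorem coeFn_ofRealLp {X : Type*} [MeasurableSpace X] {μ : Measure X} {f : X → ℝ}
    (hf : MemLp f 2 μ) : ofRealLp hf =ᵐ[μ] fun x => ((f x : ℝ) : ℂ) :=
  MemLp.coeFn_toLp _

theorem enorm_ofRealLp_sq {X : Type*} [MeasurableSpace X] {μ : Measure X} {f : X → ℝ}
    (hf : MemLp f 2 μ) : ‖ofRealLp hf‖ₑ ^ 2 = ∫⁻ x, ‖f x‖ₑ ^ 2 ∂μ := by
  rw [enorm_Lp_two_sq]
  refine lintegral_congr_ae ?_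
  filter_upwards [coeFn_ofRealLp hf] with x hx
  rw [hx]
  congr 1
  simp [enorm_eq_nnnorm]

theorem measurable_inner_ofRealLp {X Q : Type*} [MeasurableSpace X] [MeasurableSpace Q]
    {μ : Measure X} [SFinite μ] {f : Q → X → ℝ} (hf : ∀ q, MemLp (f q) 2 μ)
    (hm : Measurable fun p : Q × X => f p.1 p.2) (x : Lp ℂ 2 μ) :
    Measurable fun q => inner ℂ x (ofRealLp (hf q)) := by
  have e : ∀ q, inner ℂ x (ofRealLp (hf q)) = ∫ y, inner ℂ (x y) ((f q y : ℝ) : ℂ) ∂μ := by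
    intro q
    rw [L2.inner_def]
    refine integral_congr_ae ?_
    filter_upwards [coeFn_ofRealLp (hf q)] with y hy
    rw [hy]
  simp only [e]
  have h : StronglyMeasurable fun p : Q × X => inner ℂ (x p.2) ((f p.1 p.2 : ℝ) : ℂ) :=
    (((Lp.stronglyMeasurable x).measurable.comp measurable_snd).inner
      (Complex.measurable_ofReal.comp hm)).stronglyMeasurable
  exact h.integral_prod_right.measurable

theorem slater_toL2 {N d : ℕ} {φ : Fin N → Space d → ℂ}
    (h : MemLp (slaterFun φ) 2 (volume : Measure (Config N d))) :
    (slater φ).toL2 = h.toLp (slaterFun φ) :=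
  congrArg Subtype.val (dif_pos h :
    slater φ = (⟨h.toLp (slaterFun φ), _⟩ : antisymmetric N d))

theorem trialVector_toL2 {N d : ℕ} {ρ χ : Space d → ℝ} {ε : ℝ} {Z : Config N d}
    (h : MemLp (slaterAt (fun _ => orbital ρ (rescale χ ε)) Z) 2 volume) :
    (trialVector ρ χ ε Z).toL2 = ofRealLp h := by
  have e : slaterFun (fun k x => ((Real.sqrt (ρ x) * rescale χ ε (x - Z k) : ℝ) : ℂ))
      = fun X => ((slaterAt (fun _ => orbital ρ (rescale χ ε)) Z X : ℝ) : ℂ) := by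
    funext X
    exact slaterFun_ofReal (fun k x => Real.sqrt (ρ x) * rescale χ ε (x - Z k)) X
  have h' : MemLp (slaterFun fun k x => ((Real.sqrt (ρ x) * rescale χ ε (x - Z k) : ℝ) : ℂ)) 2
      (volume : Measure (Config N d)) := by
    rw [e]
    exact MemLp.ofReal (K := ℂ) h
  rw [trialVector, slater_toL2 h', ofRealLp]
  congr 1

section State

variable {N d : ℕ} {P : Measure (Config N d)} {ρ χ : Space d → ℝ} {ε α : ℝ}

theorem memLp_trial (hη : IsCutoff (rescale χ ε) ε)
    (h2 : MemLp (fun x => Real.sqrt (ρ x)) 2 volume) (Z : Config N d) :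
    MemLp (slaterAt (fun _ => orbital ρ (rescale χ ε)) Z) 2 volume :=
  memLp_slaterAt (fun _ z => hη.memLp_orbital h2 z) Z

theorem stronglyMeasurable_trialVector (hη : IsCutoff (rescale χ ε) ε) (hρ : IsDensity ρ)
    (h2 : MemLp (fun x => Real.sqrt (ρ x)) 2 volume) :
    StronglyMeasurable fun Z : Config N d => trialVector ρ χ ε Z := by
  refine stronglyMeasurable_of_inner _ fun x => ?_
  have h := measurable_inner_ofRealLp (μ := (volume : Measure (Config N d)))
    (fun Z : Config N d => memLp_trial hη h2 Z) (measurable_slaterAt (fun _ =>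
      hη.measurable_orbital_comp hρ.measurable measurable_fst measurable_snd)
      measurable_fst measurable_snd) x.toL2
  simp only [← trialVector_toL2 (memLp_trial hη h2 _)] at h
  exact h

theorem enorm_trialVector_sq (hη : IsCutoff (rescale χ ε) ε)
    (h2 : MemLp (fun x => Real.sqrt (ρ x)) 2 volume) (Z : Config N d) :
    ‖trialVector ρ χ ε Z‖ₑ ^ 2
      = ∫⁻ X, ‖slaterAt (fun _ => orbital ρ (rescale χ ε)) Z X‖ₑ ^ 2 := by
  rw [← enorm_toL2, trialVector_toL2 (memLp_trial hη h2 Z), enorm_ofRealLp_sq]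

/-- The part of the mixture that is carried by a set `A` of configurations has the mass
`P_ε(A)`. -/
theorem lintegral_mixWeight_mul_setLIntegral [IsProbabilityMeasure P]
    (hη : IsCutoff (rescale χ ε) ε) (hα : 4 * ε < α) (hP : IsSymmetricMeasure P)
    (hρ : IsDensity ρ) (hsupp : P (separated N d α)ᶜ = 0) {A : Set (Config N d)}
    (hA : MeasurableSet A) :
    ∫⁻ q, mixWeight ρ (rescale χ ε) q *
      (∫⁻ X in A, ‖slaterAt (fun _ => orbital ρ (rescale χ ε)) q.2 X‖ₑ ^ 2) ∂(P.prod volume)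
      = regularizedMeasure P ρ χ ε A := by
  have hm : Measurable fun p : (Config N d × Config N d) × Config N d =>
      ‖slaterAt (fun _ => orbital ρ (rescale χ ε)) p.1.2 p.2‖ₑ ^ 2 :=
    (measurable_slaterAt (fun _ => hη.measurable_orbital_comp hρ.measurable measurable_fst
      measurable_snd) measurable_fst.snd measurable_snd).enorm.pow_const 2
  have hm' : ∀ q : Config N d × Config N d, Measurable fun X =>
      ‖slaterAt (fun _ => orbital ρ (rescale χ ε)) q.2 X‖ₑ ^ 2 := fun q =>
    (measurable_slaterAt (fun _ => hη.measurable_orbital_comp hρ.measurable measurable_fst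
      measurable_snd) measurable_const measurable_id).enorm.pow_const 2
  rw [regularizedMeasure_eq_withDensity hρ, withDensity_apply _ hA]
  simp only [← lintegral_mixWeight_mul_enorm_slaterAt_sq hη hα hP hρ hsupp]
  rw [lintegral_lintegral_swap]
  · exact lintegral_congr fun q => (lintegral_const_mul _ (hm' q)).symm
  · exact (((hη.measurable_mixWeight hρ).comp measurable_snd).mul
      (hm.comp (measurable_snd.prodMk measurable_fst))).aemeasurable

theorem measurable_weight (hη : IsCutoff (rescale χ ε) ε) (hρ : IsDensity ρ) :
    Measurable fun q : Config N d × Config N d => weight ρ χ ε q.1 q.2 := by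
  unfold weight
  simp only [smoothed_eq_smear]
  refine Finset.measurable_fun_prod _ fun k _ => ?_
  have h1 : Measurable fun q : Config N d × Config N d => q.1 k :=
    (measurable_pi_apply k).comp measurable_fst
  have h2 : Measurable fun q : Config N d × Config N d => q.2 k :=
    (measurable_pi_apply k).comp measurable_snd
  exact ((hη.measurable.comp (h2.sub h1)).pow_const 2).div ((hη.measurable_smear hρ).comp h2)

theorem weight_nonneg (hρ : IsDensity ρ) (Y Z : Config N d) : 0 ≤ weight ρ χ ε Y Z :=
  Finset.prod_nonneg fun k _ => div_nonneg (sq_nonneg _)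
    (by rw [smoothed_eq_smear]; exact IsCutoff.smear_nonneg hρ _)

/-- The norm of `|Ψ⟩⟨Ψ|` is `‖Ψ‖²`, so that the norms integrate to the total mass of `P_ε`. -/
theorem integrable_stateIntegrand [IsProbabilityMeasure P] [NeZero N]
    (hη : IsCutoff (rescale χ ε) ε) (hα : 4 * ε < α) (hP : IsSymmetricMeasure P)
    (hρ : IsMarginalDensity P ρ) (hsupp : P (separated N d α)ᶜ = 0)
    (h2 : MemLp (fun x => Real.sqrt (ρ x)) 2 volume) :
    Integrable (stateIntegrand (N := N) ρ χ ε) (P.prod volume) := by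
  have hd := hρ.isDensity
  refine ⟨?_, ?_⟩
  · have h1 : StronglyMeasurable fun q : Config N d × Config N d => trialVector ρ χ ε q.2 :=
      (stronglyMeasurable_trialVector hη hd h2).comp_measurable measurable_snd
    have hc : Continuous fun x : Fermionic N d => InnerProductSpace.rankOne ℂ x x :=
      ((ContinuousLinearMap.smulRightL ℂ (Fermionic N d) (Fermionic N d)).continuous.comp
        (innerSL ℂ (E := Fermionic N d)).continuous).clm_apply continuous_id
    exact ((Complex.measurable_ofReal.comp (measurable_weight hη hd)).stronglyMeasurable.smul
      (hc.comp_stronglyMeasurable h1)).aestronglyMeasurable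
  · rw [hasFiniteIntegral_def]
    have e : ∀ q : Config N d × Config N d, ‖stateIntegrand ρ χ ε q‖ₑ
        = mixWeight ρ (rescale χ ε) q * (∫⁻ X in Set.univ,
          ‖slaterAt (fun _ => orbital ρ (rescale χ ε)) q.2 X‖ₑ ^ 2) := by
      intro q
      have e1 : ‖((weight ρ χ ε q.1 q.2 : ℝ) : ℂ)‖ₑ = mixWeight ρ (rescale χ ε) q := by
        rw [mixWeight, ← ofReal_weight hd, ← ofReal_norm, Complex.norm_real,
          Real.norm_of_nonneg (weight_nonneg hd _ _)]
      rw [stateIntegrand, enorm_smul, InnerProductSpace.enorm_rankOne, e1, ← pow_two,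
        enorm_trialVector_sq hη h2, Measure.restrict_univ]
    simp only [e]
    rw [lintegral_mixWeight_mul_setLIntegral hη hα hP hd hsupp MeasurableSet.univ]
    have := isProbabilityMeasure_regularizedMeasure hη hP hρ
    rw [measure_univ]
    exact ENNReal.one_lt_top

theorem inner_quantumState (hint : Integrable (stateIntegrand (N := N) ρ χ ε) (P.prod volume))
    (x : Fermionic N d) :
    inner ℂ x (quantumState P ρ χ ε x)
      = ((∫ q, weight ρ χ ε q.1 q.2 * ‖inner ℂ (trialVector ρ χ ε q.2) x‖ ^ 2
        ∂(P.prod volume) : ℝ) : ℂ) := by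
  have hx : Integrable (fun q => stateIntegrand ρ χ ε q x) (P.prod volume) :=
    (ContinuousLinearMap.apply ℂ (Fermionic N d) x).integrable_comp hint
  rw [quantumState, ContinuousLinearMap.integral_apply hint, ← integral_inner hx,
    ← integral_complex_ofReal]
  refine integral_congr_ae (ae_of_all _ fun q => ?_)
  beta_reduce
  rw [stateIntegrand, smul_apply, inner_smul_right,
    InnerProductSpace.inner_right_rankOne_apply, ← inner_conj_symm x, Complex.conj_mul']
  push_cast
  rfl

theorem quantumState_nonneg (hρ : IsDensity ρ)
    (hint : Integrable (stateIntegrand (N := N) ρ χ ε) (P.prod volume)) :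
    0 ≤ quantumState P ρ χ ε := by
  rw [ContinuousLinearMap.nonneg_iff_isPositive, ContinuousLinearMap.isPositive_iff_complex]
  intro x
  have h : inner ℂ (quantumState P ρ χ ε x) x
      = ((∫ q, weight ρ χ ε q.1 q.2 * ‖inner ℂ (trialVector ρ χ ε q.2) x‖ ^ 2
        ∂(P.prod volume) : ℝ) : ℂ) := by
    rw [← inner_conj_symm, inner_quantumState hint, Complex.conj_ofReal]
  rw [h]
  refine ⟨by simp, ?_⟩
  exact integral_nonneg fun q => mul_nonneg (weight_nonneg hρ _ _) (sq_nonneg _)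

theorem ofReal_inner_quantumState (hρ : IsDensity ρ)
    (hint : Integrable (stateIntegrand (N := N) ρ χ ε) (P.prod volume)) (x : Fermionic N d) :
    ENNReal.ofReal (inner ℂ x (quantumState P ρ χ ε x)).re
      = ∫⁻ q, mixWeight ρ (rescale χ ε) q * ‖inner ℂ (trialVector ρ χ ε q.2) x‖ₑ ^ 2
        ∂(P.prod volume) := by
  have hi : Integrable (fun q : Config N d × Config N d => weight ρ χ ε q.1 q.2 *
      ‖inner ℂ (trialVector ρ χ ε q.2) x‖ ^ 2) (P.prod volume) := by
    have h1 := ((ContinuousLinearMap.apply ℂ (Fermionic N d) x).integrable_comp hint).const_inner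
      (𝕜 := ℂ) x
    refine h1.re.congr (ae_of_all _ fun q => ?_)
    beta_reduce
    rw [ContinuousLinearMap.apply_apply, stateIntegrand, smul_apply, inner_smul_right,
      InnerProductSpace.inner_right_rankOne_apply, ← inner_conj_symm x, Complex.conj_mul',
      ← Complex.ofReal_pow, ← Complex.ofReal_mul]
    rfl
  rw [inner_quantumState hint, Complex.ofReal_re, ofReal_integral_eq_lintegral_ofReal hi
    (ae_of_all _ fun q => mul_nonneg (weight_nonneg hρ _ _) (sq_nonneg _))]
  refine lintegral_congr fun q => ?_
  rw [ENNReal.ofReal_mul (weight_nonneg hρ _ _), ofReal_weight hρ, mixWeight,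
    ENNReal.ofReal_pow (norm_nonneg _), ofReal_norm]

end State

/-! ### Multiplication operators -/

section Trace

variable {N d : ℕ} [NeZero N] {P : Measure (Config N d)} [IsProbabilityMeasure P]
  {ρ χ : Space d → ℝ} {ε α : ℝ}

/-- The position densities of `Γ^{1/2} bᵢ` sum up to the regularized measure: `exists_trace_formula`
for the restriction to a measurable set `A`. -/
theorem sum_withDensity_sqrt_quantumState (hη : IsCutoff (rescale χ ε) ε) (hα : 4 * ε < α)
    (hP : IsSymmetricMeasure P) (hρ : IsMarginalDensity P ρ)
    (hsupp : P (separated N d α)ᶜ = 0) (h2 : MemLp (fun x => Real.sqrt (ρ x)) 2 volume)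
    {ι : Type*} (b : HilbertBasis ι ℂ (Fermionic N d)) :
    Measure.sum (fun i => volume.withDensity fun X =>
      ‖(CFC.sqrt (quantumState P ρ χ ε) (b i)).toL2 X‖ₑ ^ 2) = regularizedMeasure P ρ χ ε := by
  have hd := hρ.isDensity
  have hint := integrable_stateIntegrand hη hα hP hρ hsupp h2
  have hΓ := quantumState_nonneg hd hint
  refine Measure.ext fun A hA => ?_
  rw [Measure.sum_apply _ hA]
  simp only [withDensity_apply _ hA]
  -- the restriction of a wave function to `A`
  let R : Fermionic N d →L[ℂ] Lp ℂ 2 ((volume : Measure (Config N d)).restrict A) :=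
    (LpToLpRestrictCLM (Config N d) ℂ ℂ volume 2 A).comp (fermionicIncl N d)
  have hR : ∀ ψ : Fermionic N d, ‖R ψ‖ₑ ^ 2 = ∫⁻ X in A, ‖ψ.toL2 X‖ₑ ^ 2 := by
    intro ψ
    rw [enorm_Lp_two_sq]
    refine lintegral_congr_ae ?_
    filter_upwards [LpToLpRestrictCLM_coeFn ℂ A ψ.toL2] with X hX
    rw [← hX]
    rfl
  have hRΨ : ∀ Z : Config N d, ‖R (trialVector ρ χ ε Z)‖ₑ ^ 2
      = ∫⁻ X in A, ‖slaterAt (fun _ => orbital ρ (rescale χ ε)) Z X‖ₑ ^ 2 := by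
    intro Z
    rw [hR, trialVector_toL2 (memLp_trial hη h2 Z)]
    refine lintegral_congr_ae (ae_restrict_of_ae ?_)
    filter_upwards [coeFn_ofRealLp (memLp_trial hη h2 Z)] with X hX
    rw [hX]
    congr 1
    simp [enorm_eq_nnnorm]
  have hmass := lintegral_mixWeight_mul_setLIntegral hη hα hP hd hsupp hA
  simp only [← hRΨ] at hmass
  have hprob := isProbabilityMeasure_regularizedMeasure hη hP hρ
  have hmeas : ∀ x, Measurable fun q : Config N d × Config N d =>
      inner ℂ x (R (trialVector ρ χ ε q.2)) := fun x =>
    (stronglyMeasurable_const.inner (R.continuous.comp_stronglyMeasurable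
      ((stronglyMeasurable_trialVector hη hd h2).comp_measurable measurable_snd))).measurable
  obtain ⟨G, hG, hsum⟩ := exists_trace_formula (μ := P.prod volume)
    (hη.measurable_mixWeight (N := N) hd) hΓ
    (fun x => ofReal_inner_quantumState hd hint x) hmeas
    LinearMap.id Function.surjective_id.denseRange (ContinuousLinearMap.adjoint R).toLinearMap
    (fun v => ae_of_all _ fun q _ => R.adjoint_inner_right _ _)
    (by rw [hmass]; exact measure_ne_top _ _) b
  rw [← hmass, ← hsum]
  refine tsum_congr fun i => ?_
  rw [← hR]
  congr 2
  refine ext_inner_right ℂ fun v => ?_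
  exact (R.adjoint_inner_right _ _).symm.trans (hG i v)

theorem hasMulTrace_quantumState (hη : IsCutoff (rescale χ ε) ε) (hα : 4 * ε < α)
    (hP : IsSymmetricMeasure P) (hρ : IsMarginalDensity P ρ)
    (hsupp : P (separated N d α)ᶜ = 0) (h2 : MemLp (fun x => Real.sqrt (ρ x)) 2 volume)
    {ι : Type*} (b : HilbertBasis ι ℂ (Fermionic N d)) {Φ : Config N d → ℝ}
    (hΦ : Integrable Φ (regularizedMeasure P ρ χ ε)) :
    HasMulTrace b Φ (quantumState P ρ χ ε) (∫ X, Φ X ∂(regularizedMeasure P ρ χ ε)) := by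
  rw [← sum_withDensity_sqrt_quantumState hη hα hP hρ hsupp h2 b] at hΦ ⊢
  obtain ⟨ψ, hψ⟩ : ∃ ψ : ι → Lp ℂ 2 (volume : Measure (Config N d)), ∀ i,
    ψ i = (CFC.sqrt (quantumState P ρ χ ε) (b i)).toL2 := ⟨_, fun _ => rfl⟩
  unfold HasMulTrace
  simp only [← hψ] at hΦ ⊢
  have hm : ∀ i, Measurable fun X => ‖ψ i X‖ₑ ^ 2 := fun i =>
    (Lp.stronglyMeasurable (ψ i)).measurable.enorm.pow_const 2
  have hfin : ∀ i, ∀ᵐ X, ‖ψ i X‖ₑ ^ 2 < ⊤ := fun i =>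
    ae_of_all _ fun X => ENNReal.pow_lt_top enorm_lt_top
  have hreal : ∀ i X, (‖ψ i X‖ₑ ^ 2).toReal = ‖ψ i X‖ ^ 2 := fun i X => by
    rw [ENNReal.toReal_pow, toReal_enorm]
  have hi : ∀ i (f : Config N d → ℝ), ∫ X, f X ∂(volume.withDensity fun X => ‖ψ i X‖ₑ ^ 2)
      = ∫ X, f X * ‖ψ i X‖ ^ 2 := by
    intro i f
    rw [integral_withDensity_eq_integral_toReal_smul (hm i) (hfin i)]
    exact integral_congr_ae (ae_of_all _ fun X => by
      simp only [hreal, smul_eq_mul, mul_comm])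
  refine ⟨fun i => ?_, ?_, ?_⟩
  · have h1 := hΦ.mono_measure (Measure.le_sum _ i)
    rw [integrable_withDensity_iff_integrable_smul' (hm i) (hfin i)] at h1
    exact h1.congr (ae_of_all _ fun X => by simp only [hreal, smul_eq_mul, mul_comm])
  · have h1 := (hasSum_integral_measure hΦ.norm).summable
    simp only [hi, Real.norm_eq_abs] at h1
    exact h1
  · have h1 := hasSum_integral_measure hΦ
    simp only [hi] at h1
    exact h1

theorem hasSum_inner_quantumState (hη : IsCutoff (rescale χ ε) ε) (hα : 4 * ε < α)
    (hP : IsSymmetricMeasure P) (hρ : IsMarginalDensity P ρ)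
    (hsupp : P (separated N d α)ᶜ = 0) (h2 : MemLp (fun x => Real.sqrt (ρ x)) 2 volume)
    {ι : Type*} (b : HilbertBasis ι ℂ (Fermionic N d)) :
    HasSum (fun i => inner ℂ (b i) (quantumState P ρ χ ε (b i))) 1 := by
  have hprob := isProbabilityMeasure_regularizedMeasure hη hP hρ
  have hΓ := quantumState_nonneg hρ.isDensity (integrable_stateIntegrand hη hα hP hρ hsupp h2)
  have h1 := (hasMulTrace_quantumState hη hα hP hρ hsupp h2 b (integrable_const (1 : ℝ))).2.2
  simp only [integral_const, one_mul, probReal_univ, one_smul] at h1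
  rw [← Complex.hasSum_ofReal, Complex.ofReal_one] at h1
  convert! h1 using 2 with i
  rw [inner_apply_eq_norm_sqrt_sq hΓ]
  congr 1
  set ψ := CFC.sqrt (quantumState P ρ χ ε) (b i)
  have h3 : ‖ψ‖ ^ 2 = (‖ψ.toL2‖ₑ ^ 2).toReal := by
    rw [enorm_toL2, ENNReal.toReal_pow, toReal_enorm]
  rw [h3, enorm_Lp_two_sq, integral_eq_lintegral_of_nonneg_ae (ae_of_all _ fun _ => sq_nonneg _)
    ((Lp.stronglyMeasurable _).norm.pow 2).aestronglyMeasurable]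
  congr 1
  refine lintegral_congr fun X => ?_
  rw [ENNReal.ofReal_pow (norm_nonneg _), ofReal_norm]

theorem hasOneParticleDensity_quantumState (hη : IsCutoff (rescale χ ε) ε) (hα : 4 * ε < α)
    (hP : IsSymmetricMeasure P) (hρ : IsMarginalDensity P ρ)
    (hsupp : P (separated N d α)ᶜ = 0) (h2 : MemLp (fun x => Real.sqrt (ρ x)) 2 volume)
    {ι : Type*} (b : HilbertBasis ι ℂ (Fermionic N d)) :
    HasOneParticleDensity b (quantumState P ρ χ ε) ρ := by
  refine ⟨hρ.isDensity.integrable, fun φ hφ => ?_⟩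
  have hmap := regularizedMeasure_map_eval hη hP hρ 0
  have hprob := isProbabilityMeasure_regularizedMeasure hη hP hρ
  have hprob' : IsProbabilityMeasure (volume.withDensity fun x => ENNReal.ofReal (ρ x)) := by
    rw [← hmap]
    exact Measure.isProbabilityMeasure_map (measurable_pi_apply 0).aemeasurable
  have hac := withDensity_absolutelyContinuous (volume : Measure (Space d))
    fun x => ENNReal.ofReal (ρ x)
  have hφi : Integrable φ (volume.withDensity fun x => ENNReal.ofReal (ρ x)) := by
    have h3 : ∀ᵐ x, ‖φ x‖ ≤ (eLpNormEssSup φ volume).toReal := by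
      filter_upwards [ae_le_eLpNormEssSup (f := φ) (μ := volume)] with x hx
      rw [← toReal_enorm]
      refine ENNReal.toReal_mono ?_ hx
      rw [← eLpNorm_exponent_top]
      exact hφ.2.ne
    exact Integrable.of_bound (hφ.1.mono_ac hac) _ (hac.ae_le h3)
  have hφm : AEStronglyMeasurable φ
      ((regularizedMeasure P ρ χ ε).map fun X : Config N d => X 0) := by
    rw [hmap]
    exact hφi.1
  have h4 : Integrable (fun X : Config N d => φ (X 0)) (regularizedMeasure P ρ χ ε) := by
    rw [← hmap] at hφi
    exact hφi.comp_measurable (measurable_pi_apply 0)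
  have h5 : ∫ X : Config N d, φ (X 0) ∂(regularizedMeasure P ρ χ ε) = ∫ x, φ x * ρ x := by
    rw [← integral_map (measurable_pi_apply 0).aemeasurable hφm, hmap,
      integral_withDensity_eq_integral_toReal_smul hρ.measurable.ennreal_ofReal
        (ae_of_all _ fun _ => ENNReal.ofReal_lt_top)]
    exact integral_congr_ae (ae_of_all _ fun x => by
      simp only [ENNReal.toReal_ofReal (hρ.nonneg x), smul_eq_mul, mul_comm])
  rw [← h5]
  exact hasMulTrace_quantumState hη hα hP hρ hsupp h2 b h4

end Trace

/-! ### The kinetic energy of the mixed state -/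

section TestFunctions

variable (V : Type*) [NormedAddCommGroup V] [NormedSpace ℝ V]

/-- Smooth compactly supported complex functions. -/
def testFunctions : Submodule ℂ (V → ℂ) where
  carrier := {φ | ContDiff ℝ ∞ φ ∧ HasCompactSupport φ}
  add_mem' h1 h2 := ⟨h1.1.add h2.1, h1.2.add h2.2⟩
  zero_mem' := ⟨contDiff_const, HasCompactSupport.zero⟩
  smul_mem' c _ h := ⟨contDiff_const.smul h.1, h.2.smul_left (f := fun _ => c)⟩

variable {V}

/-- The directional derivative of a test function. -/
noncomputable def testDeriv (v : V) : testFunctions V →ₗ[ℂ] testFunctions V where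
  toFun φ := ⟨fun x => fderiv ℝ φ.1 x v,
    (φ.2.1.fderiv_right (m := ∞) (by simp)).clm_apply contDiff_const, φ.2.2.fderiv_apply ℝ v⟩
  map_add' φ ψ := by
    ext x
    have h1 := φ.2.1.differentiable (by simp) x
    have h2 := ψ.2.1.differentiable (by simp) x
    simp [fderiv_add h1 h2]
  map_smul' c φ := by
    ext x
    have h1 := φ.2.1.differentiable (by simp) x
    simp [fderiv_const_smul h1]

variable [MeasureSpace V] [BorelSpace V] [IsFiniteMeasureOnCompacts (volume : Measure V)]

theorem memLp_testFunction (φ : testFunctions V) : MemLp φ.1 2 (volume : Measure V) :=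
  φ.2.1.continuous.memLp_of_hasCompactSupport φ.2.2

/-- Test functions as elements of `L²`. -/
noncomputable def testToLp : testFunctions V →ₗ[ℂ] Lp ℂ 2 (volume : Measure V) where
  toFun φ := (memLp_testFunction φ).toLp φ.1
  map_add' φ ψ := (memLp_testFunction φ).toLp_add (memLp_testFunction ψ)
  map_smul' c φ := MemLp.toLp_const_smul (f := φ.1) c (memLp_testFunction φ)

theorem coeFn_testToLp (φ : testFunctions V) : testToLp φ =ᵐ[volume] φ.1 :=
  (memLp_testFunction φ).coeFn_toLp

/-- Real weak derivatives can be tested with complex functions. -/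
theorem IsWeakLineDeriv.inner_ofRealLp {f g : V → ℝ} {v : V} (h : IsWeakLineDeriv v f g)
    (hf : MemLp f 2 volume) (hg : MemLp g 2 volume) (φ : testFunctions V) :
    inner ℂ (ofRealLp hf) (testToLp (testDeriv v φ)) = - inner ℂ (ofRealLp hg) (testToLp φ) := by
  have hφd : Differentiable ℝ φ.1 := φ.2.1.differentiable (by simp)
  have hre : ContDiff ℝ ∞ fun x => (φ.1 x).re := Complex.reCLM.contDiff.comp φ.2.1
  have him : ContDiff ℝ ∞ fun x => (φ.1 x).im := Complex.imCLM.contDiff.comp φ.2.1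
  have hrec : HasCompactSupport fun x => (φ.1 x).re := φ.2.2.comp_left Complex.zero_re
  have himc : HasCompactSupport fun x => (φ.1 x).im := φ.2.2.comp_left Complex.zero_im
  have dre : ∀ x, fderiv ℝ (fun x => (φ.1 x).re) x v = (fderiv ℝ φ.1 x v).re := fun x =>
    congrArg (fun L : V →L[ℝ] ℝ => L v)
      ((Complex.reCLM.hasFDerivAt (x := φ.1 x)).comp x (hφd x).hasFDerivAt).fderiv
  have dim : ∀ x, fderiv ℝ (fun x => (φ.1 x).im) x v = (fderiv ℝ φ.1 x v).im := fun x =>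
    congrArg (fun L : V →L[ℝ] ℝ => L v)
      ((Complex.imCLM.hasFDerivAt (x := φ.1 x)).comp x (hφd x).hasFDerivAt).fderiv
  have e1 := h.integral_eq _ hre hrec
  have e2 := h.integral_eq _ him himc
  simp only [dre, dim, smul_eq_mul] at e1 e2
  have key : ∀ (u : V → ℝ) (hu : MemLp u 2 volume) (θ : testFunctions V),
      inner ℂ (ofRealLp hu) (testToLp θ) = ((∫ x, (θ.1 x).re * u x : ℝ) : ℂ)
        + ((∫ x, (θ.1 x).im * u x : ℝ) : ℂ) * Complex.I := by
    intro u hu θ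
    have i1 : Integrable fun x => (θ.1 x).re * u x :=
      (MemLp.re (memLp_testFunction θ)).integrable_mul hu
    have i2 : Integrable fun x => (θ.1 x).im * u x :=
      (MemLp.im (memLp_testFunction θ)).integrable_mul hu
    rw [L2.inner_def, ← integral_complex_ofReal, ← integral_complex_ofReal, ← integral_mul_const,
      ← integral_add i1.ofReal (i2.ofReal.mul_const _)]
    refine integral_congr_ae ?_
    filter_upwards [coeFn_ofRealLp hu, coeFn_testToLp θ] with x h1 h2
    rw [h1, h2, RCLike.inner_apply, Complex.conj_ofReal]
    apply Complex.ext <;> simp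
  rw [key f hf, key g hg]
  have e1' : ∫ x, ((testDeriv v φ).1 x).re * f x = - ∫ x, (φ.1 x).re * g x := e1
  have e2' : ∫ x, ((testDeriv v φ).1 x).im * f x = - ∫ x, (φ.1 x).im * g x := e2
  rw [e1', e2']
  push_cast
  ring

variable [FiniteDimensional ℝ V]

/-- Complex test functions determine the weak derivative. -/
theorem isWeakLineDeriv_of_inner {ψ G : Lp ℂ 2 (volume : Measure V)} {v : V}
    (h : ∀ φ : testFunctions V,
      inner ℂ ψ (testToLp (testDeriv v φ)) = - inner ℂ G (testToLp φ)) :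
    IsWeakLineDeriv v ψ G := by
  refine ⟨(Lp.memLp ψ).locallyIntegrable (by norm_num), (Lp.memLp G).locallyIntegrable
    (by norm_num), fun φ h1 h2 => ?_⟩
  let θ : testFunctions V := ⟨fun x => (φ x : ℂ), Complex.ofRealCLM.contDiff.comp h1,
    h2.comp_left Complex.ofReal_zero⟩
  have hθ : ∀ x, (testDeriv v θ).1 x = ((fderiv ℝ φ x v : ℝ) : ℂ) := fun x =>
    congrArg (fun L : V →L[ℝ] ℂ => L v) ((Complex.ofRealCLM.hasFDerivAt (x := φ x)).comp x
      (h1.differentiable (by simp) x).hasFDerivAt).fderiv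
  have e := congrArg (starRingEnd ℂ) (h θ)
  rw [map_neg, inner_conj_symm, inner_conj_symm, L2.inner_def, L2.inner_def] at e
  have e1 : ∫ x, inner ℂ (testToLp (testDeriv v θ) x) (ψ x) = ∫ x, fderiv ℝ φ x v • ψ x := by
    refine integral_congr_ae ?_
    filter_upwards [coeFn_testToLp (testDeriv v θ)] with x hx
    rw [hx, hθ, RCLike.inner_apply, Complex.conj_ofReal, mul_comm, Complex.real_smul]
  have e2 : ∫ x, inner ℂ (testToLp θ x) (G x) = ∫ x, φ x • G x := by
    refine integral_congr_ae ?_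
    filter_upwards [coeFn_testToLp θ] with x hx
    rw [hx, RCLike.inner_apply, Complex.conj_ofReal, mul_comm, Complex.real_smul]
  rw [e1, e2] at e
  exact e

theorem denseRange_testToLp : DenseRange (testToLp (V := V)) := by
  refine (Lp.dense_hasCompactSupport_contDiff (μ := (volume : Measure V)) (F := ℂ)
    (p := 2) ENNReal.ofNat_ne_top).mono ?_
  rintro f ⟨g, hfg, hg1, hg2⟩
  refine ⟨⟨g, hg2, hg1⟩, Lp.ext ?_⟩
  exact (coeFn_testToLp _).trans hfg.symm

end TestFunctions

section Kinetic

variable {N d : ℕ}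

/-- The coordinate `x ↦ (x_j)_a` on configurations. -/
noncomputable def coordinate (p : Fin N × Fin d) : Config N d →L[ℝ] ℝ :=
  (EuclideanSpace.proj p.2).comp (ContinuousLinearMap.proj p.1)

theorem eq_sum_coordinate (X : Config N d) :
    X = ∑ p : Fin N × Fin d, coordinate p X •
      (Pi.single p.1 (EuclideanSpace.single p.2 (1 : ℝ)) : Config N d) := by
  funext j
  rw [Fintype.sum_prod_type, Finset.sum_apply, Finset.sum_eq_single j]
  · ext a
    simp [coordinate, Finset.sum_apply, Pi.single_apply]
  · intro k _ hk
    simp [Finset.sum_apply, hk.symm]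
  · simp

theorem coordinate_single (p q : Fin N × Fin d) :
    coordinate p (Pi.single q.1 (EuclideanSpace.single q.2 (1 : ℝ)) : Config N d)
      = if p = q then 1 else 0 := by
  obtain ⟨j, a⟩ := p
  obtain ⟨k, c⟩ := q
  by_cases hj : j = k
  · subst hj
    simp [coordinate]
  · simp [coordinate, hj]

/-- The kinetic form through the partial derivatives in the standard basis. -/
theorem kineticForm_eq_sum {ψ : Config N d → ℂ}
    {G : Fin N → Fin d → Lp ℂ 2 (volume : Measure (Config N d))}
    (hψ : LocallyIntegrable ψ volume)
    (h : ∀ j a, IsWeakLineDeriv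
      (Pi.single j (EuclideanSpace.single a (1 : ℝ)) : Config N d) ψ (G j a)) :
    kineticForm ψ = ∑ j, ∑ a, ‖G j a‖ₑ ^ 2 := by
  rw [kineticForm_eq (hasWeakFDeriv_of_basis coordinate eq_sum_coordinate hψ
    (g := fun p X => G p.1 p.2 X) fun p => h p.1 p.2)]
  have e : ∀ X j a, (∑ p : Fin N × Fin d, (coordinate p).smulRight (G p.1 p.2 X))
      (Pi.single j (EuclideanSpace.single a (1 : ℝ))) = G j a X := by
    intro X j a
    rw [sum_apply, Finset.sum_eq_single (j, a)]
    · rw [ContinuousLinearMap.smulRight_apply, coordinate_single _ (j, a)]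
      simp
    · intro p _ hp
      rw [ContinuousLinearMap.smulRight_apply, coordinate_single _ (j, a), if_neg hp, zero_smul]
    · simp
  simp only [e]
  have hm : ∀ j a, Measurable fun X => ‖G j a X‖ₑ ^ 2 := fun j a =>
    (Lp.stronglyMeasurable (G j a)).measurable.enorm.pow_const 2
  rw [lintegral_finsetSum _ fun j _ => Finset.measurable_fun_sum _ fun a _ => hm j a]
  refine Finset.sum_congr rfl fun j _ => ?_
  rw [lintegral_finsetSum _ fun a _ => hm j a]
  exact Finset.sum_congr rfl fun a _ => (enorm_Lp_two_sq _).symm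

variable [NeZero N] {P : Measure (Config N d)} [IsProbabilityMeasure P]
  {ρ χ : Space d → ℝ} {ε α : ℝ}

/-- The kinetic energy against `Γ^{1/2} bᵢ` is that of the mixture: `exists_trace_formula` for each
partial derivative. That `Γ^{1/2} bᵢ` has a weak derivative is part of its conclusion. -/
theorem kineticTrace_quantumState (hη : IsCutoff (rescale χ ε) ε) (hα : 4 * ε < α)
    (hP : IsSymmetricMeasure P) (hρ : IsMarginalDensity P ρ)
    (hsupp : P (separated N d α)ᶜ = 0) (h2 : MemLp (fun x => Real.sqrt (ρ x)) 2 volume)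
    {G : Space d → Space d →L[ℝ] ℝ}
    (hGm : StronglyMeasurable G) (hG : HasWeakFDeriv (fun x => Real.sqrt (ρ x)) G)
    (hG2 : MemLp G 2 volume) {ι : Type*} (b : HilbertBasis ι ℂ (Fermionic N d)) :
    kineticTrace b (quantumState P ρ χ ε) = ENNReal.ofReal
      (N * ((∫ x, ‖G x‖ ^ 2) + ∫ u, ‖fderiv ℝ (rescale χ ε) u‖ ^ 2)) := by
  have hd := hρ.isDensity
  have hint := integrable_stateIntegrand hη hα hP hρ hsupp h2
  have hΓ := quantumState_nonneg hd hint
  have hmo : Measurable fun p : Space d × Space d => orbital ρ (rescale χ ε) p.1 p.2 :=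
    hη.measurable_orbital_comp hρ.measurable measurable_fst measurable_snd
  have hmd : ∀ v, Measurable fun p : Space d × Space d =>
      orbitalDeriv ρ G (rescale χ ε) v p.1 p.2 := fun v =>
    hη.measurable_orbitalDeriv_comp hρ.measurable hGm v measurable_fst measurable_snd
  have hE := sum_lintegral_mixWeight_mul_deriv_sq hη hα hP hρ hsupp hGm hG hG2
  let o : Fin N → Fin d → Fin N → Space d → Space d → ℝ := fun j a =>
    Function.update (fun _ => orbital ρ (rescale χ ε)) j
      (orbitalDeriv ρ G (rescale χ ε) (EuclideanSpace.single a 1))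
  have ho : ∀ j a k, Measurable fun p : Space d × Space d => o j a k p.1 p.2 := by
    intro j a k
    by_cases h : k = j
    · subst h
      simpa [o] using hmd _
    · simpa only [o, Function.update_of_ne h] using hmo
  have hoL : ∀ j a k z, MemLp (o j a k z) 2 volume := by
    intro j a k z
    by_cases h : k = j
    · subst h
      simpa [o] using hη.memLp_orbitalDeriv h2 hG2 _ z
    · simpa only [o, Function.update_of_ne h] using hη.memLp_orbital h2 z
  have hSL : ∀ j a (Z : Config N d), MemLp (slaterAt (o j a) Z) 2 volume := fun j a Z =>
    memLp_slaterAt (hoL j a) Z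
  let Ψ' : Fin N → Fin d → Config N d × Config N d → Lp ℂ 2 (volume : Measure (Config N d)) :=
    fun j a q => ofRealLp (hSL j a q.2)
  have hE' : ∑ j, ∑ a, ∫⁻ q, mixWeight ρ (rescale χ ε) q * ‖Ψ' j a q‖ₑ ^ 2 ∂(P.prod volume)
      = ENNReal.ofReal (N * ((∫ x, ‖G x‖ ^ 2) + ∫ u, ‖fderiv ℝ (rescale χ ε) u‖ ^ 2)) := by
    rw [← hE]
    simp only [Ψ', enorm_ofRealLp_sq]
    rfl
  have hfin : ∀ j a,
      ∫⁻ q, mixWeight ρ (rescale χ ε) q * ‖Ψ' j a q‖ₑ ^ 2 ∂(P.prod volume) ≠ ⊤ := by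
    intro j a htop
    have h1 : ∑ j, ∑ a, ∫⁻ q, mixWeight ρ (rescale χ ε) q * ‖Ψ' j a q‖ₑ ^ 2
        ∂(P.prod volume) = ⊤ :=
      ENNReal.sum_eq_top.2 ⟨j, Finset.mem_univ j, ENNReal.sum_eq_top.2 ⟨a, Finset.mem_univ a, htop⟩⟩
    rw [hE'] at h1
    exact ENNReal.ofReal_ne_top h1
  have hex : ∀ j a, ∃ D : ι → Lp ℂ 2 (volume : Measure (Config N d)),
      (∀ i, IsWeakLineDeriv (Pi.single j (EuclideanSpace.single a (1 : ℝ)) : Config N d)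
        (CFC.sqrt (quantumState P ρ χ ε) (b i)).toL2 (D i)) ∧
      ∑' i, ‖D i‖ₑ ^ 2
        = ∫⁻ q, mixWeight ρ (rescale χ ε) q * ‖Ψ' j a q‖ₑ ^ 2 ∂(P.prod volume) := by
    intro j a
    have hmeas : ∀ x, Measurable fun q : Config N d × Config N d => inner ℂ x (Ψ' j a q) :=
      fun x => measurable_inner_ofRealLp (fun q : Config N d × Config N d => hSL j a q.2)
        (measurable_slaterAt (ho j a) measurable_fst.snd measurable_snd) x
    -- `A φ` is the projection of `-∂φ` to the antisymmetric functions, whence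
    -- `⟨Ψ, A φ⟩ = -⟨Ψ, ∂φ⟩ = ⟨∂Ψ, φ⟩`
    let A : testFunctions (Config N d) →ₗ[ℂ] Fermionic N d :=
      -((ContinuousLinearMap.adjoint (fermionicIncl N d)).toLinearMap ∘ₗ testToLp ∘ₗ
        testDeriv (Pi.single j (EuclideanSpace.single a 1)))
    have hAinner : ∀ (ψ : Fermionic N d) φ, inner ℂ ψ (A φ) = - inner ℂ ψ.toL2
        (testToLp (testDeriv (Pi.single j (EuclideanSpace.single a 1)) φ)) := by
      intro ψ φ
      refine (inner_neg_right _ _).trans (congrArg Neg.neg ?_)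
      exact (fermionicIncl N d).adjoint_inner_right _ _
    obtain ⟨D, hD, hsum⟩ := exists_trace_formula (μ := P.prod volume)
      (hη.measurable_mixWeight (N := N) hd) hΓ
      (fun x => ofReal_inner_quantumState hd hint x) hmeas testToLp denseRange_testToLp A
      (fun φ => ae_of_all _ fun q _ => by
        rw [hAinner, trialVector_toL2 (memLp_trial hη h2 q.2),
          (isWeakLineDeriv_slaterAt (fun z => hη.memLp_orbital h2 z)
            (fun z => hη.memLp_orbitalDeriv h2 hG2 _ z)
            (fun z => hη.isWeakLineDeriv_orbital hG _ z) j q.2).inner_ofRealLp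
            (memLp_trial hη h2 q.2) (hSL j a q.2) φ, neg_neg])
      (hfin j a) b
    refine ⟨D, fun i => isWeakLineDeriv_of_inner fun φ => ?_, hsum⟩
    rw [← hD i φ, hAinner, neg_neg]
  choose D hD hsum using hex
  have hk : ∀ i, kineticForm (CFC.sqrt (quantumState P ρ χ ε) (b i)).toL2
      = ∑ j, ∑ a, ‖D j a i‖ₑ ^ 2 := fun i =>
    kineticForm_eq_sum ((Lp.memLp _).locallyIntegrable (by norm_num)) fun j a => hD j a i
  rw [kineticTrace, ← hE']
  simp only [hk]
  rw [Summable.tsum_finsetSum fun j _ => ENNReal.summable]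
  refine Finset.sum_congr rfl fun j _ => ?_
  rw [Summable.tsum_finsetSum fun a _ => ENNReal.summable]
  exact Finset.sum_congr rfl fun a _ => hsum j a

end Kinetic

theorem theorem1 {N d : ℕ} [NeZero N] (hd : 0 < d)
    (χ : Space d → ℝ) (hχ_smooth : ContDiff ℝ ∞ χ)
    (hχ_radial : ∀ x y : Space d, ‖x‖ = ‖y‖ → χ x = χ y)
    (hχ_supp : Function.support χ ⊆ Metric.closedBall 0 1)
    (hχ_norm : ∫ x, χ x ^ 2 = 1)
    (P : Measure (Config N d)) [IsProbabilityMeasure P] (hP_symm : IsSymmetricMeasure P)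
    (α : ℝ) (hα : 0 < α) (hP_supp : P (separated N d α)ᶜ = 0)
    (ρ : Space d → ℝ) (hρ : IsMarginalDensity P ρ)
    (hρ_H1 : MemH1 (fun x => Real.sqrt (ρ x))) :
    (∀ ε : ℝ, 0 < ε → ε < α / 4 →
      -- the integral that defines `Γ_ε` converges, and `Γ_ε` is a state of density `ρ`
      Integrable (stateIntegrand (N := N) ρ χ ε) (P.prod volume) ∧
      0 ≤ quantumState P ρ χ ε ∧
      -- `P_ε` is a probability on the configurations with distances at least `α - 4ε`
      IsProbabilityMeasure (regularizedMeasure P ρ χ ε) ∧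
      regularizedMeasure P ρ χ ε (separated N d (α - 4 * ε))ᶜ = 0 ∧
      ∀ {ι : Type} (b : HilbertBasis ι ℂ (Fermionic N d)),
        HasSum (fun i => inner ℂ (b i) (quantumState P ρ χ ε (b i))) 1 ∧
        HasOneParticleDensity b (quantumState P ρ χ ε) ρ ∧
        -- the kinetic energy
        kineticTrace b (quantumState P ρ χ ε) =
          ENNReal.ofReal (N * ((∫ x, ‖weakFDeriv (fun x => Real.sqrt (ρ x)) x‖ ^ 2)
            + 1 / ε ^ 2 * ∫ x, ‖fderiv ℝ χ x‖ ^ 2)) ∧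
        -- the potential energy
        (∃ G, HasWeakFDeriv ρ G) ∧ Integrable (weakFDeriv ρ) volume ∧
        ∀ Φ : Config N d → ℝ,
          ContDiffOn ℝ 2 Φ (separated N d (α - 4 * ε)) →
          IsSymmetricOn (separated N d (α - 4 * ε)) Φ →
          (Integrable Φ (regularizedMeasure P ρ χ ε) →
            HasMulTrace b Φ (quantumState P ρ χ ε) (∫ X, Φ X ∂(regularizedMeasure P ρ χ ε))) ∧
          ((∀ j, supNorm (separated N d (α - 4 * ε))
              (gradWithin (separated N d (α - 4 * ε)) j Φ) < ⊤) →
            (Integrable Φ (regularizedMeasure P ρ χ ε) ↔ Integrable Φ P)) ∧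
          (Integrable Φ (regularizedMeasure P ρ χ ε) → Integrable Φ P →
            ENNReal.ofReal |(∫ X, Φ X ∂(regularizedMeasure P ρ χ ε)) - ∫ X, Φ X ∂P| ≤
              ENNReal.ofReal (ε ^ 2) *
                ((∑ j, supNorm (separated N d (α - 4 * ε))
                      (gradWithin (separated N d (α - 4 * ε)) j Φ)
                    * ENNReal.ofReal (∫ x, ‖weakFDeriv ρ x‖)
                    * ENNReal.ofReal (∫ u, ‖u‖ ^ 2 * χ u ^ 2))
                  + 2 * ∑ j, ∑ k, supNorm (separated N d (α - 4 * ε))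
                      (gradWithin (separated N d (α - 4 * ε)) j
                        (gradWithin (separated N d (α - 4 * ε)) k Φ))))) ∧
    -- weak convergence of `P_ε` to `P` as `ε → 0`
    ∀ f : BoundedContinuousFunction (Config N d) ℝ,
      Tendsto (fun ε : ℝ => ∫ X, f X ∂(regularizedMeasure P ρ χ ε)) (𝓝[>] 0)
        (𝓝 (∫ X, f X ∂P)) := by 
  have hη : ∀ ε : ℝ, 0 < ε → IsCutoff (rescale χ ε) ε := fun ε hε =>
    isCutoff_rescale hε hχ_smooth hχ_radial hχ_supp hχ_norm
  have hχ : IsCutoff χ 1 :=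
    { contDiff := hχ_smooth
      even := fun x => hχ_radial _ _ (norm_neg x)
      norm_le := fun x hx => by simpa using hχ_supp hx
      integral_sq := hχ_norm }
  obtain ⟨G, hGm, hG, hG2⟩ := hρ_H1.exists_stronglyMeasurable
  obtain ⟨hD, hDi, hDm⟩ :=
    hasWeakFDeriv_of_sqrt hρ.measurable hρ.nonneg hρ_H1.1 hGm hG hG2
  have hDw := ae_eq_weakFDeriv hD
  refine ⟨fun ε hε hεα => ?_, fun f => tendsto_integral_regularizedMeasure hη hP_symm hρ f⟩
  have hα4 : 4 * ε < α := by linarith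
  have hint := integrable_stateIntegrand (hη ε hε) hα4 hP_symm hρ hP_supp hρ_H1.1
  refine ⟨hint, quantumState_nonneg hρ.isDensity hint,
    isProbabilityMeasure_regularizedMeasure (hη ε hε) hP_symm hρ,
    regularizedMeasure_compl_separated (hη ε hε) hP_symm hρ hP_supp, fun b => ?_⟩
  refine ⟨hasSum_inner_quantumState (hη ε hε) hα4 hP_symm hρ hP_supp hρ_H1.1 b,
    hasOneParticleDensity_quantumState (hη ε hε) hα4 hP_symm hρ hP_supp hρ_H1.1 b,
    ?_, ⟨_, hD⟩, hDi.congr hDw.symm, fun Φ hΦ _ => ⟨fun hΦi =>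
      hasMulTrace_quantumState (hη ε hε) hα4 hP_symm hρ hP_supp hρ_H1.1 b hΦi,
      fun hgrad => integrable_regularizedMeasure_iff (hη ε hε) hε hP_symm hρ hP_supp hΦ hgrad,
      fun h1 h2 => ?_⟩⟩
  · rw [kineticTrace_quantumState (hη ε hε) hα4 hP_symm hρ hP_supp hρ_H1.1 hGm hG hG2 b,
      integral_norm_fderiv_rescale_sq hε hχ_smooth]
    have e : ∫ x, ‖weakFDeriv (fun x => Real.sqrt (ρ x)) x‖ ^ 2 = ∫ x, ‖G x‖ ^ 2 :=
      integral_congr_ae ((ae_eq_weakFDeriv hG).mono fun x hx => by simp only [hx])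
    rw [e]
  · have e : ∫ x, ‖weakFDeriv ρ x‖ = ∫ x, ‖(2 * Real.sqrt (ρ x)) • G x‖ :=
      integral_congr_ae (hDw.mono fun x hx => by simp only [hx])
    rw [e]
    exact ofReal_abs_integral_sub_le hd hχ (hη ε hε) hε hεα hP_symm hρ hP_supp hD hDi hDm hΦ h1 h2
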